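/- Let $k$ be an algebraically closed field of characteristic $0$, let $n\ge 0$ be an integer, and let $\mathfrak{G}=\mathfrak{sl}_2(k)\otimes k[t]$ be the Lie algebra with bracket $[x(a),y(b)]=[x,y](ab)$, where $x(a)=x\otimes a$; let $\{e,f,h\}$ be the standard basis of $\mathfrak{sl}_2(k)$. For a vector space $M$ with a linear map $\rho:k[t]\to\mathrm{End}(M)$ such that the operators $\rho(a)$ commute with each other, let $V(M)=U(\mathfrak{G})\otimes_{U(h\otimes k[t]\,\oplus\, e\otimes k[t])}M$, where $h(a)$ acts on $M$ by $\rho(a)$ and $e(a)$ acts by $0$. For an integer $\ell$ let $V(M)_\ell=\{v\in V(M): h(1)v=\ell v\}$. The Weyl module is $$\Delta_n(M)=V(M)\Big/\,U(\mathfrak{G})\sum_{\ell<-n}V(M)_\ell .$$ Let $\mathcal{U}_n(k[t])$ be the quotient of the tensor algebra $T(k[t])$ by the two-sided ideal generated by the following elements, for all $a,b,c\in k[t]$: the difference between the element $1\in k[t]$ (in tensor degree one) and $n$ times the unit of $T(k[t])$; $a\otimes a^2-a^2\otimes a$; $[[a,b],c]-4\,\partial_{a,b}c$, where the outer brackets are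 commutators in $T(k[t])$ and $\partial_{a,b}c=a(bc)-b(ac)$ (which is $0$ here); and $\sum_{\sigma\vdash n+1}\mathrm{sgn}(\sigma)\,|C_\sigma|\,a^{\sigma_1}\otimes\cdots\otimes a^{\sigma_m}$, where $C_\sigma$ is the conjugacy class in $S_{n+1}$ of the permutations of cycle type $\sigma=(\sigma_1,\dots,\sigma_m)$ and $\mathrm{sgn}(\sigma)$ is their sign. Let $F=k[x_1,\dots,x_n]^{S_n}$, with $\rho:k[t]\to\mathrm{End}(F)$ the linear map for which $\rho(t^\ell)$ is multiplication by the power sum $N_\ell=x_1^\ell+\cdots+x_n^\ell$ ($\ell\ge0$). Let $L$ be the two-dimensional simple $\mathfrak{sl}_2(k)$-module, and let $L[t]=L\otimes k[t]$ be the $\mathfrak{G}$-module with $(x\otimes p)(v\otimes q)=xv\otimes pq$. Let $S^n(L[t])\subset L[t]^{\otimes n}$ be the $\mathfrak{G}$-submodule of symmetric tensors, that is, of the tensors fixed by all permutations of the $n$ factors, for the diagonal action of $\mathfrak{G}$. Then $\rho$ extends to a $\mathcal{U}_n(k[t])$-module structure on $F$, which is free of rank $1$, and the Weyl module $\Delta_n(F)$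 is isomorphic to $S^n(L[t])$ as a $\mathfrak{G}$-module. -/

import Mathlib

open scoped TensorProduct

noncomputable section

namespace JordanWeyl

/-! ### The universal `J`-space envelope of level `n`

In this section `A` is a commutative associative unital algebra, regarded as a Jordan algebra. -/

section Envelope

variable (k : Type*) [Field k] (A : Type*) [CommRing A] [Algebra k A]

/-- The signature of the permutations of cycle type `σ`. -/
def sgn {N : ℕ} (σ : N.Partition) : ℤ := (-1) ^ (N + Multiset.card σ.parts)

/-- The number of permutations of `N` letters of cycle type `σ` (fixed points counted as parts). -/
def classCard {N : ℕ} (σ : N.Partition) : ℕ :=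
  Nat.card {g : Equiv.Perm (Fin N) // g.partition.parts = σ.parts}

variable {A}

/-- The inner derivation `∂_{a,b} = [L_a, L_b]` applied to `c`
(it vanishes, since `A` is associative and commutative). -/
def innerDer (a b c : A) : A := a * (b * c) - b * (a * c)

/-- The tensor `a^{σ₁} ⊗ ⋯ ⊗ a^{σₘ}`, with `σ₁ ≥ ⋯ ≥ σₘ` the parts of `σ`. -/
def partTensor {N : ℕ} (σ : N.Partition) (a : A) : TensorAlgebra k A :=
  ((σ.parts.sort (· ≥ ·)).map fun i => TensorAlgebra.ι k (a ^ i)).prod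

open TensorAlgebra in
/-- The defining relations of the universal `J`-space envelope of level `n`. -/
inductive EnvRel (n : ℕ) : TensorAlgebra k A → TensorAlgebra k A → Prop
  | level : EnvRel n (ι k 1) (n : TensorAlgebra k A)
  | jordan (a : A) : EnvRel n (ι k a * ι k (a ^ 2)) (ι k (a ^ 2) * ι k a)
  | triple (a b c : A) :
      EnvRel n ((ι k a * ι k b - ι k b * ι k a) * ι k c - ι k c * (ι k a * ι k b - ι k b * ι k a))
        ((4 : k) • ι k (innerDer a b c))
  | dominant (a : A) :
      EnvRel n (∑ σ : (n + 1).Partition, (sgn σ * classCard σ) • partTensor k σ a) 0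

variable (A)

/-- The universal `J`-space envelope `U_n(A)` of level `n`. -/
abbrev Envelope (n : ℕ) : Type _ := RingQuot (EnvRel k (A := A) n)

/-- The canonical map `A → U_n(A)`. -/
def Envelope.of (n : ℕ) : A →ₗ[k] Envelope k A n :=
  (RingQuot.mkAlgHom k (EnvRel k n)).toLinearMap ∘ₗ TensorAlgebra.ι k

variable {k A} {M : Type*} [AddCommGroup M] [Module k M]

/-- The action `ρ : A → End M` extends to a left `U_n(A)`-module structure on `M`, and this module
is free of rank `r`. -/
def IsFreeOfRank (n r : ℕ) (ρ : A →ₗ[k] Module.End k M) : Prop :=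
  ∃ R : Envelope k A n →ₐ[k] Module.End k M, (∀ a, R (Envelope.of k A n a) = ρ a) ∧
    ∃ φ : (Fin r → Envelope k A n) ≃ₗ[k] M, ∀ u w, φ (u • w) = R u (φ w)

end Envelope

/-! ### The Lie algebra `sl₂ ⊗ A` and its Weyl modules -/

section Weyl

variable (k : Type*) [Field k] (A : Type*) [CommRing A] [Algebra k A]

/-- The Lie algebra `sl₂(A) = sl₂(k) ⊗ A` over `k`, with `[x(a), y(b)] = [x,y](ab)`. -/
abbrev Current : Type _ := A ⊗[k] LieAlgebra.SpecialLinear.sl (Fin 2) k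

variable {A}

/-- `e(a)`, where `e = !![0, 1; 0, 0]`. -/
def eElt (a : A) : Current k A :=
  a ⊗ₜ[k] LieAlgebra.SpecialLinear.single 0 1 (by decide) (1 : k)

/-- `h(a)`, where `h = !![1, 0; 0, -1]`. -/
def hElt (a : A) : Current k A :=
  a ⊗ₜ[k] LieAlgebra.SpecialLinear.singleSubSingle 0 1 (1 : k)

variable {k} {M : Type*} [AddCommGroup M] [Module k M]

attribute [local instance 100] LieRing.ofAssociativeRing

open UniversalEnvelopingAlgebra in
/-- The relations `u e(a) ⊗ m = 0` and `u h(a) ⊗ m = u ⊗ ρ(a) m` in `U(sl₂(A)) ⊗ M`. -/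
def vermaRel (ρ : A →ₗ[k] Module.End k M) :
    Submodule (UniversalEnvelopingAlgebra k (Current k A))
      (UniversalEnvelopingAlgebra k (Current k A) ⊗[k] M) :=
  Submodule.span _
    ({z | ∃ u a m, z = (u * ι k (eElt k a)) ⊗ₜ[k] m} ∪
     {z | ∃ u a m, z = (u * ι k (hElt k a)) ⊗ₜ[k] m - u ⊗ₜ[k] ρ a m})

/-- The generalized Verma module `V(M) = U(𝔊) ⊗_{U(𝔊₀ ⊕ 𝔊₁)} M`, where `𝔊 = sl₂(A)`,
`𝔊₀ = h ⊗ A` acts on `M` through `ρ`, and `𝔊₁ = e ⊗ A` acts on `M` by zero. -/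
def Verma (ρ : A →ₗ[k] Module.End k M) : Type _ :=
  (UniversalEnvelopingAlgebra k (Current k A) ⊗[k] M) ⧸ vermaRel ρ

namespace Verma

variable (ρ : A →ₗ[k] Module.End k M)

instance : AddCommGroup (Verma ρ) :=
  inferInstanceAs (AddCommGroup (_ ⧸ vermaRel ρ))

instance : Module (UniversalEnvelopingAlgebra k (Current k A)) (Verma ρ) :=
  inferInstanceAs (Module _ (_ ⧸ vermaRel ρ))

instance : Module k (Verma ρ) :=
  inferInstanceAs (Module k (_ ⧸ vermaRel ρ))

instance : IsScalarTower k (UniversalEnvelopingAlgebra k (Current k A)) (Verma ρ) :=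
  inferInstanceAs (IsScalarTower k _ (_ ⧸ vermaRel ρ))

/-- `𝔊` acts on `V(M)` through `U(𝔊)`. -/
instance : LieRingModule (Current k A) (Verma ρ) where
  bracket x v := UniversalEnvelopingAlgebra.ι k x • v
  add_lie x y v := by
    change UniversalEnvelopingAlgebra.ι k (x + y) • v = _
    rw [map_add, add_smul]
  lie_add x v w := smul_add _ _ _
  leibniz_lie x y v := by
    change _ • (_ • v) = UniversalEnvelopingAlgebra.ι k ⁅x, y⁆ • v + _ • (_ • v)
    rw [LieHom.map_lie, LieRing.of_associative_ring_bracket, sub_smul, mul_smul, mul_smul,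
      sub_add_cancel]

instance : LieModule k (Current k A) (Verma ρ) where
  smul_lie c x v := by
    change UniversalEnvelopingAlgebra.ι k (c • x) • v = c • (_ • v)
    rw [map_smul, smul_assoc]
  lie_smul c x v := by
    change UniversalEnvelopingAlgebra.ι k x • (c • v) =
      c • (UniversalEnvelopingAlgebra.ι k x • v)
    rw [← algebraMap_smul (UniversalEnvelopingAlgebra k (Current k A)) c v,
      ← algebraMap_smul (UniversalEnvelopingAlgebra k (Current k A)) c (_ • v),
      ← mul_smul, ← mul_smul, Algebra.commutes]

end Verma

/-- The weight space `V_ℓ = {v | h(1) v = ℓ v}` of an `sl₂(A)`-module. -/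
def weightSpace (V : Type*) [AddCommGroup V] [Module k V] [LieRingModule (Current k A) V]
    [LieModule k (Current k A) V] (ℓ : ℤ) : Submodule k V :=
  Module.End.eigenspace (LieModule.toEnd k (Current k A) V (hElt k 1)) (ℓ : k)

/-- The submodule of `V(M)` generated by its weight spaces of weight `ℓ < -n`. -/
def lowSubmodule (n : ℕ) (ρ : A →ₗ[k] Module.End k M) :
    LieSubmodule k (Current k A) (Verma ρ) :=
  LieSubmodule.lieSpan k (Current k A)
    ((⨆ ℓ : ℤ, ⨆ _ : ℓ < -(n : ℤ), weightSpace (A := A) (Verma ρ) ℓ : Submodule k (Verma ρ)) :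
      Set (Verma ρ))

/-- The Weyl module `Δ_n(M) = V(M) / U(𝔊) ∑_{ℓ < -n} V(M)_ℓ`. -/
abbrev WeylModule (n : ℕ) (ρ : A →ₗ[k] Module.End k M) : Type _ :=
  Verma ρ ⧸ lowSubmodule n ρ

end Weyl

/-! ### Symmetric tensors -/

section SymmetricTensors

open PiTensorProduct

attribute [local instance 100] LieRing.ofAssociativeRing

variable {k : Type*} [Field k] {G : Type*} [LieRing G] [LieAlgebra k G]
  (V : Type*) [AddCommGroup V] [Module k V] [LieRingModule G V] [LieModule k G V] (n : ℕ)

/-- The endomorphism of `V^{⊗n}` that applies `f` to the `i`-th factor. -/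
def atFactor (i : Fin n) (f : Module.End k V) : Module.End k (⨂[k]^n V) :=
  PiTensorProduct.map (Function.update (fun _ => LinearMap.id) i f)

variable {V n} in
theorem atFactor_tprod (i : Fin n) (f : Module.End k V) (v : Fin n → V) :
    atFactor V n i f (tprod k v) = tprod k (Function.update v i (f (v i))) := by
  rw [atFactor, PiTensorProduct.map_tprod]
  congr 1
  ext j
  by_cases h : j = i
  · subst h; simp
  · simp [h]

variable {V n} in
theorem atFactor_mul_self (i : Fin n) (f g : Module.End k V) :
    atFactor V n i f * atFactor V n i g = atFactor V n i (f * g) := by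
  refine PiTensorProduct.ext (MultilinearMap.ext fun v => ?_)
  simp [atFactor_tprod]

variable {V n} in
theorem atFactor_commute {i j : Fin n} (h : i ≠ j) (f g : Module.End k V) :
    atFactor V n i f * atFactor V n j g = atFactor V n j g * atFactor V n i f := by
  refine PiTensorProduct.ext (MultilinearMap.ext fun v => ?_)
  simp [atFactor_tprod, h, h.symm, Function.update_comm h]

/-- The diagonal action of `G` on `V^{⊗n}`:
`x (v₁ ⊗ ⋯ ⊗ vₙ) = ∑ᵢ v₁ ⊗ ⋯ ⊗ x vᵢ ⊗ ⋯ ⊗ vₙ`. -/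
def tensorAction : G →ₗ⁅k⁆ Module.End k (⨂[k]^n V) where
  toFun x := ∑ i, atFactor V n i (LieModule.toEnd k G V x)
  map_add' x y := by
    simp only [atFactor, map_add, PiTensorProduct.map_update_add, Finset.sum_add_distrib]
  map_smul' c x := by
    simp only [atFactor, map_smul, PiTensorProduct.map_update_smul, Finset.smul_sum,
      RingHom.id_apply]
  map_lie' {x y} := by
    have hsub : ∀ (i : Fin n) (f g : Module.End k V),
        atFactor V n i (f - g) = atFactor V n i f - atFactor V n i g := fun i f g => by
      rw [eq_sub_iff_add_eq]
      simp only [atFactor]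
      rw [← PiTensorProduct.map_update_add, sub_add_cancel]
    rw [LieRing.of_associative_ring_bracket, Finset.sum_mul_sum, Finset.sum_mul_sum,
      Finset.sum_comm (γ := Fin n) (f := fun i j =>
        atFactor V n i (LieModule.toEnd k G V y) * atFactor V n j (LieModule.toEnd k G V x)),
      ← Finset.sum_sub_distrib]
    refine Finset.sum_congr rfl fun i _ => ?_
    rw [← Finset.sum_sub_distrib, Finset.sum_eq_single i, LieHom.map_lie,
      LieRing.of_associative_ring_bracket, hsub, atFactor_mul_self, atFactor_mul_self]
    · intro j _ hj
      rw [atFactor_commute hj.symm, sub_self]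
    · simp

variable {V n} in
theorem tensorAction_tprod (x : G) (v : Fin n → V) :
    tensorAction (k := k) V n x (tprod k v) =
      ∑ i, tprod k (Function.update v i ⁅x, v i⁆) := by
  change (∑ i, atFactor V n i (LieModule.toEnd k G V x)) (tprod k v) = _
  simp [LinearMap.sum_apply, atFactor_tprod]

instance : LieRingModule G (⨂[k]^n V) := LieRingModule.compLieHom _ (tensorAction (k := k) V n)

instance : LieModule k G (⨂[k]^n V) := LieModule.compLieHom _ (tensorAction V n)

/-- `S^n(V) ⊂ V^{⊗n}`, the tensors fixed by all permutations of the factors,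
as a `G`-submodule. -/
def symTensors : LieSubmodule k G (⨂[k]^n V) where
  carrier := {z | ∀ s : Equiv.Perm (Fin n), PiTensorProduct.reindex k (fun _ => V) s z = z}
  zero_mem' s := map_zero _
  add_mem' hx hy s := by rw [map_add, hx s, hy s]
  smul_mem' c x hx s := by rw [map_smul, hx s]
  lie_mem {x z} hz s := by
    change PiTensorProduct.reindex k (fun _ => V) s (tensorAction V n x z) = tensorAction V n x z
    conv_rhs => rw [← hz s]
    have key : (PiTensorProduct.reindex k (fun _ => V) s).toLinearMap ∘ₗ tensorAction (k := k) V n x =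
        tensorAction (k := k) V n x ∘ₗ (PiTensorProduct.reindex k (fun _ => V) s).toLinearMap := by
      refine PiTensorProduct.ext (MultilinearMap.ext fun v => ?_)
      simp only [LinearMap.compMultilinearMap_apply, LinearMap.comp_apply, tensorAction_tprod,
        map_sum, LinearEquiv.coe_coe, PiTensorProduct.reindex_tprod]
      rw [← Equiv.sum_comp s.symm]
      refine Finset.sum_congr rfl fun i _ => ?_
      congr 1
      ext j
      by_cases h : j = i
      · subst h; simp
      · simp [h]
    exact LinearMap.congr_fun key z

end SymmetricTensors

/-! ### The modules `L[t]` and `F` -/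

section Objects

variable (k : Type*) [Field k]

/-- `sl₂(A)` acts `k`-linearly on `A ⊗ L`, by `(x ⊗ a)(v ⊗ b) = xv ⊗ ab`. -/
instance (A : Type*) [CommRing A] [Algebra k A] (L : Type*) [AddCommGroup L] [Module k L]
    [LieRingModule (LieAlgebra.SpecialLinear.sl (Fin 2) k) L]
    [LieModule k (LieAlgebra.SpecialLinear.sl (Fin 2) k) L] :
    LieModule k (Current k A) (A ⊗[k] L) where
  smul_lie c x v := by
    rw [← algebraMap_smul A c x, smul_lie, algebraMap_smul]
  lie_smul c x v := by
    rw [← algebraMap_smul A c v, lie_smul, algebraMap_smul]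

/-- `L[t] = L ⊗ k[t]`, with `L = k²` the natural (two-dimensional simple) `sl₂(k)`-module. -/
abbrev Loops : Type _ := Polynomial k ⊗[k] (Fin 2 → k)

/-- The power sum `N_ℓ = x₁^ℓ + ⋯ + xₙ^ℓ`, as an element of the ring of symmetric polynomials. -/
def newton (n ℓ : ℕ) : MvPolynomial.symmetricSubalgebra (Fin n) k :=
  ⟨MvPolynomial.psum (Fin n) k ℓ, MvPolynomial.psum_isSymmetric (Fin n) k ℓ⟩

/-- The `k[t]`-space `F = k[x₁, …, xₙ]^{Sₙ}`: the linear map `ρ : k[t] → End F` for which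
`ρ(t^ℓ)` is multiplication by `N_ℓ`. -/
def newtonAction (n : ℕ) :
    Polynomial k →ₗ[k] Module.End k (MvPolynomial.symmetricSubalgebra (Fin n) k) :=
  (Polynomial.basisMonomials k).constr k fun ℓ => LinearMap.mulLeft k (newton k n ℓ)

end Objects

end JordanWeyl
end

noncomputable section

namespace JordanWeyl

/-! ### Symmetric polynomials and power sums -/

section PowerSums

/-! Write `Sym_m` for the symmetric polynomials in `m` variables. Over a field of characteristic
zero they are polynomials in the first `m` power sums. The engine of both halves is
`SymPoly.exists_algHom_of_relation`: a linear map `τ : k[t] → B` with `τ 1 = m` extends to `Sym_m →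
B` as soon as every `a` satisfies one relation that expresses the `(m+1)`-st power sum through lower
ones.

Freeness: polarizing `[a, a²] = 0` and using that `1` acts as a scalar makes the envelope
commutative. The level relation is a multiple of the elementary symmetric function of degree `n+1`
written in power sums, so it holds in `Sym_n`, and the engine inverts the resulting map from the
envelope to `Sym_n`. Thus `F` is the envelope acting on itself.

Weyl module: in a module with a highest weight map `w`, the products of `r` lowering operators
applied to `w` are parametrized by `lowerMap w r : Sym_r ⊗ Sym_n → W`. In the symmetric tensors,
where `L[t]^{⊗n}` is a sum of copies of `k[x₁, …, xₙ]`, the kernel of `lowerMap` is that of the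
multiplication map `Sym_r ⊗ Sym_n → Sym_r ⊗ Sym_{n-r}` (`component_lowerMap`), which is surjective.
The canonical map from the Weyl module to the symmetric tensors exists because no weight of the
latter is below `-n`, and it is onto because every component of a symmetric tensor is reached.

For injectivity the same relations must hold in the Weyl module
(`IsHighestWeight.lowerMap_eq_zero`). There all products of `n+1` lowering operators vanish.
Applying `e(b)` separates one variable and contracts it against the shifted sums "power sum of all
`n` variables minus power sum of the first `r`". By Newton's identities, repeated contraction of the
vanishing in degree `n+1` gives the vanishing of the elementary symmetric function of degree `n-r+1`
of the shifted sums (`IsHighestWeight.newtonE_mem_lowerIdeal`). The engine then says that these sums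
behave like power sums of `n-r` variables, which is exactly the required factorization. -/

theorem injective_of_surjective_ringEnd {R : Type*} [CommRing R] [IsNoetherianRing R]
    (f : R →+* R) (hf : Function.Surjective f) : Function.Injective f := by
  have hsucc : ∀ n x, (f ^ (n + 1)) x = (f ^ n) (f x) := fun n x => by
    rw [pow_succ]; rfl
  have hsucc' : ∀ n x, (f ^ (n + 1)) x = f ((f ^ n) x) := fun n x => by
    rw [pow_succ']; rfl
  have hmono : Monotone fun n : ℕ => RingHom.ker (f ^ n) := by
    refine monotone_nat_of_le_succ fun n x hx => ?_
    rw [RingHom.mem_ker] at hx ⊢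
    rw [hsucc', hx, map_zero]
  -- The kernels of the iterates stabilize at some `n`. An element of `ker f` is `f ^ n` of some
  -- `y`, and then `y ∈ ker f ^ (n+1) = ker f ^ n`, so the element is zero.
  obtain ⟨n, hn⟩ := monotone_stabilizes_iff_noetherian.mpr
    (inferInstance : IsNoetherian R R) ⟨_, hmono⟩
  have hsurj : Function.Surjective (f ^ n) := by
    clear hn
    induction n with
    | zero => exact fun x => ⟨x, rfl⟩
    | succ n ih =>
      intro x
      obtain ⟨y, rfl⟩ := ih x
      obtain ⟨z, rfl⟩ := hf y
      exact ⟨z, hsucc n z⟩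
  refine (injective_iff_map_eq_zero f).mpr fun x hx => ?_
  obtain ⟨y, rfl⟩ := hsurj x
  rw [← hsucc'] at hx
  have h : y ∈ RingHom.ker (f ^ (n + 1)) := hx
  have h2 : RingHom.ker (f ^ n) = RingHom.ker (f ^ (n + 1)) := hn (n + 1) n.le_succ
  rwa [← h2] at h

variable {k : Type*} [Field k]

/-- A polynomial in `s` with coefficients in a vector space that takes values in a subspace for all
scalars `s` has its coefficients in that subspace. -/
theorem mem_of_forall_sum_pow_smul_mem [Infinite k] {E : Type*} [AddCommGroup E] [Module k E]
    (S : Submodule k E) (N : ℕ) (v : ℕ → E)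
    (h : ∀ s : k, ∑ i ∈ Finset.range N, s ^ i • v i ∈ S) {i : ℕ} (hi : i < N) : v i ∈ S := by
  by_contra hv
  -- A functional that kills `S` but not `v i` reduces the claim to a scalar polynomial that
  -- vanishes at every point of an infinite field.
  obtain ⟨f, hf, hS⟩ := Submodule.exists_le_ker_of_notMem hv
  let p : Polynomial k := ∑ j ∈ Finset.range N, Polynomial.monomial j (f (v j))
  have hp : p = 0 := by
    refine Polynomial.funext fun s => ?_
    have := hS (h s)
    rw [LinearMap.mem_ker, map_sum] at this
    simp only [map_smul, smul_eq_mul] at this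
    simp only [p, Polynomial.eval_finsetSum, Polynomial.eval_monomial, Polynomial.eval_zero]
    rw [← this]
    exact Finset.sum_congr rfl fun _ _ => mul_comm _ _
  apply hf
  have hc := congrArg (fun q => Polynomial.coeff q i) hp
  simpa [p, Polynomial.finsetSum_coeff, Polynomial.coeff_monomial, hi] using hc

variable (k)

/-- The elementary symmetric functions attached to a sequence of power sums by Newton's
identities. -/
def newtonE {B : Type*} [CommRing B] [Algebra k B] (p : ℕ → B) : ℕ → B
  | 0 => 1
  | s + 1 => ((s + 1 : ℕ) : k)⁻¹ •
      ∑ i : Fin (s + 1), (-1) ^ (i : ℕ) * p (i + 1) * newtonE p (s - i)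
termination_by s => s
decreasing_by omega

section newtonE

variable {B : Type*} [CommRing B] [Algebra k B] (p : ℕ → B)

theorem newtonE_zero : newtonE k p 0 = 1 := by rw [newtonE]

theorem newtonE_succ (s : ℕ) : newtonE k p (s + 1) = ((s + 1 : ℕ) : k)⁻¹ •
    ∑ i ∈ Finset.range (s + 1), (-1) ^ i * p (i + 1) * newtonE k p (s - i) := by
  rw [newtonE, Finset.sum_range fun i => (-1) ^ i * p (i + 1) * newtonE k p (s - i)]

theorem succ_smul_newtonE_succ [CharZero k] (s : ℕ) : ((s + 1 : ℕ) : k) • newtonE k p (s + 1) =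
    ∑ i ∈ Finset.range (s + 1), (-1) ^ i * p (i + 1) * newtonE k p (s - i) := by
  rw [newtonE_succ, smul_smul, mul_inv_cancel₀ (Nat.cast_ne_zero.mpr s.succ_ne_zero), one_smul]

theorem map_newtonE {C : Type*} [CommRing C] [Algebra k C] (f : B →ₐ[k] C) (s : ℕ) :
    f (newtonE k p s) = newtonE k (fun j => f (p j)) s := by
  induction s using Nat.strong_induction_on with
  | _ s ih =>
    cases s with
    | zero => rw [newtonE_zero, newtonE_zero, map_one]
    | succ s =>
      rw [newtonE_succ, newtonE_succ, map_smul, map_sum]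
      congr 1
      refine Finset.sum_congr rfl fun i hi => ?_
      rw [map_mul, map_mul, map_pow, map_neg, map_one, ih _ (by omega)]

theorem newtonE_mem (S : Subalgebra k B) (s : ℕ) (h : ∀ j, 1 ≤ j → j ≤ s → p j ∈ S) :
    newtonE k p s ∈ S := by
  induction s using Nat.strong_induction_on with
  | _ s ih =>
    cases s with
    | zero => rw [newtonE_zero]; exact S.one_mem
    | succ s =>
      rw [newtonE_succ]
      refine S.smul_mem (S.sum_mem fun i hi => S.mul_mem (S.mul_mem ?_ ?_) ?_) _
      · exact S.pow_mem (S.neg_mem S.one_mem) _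
      · exact h _ (by omega) (by have := Finset.mem_range.mp hi; omega)
      · exact ih _ (by omega) fun j h1 h2 => h j h1 (by omega)

theorem newtonE_psum [CharZero k] (m s : ℕ) :
    newtonE k (fun j => MvPolynomial.psum (Fin m) k j) s = MvPolynomial.esymm (Fin m) k s := by
  induction s using Nat.strong_induction_on with
  | _ s ih =>
    cases s with
    | zero => rw [newtonE_zero, MvPolynomial.esymm_zero]
    | succ s =>
      have h := MvPolynomial.mul_esymm_eq_sum (Fin m) k (s + 1)
      rw [newtonE_succ, inv_smul_eq_iff₀ (Nat.cast_ne_zero.mpr s.succ_ne_zero),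
        Algebra.smul_def, map_natCast, h, Finset.sum_filter,
        Finset.Nat.sum_antidiagonal_eq_sum_range_succ_mk, Finset.sum_range_succ _ (s + 1), if_neg (by simp),
        add_zero, ← Finset.sum_range_reflect, Finset.mul_sum]
      refine Finset.sum_congr rfl fun i hi => ?_
      have hi' := Finset.mem_range.mp hi
      rw [ih _ (by omega), if_pos (by simp; omega)]
      have h1 : s - (s - i) = i := by omega
      have h2 : s + 1 - i = s - i + 1 := by omega
      have h3 : (-1 : MvPolynomial (Fin m) k) ^ (s - i) = (-1) ^ (s + 1 + 1) * (-1) ^ i := by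
        rw [← pow_add, show s + 1 + 1 + i = (s - i) + 2 * (i + 1) by omega, pow_add, pow_mul]
        simp
      simp only [Nat.add_sub_cancel, h1, h2, h3]
      ring

/-- Removing a variable `u` divides `∏ (1 + xᵢ z)` by `1 + u z`; this is the coefficient of `z ^
(s+1)` after clearing the denominator. For an arbitrary sequence `p` it follows from Newton's
recursion by strong induction. -/
theorem newtonE_sub_pow_succ_add [CharZero k] (u : B) (s : ℕ) :
    newtonE k (fun j => p j - u ^ j) (s + 1) + u * newtonE k (fun j => p j - u ^ j) s =
      newtonE k p (s + 1) := by
  induction s using Nat.strong_induction_on with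
  | _ s ih =>
    have hs : ((s + 1 : ℕ) : k) ≠ 0 := Nat.cast_ne_zero.mpr s.succ_ne_zero
    refine smul_right_injective B hs ?_
    simp only
    rw [smul_add, succ_smul_newtonE_succ, succ_smul_newtonE_succ]
    cases s with
    | zero => simp [newtonE_zero]
    | succ s =>
      set E := newtonE k (fun j => p j - u ^ j) with hE
      have h1 := succ_smul_newtonE_succ k (fun j => p j - u ^ j) s
      rw [← hE] at h1
      have h2 : ∑ i ∈ Finset.range (s + 1 + 1), (-1) ^ i * p (i + 1) * newtonE k p (s + 1 - i) =
          ∑ i ∈ Finset.range (s + 1 + 1), (-1) ^ i * p (i + 1) * E (s + 1 - i) +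
            u * ∑ i ∈ Finset.range (s + 1), (-1) ^ i * p (i + 1) * E (s - i) := by
        rw [Finset.sum_range_succ, Finset.sum_range_succ _ (s + 1), Finset.mul_sum, add_right_comm (_ : B),
          ← Finset.sum_add_distrib]
        congr 1
        · refine Finset.sum_congr rfl fun i hi => ?_
          have hi' := Finset.mem_range.mp hi
          rw [show s + 1 - i = (s - i) + 1 by omega, ← ih (s - i) (by omega)]
          ring
        · rw [Nat.sub_self, newtonE_zero, hE, newtonE_zero]
      have h3 : ∑ i ∈ Finset.range (s + 1 + 1), (-1) ^ i * u ^ (i + 1) * E (s + 1 - i) =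
          u * E (s + 1) - u * ∑ i ∈ Finset.range (s + 1), (-1) ^ i * u ^ (i + 1) * E (s - i) := by
        rw [Finset.sum_range_succ', add_comm, sub_eq_add_neg, Finset.mul_sum,
          ← Finset.sum_neg_distrib]
        congr 1
        · simp
        · refine Finset.sum_congr rfl fun i hi => ?_
          rw [show s + 1 - (i + 1) = s - i by omega]
          ring
      simp only [mul_sub, sub_mul, Finset.sum_sub_distrib] at h1 ⊢
      rw [h2, h3, Nat.cast_succ, add_smul, one_smul, ← mul_smul_comm, h1]
      ring

/-- Adding a point with coordinate `-u` to the power sums `p` multiplies the generating function of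
the elementary symmetric functions by `1 / (1 + u z)`. -/
theorem newtonE_sub_pow [CharZero k] (u : B) (s : ℕ) : newtonE k (fun j => p j - u ^ j) s =
    ∑ i ∈ Finset.range (s + 1), (-u) ^ i * newtonE k p (s - i) := by
  induction s with
  | zero => simp [newtonE_zero]
  | succ s ih =>
    rw [eq_sub_of_add_eq (newtonE_sub_pow_succ_add k p u s), ih, Finset.sum_range_succ' _ (s + 1),
      Finset.mul_sum, add_comm (_ : B), sub_eq_add_neg, ← Finset.sum_neg_distrib]
    congr 1
    · simp
    · refine Finset.sum_congr rfl fun i hi => ?_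
      rw [show s + 1 - (i + 1) = s - i by omega]
      ring

end newtonE

theorem esymm_eq_zero_of_lt {m s : ℕ} (h : m < s) : MvPolynomial.esymm (Fin m) k s = 0 := by
  rw [MvPolynomial.esymm, Finset.powersetCard_eq_empty.mpr (by simpa using h), Finset.sum_empty]

variable {k}

/-- The ring of symmetric polynomials in `m` variables. -/
abbrev SymPoly (k : Type*) [Field k] (m : ℕ) : Type _ := MvPolynomial.symmetricSubalgebra (Fin m) k

theorem coe_newton (m j : ℕ) : (newton k m j : MvPolynomial (Fin m) k) =
    MvPolynomial.psum (Fin m) k j := rfl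

theorem coe_newtonE_newton [CharZero k] (m s : ℕ) :
    ((newtonE k (newton k m) s : SymPoly k m) : MvPolynomial (Fin m) k) =
      MvPolynomial.esymm (Fin m) k s := by
  rw [← newtonE_psum]
  exact map_newtonE k (newton k m) (MvPolynomial.symmetricSubalgebra (Fin m) k).val s

/-- The polynomial ring in `m` variables maps to the symmetric polynomials by sending the variables
to the first `m` power sums. -/
def psumHom (k : Type*) [Field k] (m : ℕ) : MvPolynomial (Fin m) k →ₐ[k] SymPoly k m :=
  MvPolynomial.aeval fun i : Fin m => newton k m (i + 1)

/-- The elementary symmetric polynomials generate, and Newton's identities, with division by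
integers, express them through the first `m` power sums. -/
theorem psumHom_surjective [CharZero k] (m : ℕ) : Function.Surjective (psumHom k m) := by
  have hp : ∀ j, 1 ≤ j → j ≤ m → newton k m j ∈ (psumHom k m).range := fun j h1 h2 =>
    ⟨MvPolynomial.X ⟨j - 1, by omega⟩, by
      have : j - 1 + 1 = j := by omega
      simp [psumHom, this]⟩
  intro x
  obtain ⟨q, rfl⟩ := (MvPolynomial.esymmAlgEquiv (Fin m) k (Fintype.card_fin m)).surjective x
  change _ ∈ (psumHom k m).range
  rw [MvPolynomial.esymmAlgEquiv_apply]
  induction q using MvPolynomial.induction_on with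
  | C a =>
    rw [← MvPolynomial.algebraMap_eq, AlgHom.commutes]
    exact Subalgebra.algebraMap_mem _ a
  | add p q hp hq => rw [map_add]; exact add_mem hp hq
  | mul_X p i hq =>
    rw [map_mul]
    refine mul_mem hq ?_
    have h := newtonE_mem k (newton k m) (psumHom k m).range ((i : ℕ) + 1)
      fun j h1 h2 => hp j h1 (by omega)
    convert h
    refine Subtype.ext ?_
    rw [coe_newtonE_newton, MvPolynomial.esymmAlgHom_apply, MvPolynomial.aeval_X]

/-- Composed with the inverse of the isomorphism of the fundamental theorem, the map becomes a
surjective endomorphism of a Noetherian ring, hence injective. So no Jacobian is needed for the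
algebraic independence of the power sums. -/
theorem psumHom_bijective [CharZero k] (m : ℕ) : Function.Bijective (psumHom k m) := by
  refine ⟨?_, psumHom_surjective m⟩
  let e := MvPolynomial.esymmAlgEquiv (Fin m) k (Fintype.card_fin m)
  let g : MvPolynomial (Fin m) k →ₐ[k] MvPolynomial (Fin m) k := e.symm.toAlgHom.comp (psumHom k m)
  have h : Function.Injective (e.symm ∘ psumHom k m) := injective_of_surjective_ringEnd
    g.toRingHom (e.symm.surjective.comp (psumHom_surjective m))
  exact Function.Injective.of_comp h

theorem SymPoly.algHom_ext [CharZero k] {m : ℕ} {B : Type*} [Semiring B] [Algebra k B]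
    {f g : SymPoly k m →ₐ[k] B} (h : ∀ j, 1 ≤ j → j ≤ m → f (newton k m j) = g (newton k m j)) :
    f = g := by
  have : f.comp (psumHom k m) = g.comp (psumHom k m) := by
    refine MvPolynomial.algHom_ext fun i => ?_
    simpa [psumHom] using h (i + 1) (by omega) (by omega)
  refine AlgHom.ext fun x => ?_
  obtain ⟨q, rfl⟩ := psumHom_surjective m x
  exact DFunLike.congr_fun this q

theorem SymPoly.exists_algHom [CharZero k] {m : ℕ} {B : Type*} [CommRing B] [Algebra k B]
    (b : ℕ → B) : ∃ f : SymPoly k m →ₐ[k] B, ∀ j, 1 ≤ j → j ≤ m → f (newton k m j) = b j := by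
  let e := AlgEquiv.ofBijective (psumHom k m) (psumHom_bijective m)
  refine ⟨(MvPolynomial.aeval fun i : Fin m => b (i + 1)).comp (e.symm : SymPoly k m →ₐ[k] _),
    fun j h1 h2 => ?_⟩
  have h : e (MvPolynomial.X ⟨j - 1, by omega⟩) = newton k m j := by
    have : j - 1 + 1 = j := by omega
    simp [e, psumHom, this]
  have : j - 1 + 1 = j := by omega
  rw [← h]
  simp [this]

/-- The linear map `a ↦ a(x₁) + ⋯ + a(xₘ)`. -/
def powerSum (k : Type*) [Field k] (m : ℕ) : Polynomial k →ₗ[k] SymPoly k m where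
  toFun a := ⟨∑ i, Polynomial.aeval (MvPolynomial.X i) a, fun e => by
    rw [map_sum]
    refine Fintype.sum_equiv e _ _ fun i => ?_
    rw [← Polynomial.aeval_algHom_apply, MvPolynomial.rename_X]⟩
  map_add' a b := Subtype.ext (by simp [Finset.sum_add_distrib])
  map_smul' c a := Subtype.ext (by simp [Finset.smul_sum])

theorem coe_powerSum (m : ℕ) (a : Polynomial k) : (powerSum k m a : MvPolynomial (Fin m) k) =
    ∑ i, Polynomial.aeval (MvPolynomial.X i) a := rfl

theorem powerSum_X_pow (m j : ℕ) : powerSum k m (Polynomial.X ^ j) = newton k m j :=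
  Subtype.ext (by simp [coe_powerSum, coe_newton, MvPolynomial.psum])

theorem powerSum_one (m : ℕ) : powerSum k m 1 = m :=
  Subtype.ext (by simp [coe_powerSum])

/-- The monoid homomorphism `a ↦ a(x₁) ⋯ a(xₘ)`. -/
def powerProd (k : Type*) [Field k] (m : ℕ) : Polynomial k →* SymPoly k m where
  toFun a := ⟨∏ i, Polynomial.aeval (MvPolynomial.X i) a, fun e => by
    rw [map_prod]
    refine Fintype.prod_equiv e _ _ fun i => ?_
    rw [← Polynomial.aeval_algHom_apply, MvPolynomial.rename_X]⟩
  map_one' := Subtype.ext (by simp)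
  map_mul' a b := Subtype.ext (by simp [Finset.prod_mul_distrib])

theorem coe_powerProd (m : ℕ) (a : Polynomial k) : (powerProd k m a : MvPolynomial (Fin m) k) =
    ∏ i, Polynomial.aeval (MvPolynomial.X i) a := rfl

/-- The span is a subalgebra because `powerProd` is multiplicative, and it contains each power sum
as the coefficient of `s` in `∏ (1 + s xᵢ ^ j)`. Linear maps on symmetric polynomials can therefore
be compared on the elements `a(x₁) ⋯ a(xₘ)`, where the commutator formulas are simple. -/
theorem span_powerProd [CharZero k] (m : ℕ) :
    Submodule.span k (Set.range (powerProd k m)) = ⊤ := by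
  have hadj : Subalgebra.toSubmodule (Algebra.adjoin k (Set.range (powerProd k m))) =
      Submodule.span k (Set.range (powerProd k m)) := by
    rw [Algebra.adjoin_eq_span, ← MonoidHom.coe_mrange, Submonoid.closure_eq]
  have hp : ∀ j, newton k m j ∈ Submodule.span k (Set.range (powerProd k m)) := fun j => by
    let ι := (MvPolynomial.symmetricSubalgebra (Fin m) k).val.toLinearMap
    let v : ℕ → MvPolynomial (Fin m) k := fun d =>
      ∑ t ∈ (Finset.univ : Finset (Fin m)).powersetCard d, ∏ i ∈ t, MvPolynomial.X i ^ j
    have h : ∀ s : k, ∑ d ∈ Finset.range (m + 1 + 1), s ^ d • v d ∈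
        (Submodule.span k (Set.range (powerProd k m))).map ι := fun s => by
      refine ⟨powerProd k m (1 + Polynomial.C s * Polynomial.X ^ j),
        Submodule.subset_span ⟨_, rfl⟩, ?_⟩
      -- The sum is padded with this zero term so that the index `1`, extracted below, lies in the
      -- range even for `m = 0`.
      have : v (m + 1) = 0 := by
        refine (Finset.sum_congr (Finset.powersetCard_eq_empty.mpr ?_) fun _ _ => rfl).trans
          Finset.sum_empty
        simp
      change ∏ i : Fin m, Polynomial.aeval (MvPolynomial.X i) (1 + Polynomial.C s * Polynomial.X ^ j) = _
      rw [Finset.sum_range_succ, this, smul_zero, add_zero]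
      simp only [map_add, map_one, map_mul, Polynomial.aeval_C, map_pow, Polynomial.aeval_X]
      rw [Finset.prod_one_add, Finset.sum_powerset]
      simp only [Finset.card_univ, Fintype.card_fin, v]
      refine Finset.sum_congr rfl fun d _ => ?_
      rw [Finset.smul_sum]
      refine Finset.sum_congr rfl fun t ht => ?_
      rw [Finset.prod_mul_distrib, Finset.prod_const, (Finset.mem_powersetCard.mp ht).2,
        Algebra.smul_def, map_pow]
    obtain ⟨x, hx, hxv⟩ := mem_of_forall_sum_pow_smul_mem _ _ v h (i := 1) (by omega)
    have : x = newton k m j := Subtype.ext (hxv.trans (by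
      simp [v, Finset.powersetCard_one, coe_newton, MvPolynomial.psum]))
    rwa [this] at hx
  refine eq_top_iff.mpr fun x _ => ?_
  obtain ⟨q, rfl⟩ := psumHom_surjective m x
  rw [← hadj] at hp ⊢
  have hle : (psumHom k m).range ≤ Algebra.adjoin k (Set.range (powerProd k m)) := by
    rw [psumHom, ← Algebra.adjoin_range_eq_range_aeval]
    refine Algebra.adjoin_le ?_
    rintro _ ⟨i, rfl⟩
    exact hp _
  exact hle ⟨q, rfl⟩

end PowerSums

/-! ### Homomorphisms out of the ring of symmetric polynomials -/

section Universal

variable {k : Type*} [Field k] {B : Type*} [CommRing B] [Algebra k B]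

theorem eq_zero_of_forall_eval_algebraMap [Infinite k] {p : Polynomial B}
    (h : ∀ s : k, p.eval (algebraMap k B s) = 0) : p = 0 := by
  ext i
  by_cases hi : i < p.natDegree + 1
  · refine (Submodule.mem_bot k).mp
      (mem_of_forall_sum_pow_smul_mem ⊥ (p.natDegree + 1) p.coeff (fun s => ?_) hi)
    rw [Submodule.mem_bot, ← h s, Polynomial.eval_eq_sum_range]
    refine Finset.sum_congr rfl fun j _ => ?_
    rw [Algebra.smul_def, map_pow, mul_comm]
  · exact Polynomial.coeff_eq_zero_of_natDegree_lt (by omega)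

/-- The polynomial in `s` whose value is `τ ((t + s t ^ r) ^ j)`. -/
def deform (τ : Polynomial k →ₗ[k] B) (r j : ℕ) : Polynomial B :=
  ∑ i ∈ Finset.range (j + 1), Polynomial.monomial i
    (τ (j.choose i • Polynomial.X ^ (j - i + r * i)))

theorem eval_deform (τ : Polynomial k →ₗ[k] B) (r j : ℕ) (s : k) :
    (deform τ r j).eval (algebraMap k B s) =
      τ ((Polynomial.X + s • Polynomial.X ^ r) ^ j) := by
  rw [deform, Polynomial.eval_finsetSum, add_comm (Polynomial.X : Polynomial k), add_pow, map_sum]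
  refine Finset.sum_congr rfl fun i _ => ?_
  rw [Polynomial.eval_monomial, ← map_pow, mul_comm, ← Algebra.smul_def, ← map_smul]
  congr 1
  rw [smul_pow, ← pow_mul, smul_mul_assoc, smul_mul_assoc, ← pow_add, nsmul_eq_mul, mul_comm,
    add_comm]

theorem coeff_deform_zero (τ : Polynomial k →ₗ[k] B) (r j : ℕ) :
    (deform τ r j).coeff 0 = τ (Polynomial.X ^ j) := by
  simp [deform, Polynomial.finsetSum_coeff, Polynomial.coeff_monomial]

theorem coeff_deform_one (τ : Polynomial k →ₗ[k] B) (r j : ℕ) :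
    (deform τ r j).coeff 1 = j • τ (Polynomial.X ^ (j - 1 + r)) := by
  rcases Nat.eq_zero_or_pos j with rfl | hj
  · simp [deform]
  · simp only [deform, Polynomial.finsetSum_coeff, Polynomial.coeff_monomial]
    simp only [map_nsmul, Finset.sum_ite_eq', Finset.mem_range]
    rw [if_pos (by omega), Nat.choose_one_right, mul_one]

/-- The hypothesis at `a = t + s t ^ r` is the value of the left side at `s`. Since `k` is infinite,
the identity holds in `B[s]` and its coefficients can be compared. -/
theorem relation_deform [Infinite k] (τ : Polynomial k →ₗ[k] B) (c : k) (m : ℕ)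
    (q : MvPolynomial ℕ k)
    (h : ∀ a : Polynomial k, c • τ (a ^ (m + 1)) + MvPolynomial.aeval (fun j => τ (a ^ j)) q = 0)
    (r : ℕ) : c • deform τ r (m + 1) + MvPolynomial.aeval (deform τ r) q = 0 := by
  refine eq_zero_of_forall_eval_algebraMap (k := k) fun s => ?_
  rw [Polynomial.eval_add, Polynomial.eval_smul, eval_deform,
    ← h (Polynomial.X + s • Polynomial.X ^ r)]
  congr 1
  let ev : Polynomial B →ₐ[k] B :=
    (Polynomial.aeval (R := B) (algebraMap k B s)).restrictScalars k
  have : ev (MvPolynomial.aeval (deform τ r) q) =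
      MvPolynomial.aeval (fun j => ev (deform τ r j)) q := by
    rw [← AlgHom.comp_apply, MvPolynomial.comp_aeval]
  simpa [ev, eval_deform] using this

theorem aeval_eq_of_mem_supported {C : Type*} [CommRing C] [Algebra k C] {S : Set ℕ}
    {q : MvPolynomial ℕ k} (hq : q ∈ MvPolynomial.supported k S) {f g : ℕ → C}
    (h : ∀ j ∈ S, f j = g j) : MvPolynomial.aeval f q = MvPolynomial.aeval g q :=
  MvPolynomial.eval₂Hom_congr' rfl (fun i hi _ => h i (MvPolynomial.mem_supported.mp hq hi)) rfl

/-- The substitution `xᵢ ↦ a(xᵢ)` carries the relation among the power sums to the one for `a`. -/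
theorem powerSum_relation {m : ℕ} {c : k} {q : MvPolynomial ℕ k}
    (h : c • MvPolynomial.psum (Fin m) k (m + 1) +
      MvPolynomial.aeval (fun j => MvPolynomial.psum (Fin m) k j) q = 0) (a : Polynomial k) :
    c • powerSum k m (a ^ (m + 1)) + MvPolynomial.aeval (fun j => powerSum k m (a ^ j)) q = 0 := by
  let f : MvPolynomial (Fin m) k →ₐ[k] MvPolynomial (Fin m) k :=
    MvPolynomial.aeval fun i => Polynomial.aeval (MvPolynomial.X i) a
  have hf : ∀ j, f (MvPolynomial.psum (Fin m) k j) = powerSum k m (a ^ j) := fun j => by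
    simp [f, MvPolynomial.psum, coe_powerSum]
  refine Subtype.ext ?_
  have h1 := congrArg f h
  rw [map_add, map_smul, hf, map_zero, ← AlgHom.comp_apply, MvPolynomial.comp_aeval] at h1
  simp only [hf] at h1
  rw [← AlgHom.coe_toRingHom] at h1
  have h2 : ((MvPolynomial.aeval (fun j => powerSum k m (a ^ j)) q : SymPoly k m) :
      MvPolynomial (Fin m) k) =
      MvPolynomial.aeval (fun j => (powerSum k m (a ^ j) : MvPolynomial (Fin m) k)) q := by
    change (MvPolynomial.symmetricSubalgebra (Fin m) k).val _ = _
    rw [← AlgHom.comp_apply, MvPolynomial.comp_aeval]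
    rfl
  rw [AddMemClass.coe_add, h2]
  exact h1

/-- A linear map `τ` from `k[t]` to a commutative algebra extends to the ring of symmetric
polynomials in `m` variables, in place of `a ↦ a(x₁) + ⋯ + a(xₘ)`, as soon as `τ 1 = m` and the
values `τ (a ^ j)` satisfy a relation that expresses the `(m+1)`-st power sum of `m` variables
through the lower ones. -/
theorem SymPoly.exists_algHom_of_relation [CharZero k] {m : ℕ} (τ : Polynomial k →ₗ[k] B)
    (h1 : τ 1 = m) {c : k} (hc : c ≠ 0) {q : MvPolynomial ℕ k}
    (hq : q ∈ MvPolynomial.supported k (Set.Iic m))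
    (hF : c • MvPolynomial.psum (Fin m) k (m + 1) +
      MvPolynomial.aeval (fun j => MvPolynomial.psum (Fin m) k j) q = 0)
    (hB : ∀ a : Polynomial k,
      c • τ (a ^ (m + 1)) + MvPolynomial.aeval (fun j => τ (a ^ j)) q = 0) :
    ∃ θ : SymPoly k m →ₐ[k] B, ∀ a, θ (powerSum k m a) = τ a := by
  obtain ⟨θ, hθ⟩ := SymPoly.exists_algHom (k := k) (m := m) fun j => τ (Polynomial.X ^ j)
  refine ⟨θ, fun a => ?_⟩
  suffices h : ∀ j, θ (powerSum k m (Polynomial.X ^ j)) = τ (Polynomial.X ^ j) by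
    have : θ.toLinearMap ∘ₗ powerSum k m = τ :=
      (Polynomial.basisMonomials k).ext fun j => by
        simpa [Polynomial.X_pow_eq_monomial] using h j
    exact LinearMap.congr_fun this a
  intro j
  induction j using Nat.strong_induction_on with
  | _ j ih =>
    rcases Nat.eq_zero_or_pos j with rfl | hj
    · rw [pow_zero, h1, powerSum_one, map_natCast]
    rcases Nat.lt_or_ge m j with hm | hm
    -- The relation is deformed along `t + s t ^ r` and read modulo `s²`. The tail involves only
    -- indices `i ≤ m`, whose coefficients of `s` are `i τ(t ^ (i-1+r))` with `i-1+r < m+r`, known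
    -- by induction. The remaining term contributes `(m+1) τ(t ^ (m+r))`, which is thereby
    -- determined.
    · obtain ⟨r, rfl⟩ : ∃ r, j = m + r := ⟨j - m, by omega⟩
      let I : Ideal (Polynomial B) := Ideal.span {Polynomial.X ^ 2}
      let mk : Polynomial B →ₐ[k] Polynomial B ⧸ I := Ideal.Quotient.mkₐ k I
      let Θ : Polynomial (SymPoly k m) →ₐ[k] Polynomial B := Polynomial.mapAlgHom θ
      have hmk : ∀ i, i ≤ m → mk (Θ (deform (powerSum k m) r i)) = mk (deform τ r i) :=
        fun i hi => by
          refine (Ideal.Quotient.mk_eq_mk_iff_sub_mem _ _).mpr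
            (Ideal.mem_span_singleton.mpr (Polynomial.X_pow_dvd_iff.mpr fun d hd => ?_))
          rw [Polynomial.coeff_sub, sub_eq_zero]
          change (Polynomial.map θ.toRingHom _).coeff d = _
          rw [Polynomial.coeff_map]
          interval_cases d
          · rw [coeff_deform_zero, coeff_deform_zero]
            exact ih _ (by omega)
          · rw [coeff_deform_one, coeff_deform_one, map_nsmul]
            rcases Nat.eq_zero_or_pos i with rfl | hi0
            · simp
            · congr 1
              exact ih _ (by omega)
      have eF := congrArg (fun x => mk (Θ x))
        (relation_deform (powerSum k m) c m q (powerSum_relation hF) r)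
      have eB := congrArg mk (relation_deform τ c m q hB r)
      have e : mk (Θ (MvPolynomial.aeval (deform (powerSum k m) r) q)) =
          mk (MvPolynomial.aeval (deform τ r) q) := by
        rw [← AlgHom.comp_apply, ← AlgHom.comp_apply, MvPolynomial.comp_aeval,
          ← AlgHom.comp_apply, MvPolynomial.comp_aeval]
        exact aeval_eq_of_mem_supported hq hmk
      simp only [map_add, map_zero, map_smul] at eF eB
      rw [e, ← eB, add_left_inj] at eF
      have h2 := smul_right_injective _ hc eF
      have h3 := Polynomial.X_pow_dvd_iff.mp (Ideal.mem_span_singleton.mp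
        ((Ideal.Quotient.mk_eq_mk_iff_sub_mem _ _).mp h2)) 1 (by omega)
      rw [Polynomial.coeff_sub, sub_eq_zero] at h3
      change (Polynomial.map θ.toRingHom _).coeff 1 = _ at h3
      rw [Polynomial.coeff_map, coeff_deform_one, coeff_deform_one, map_nsmul,
        Nat.add_sub_cancel, ← Nat.cast_smul_eq_nsmul k, ← Nat.cast_smul_eq_nsmul k] at h3
      exact smul_right_injective _ (Nat.cast_ne_zero.mpr m.succ_ne_zero : ((m + 1 : ℕ) : k) ≠ 0) h3
    · rw [powerSum_X_pow, hθ j hj hm]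

variable (k) in
/-- Up to a scalar, the elementary symmetric function of degree `m + 1` as a polynomial in the power
sums, without its term of degree one. -/
def newtonTail (m : ℕ) : MvPolynomial ℕ k :=
  ∑ i ∈ Finset.range m, (-1) ^ i * MvPolynomial.X (i + 1) * newtonE k MvPolynomial.X (m - i)

theorem newtonTail_mem_supported (m : ℕ) :
    newtonTail k m ∈ MvPolynomial.supported k (Set.Iic m) := by
  have hX : ∀ j ≤ m, (MvPolynomial.X j : MvPolynomial ℕ k) ∈
      MvPolynomial.supported k (Set.Iic m) := fun j hj => MvPolynomial.X_mem_supported.mpr hj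
  refine sum_mem fun i hi => ?_
  have := Finset.mem_range.mp hi
  exact mul_mem (mul_mem (pow_mem (neg_mem (one_mem _)) _) (hX _ (by omega)))
    (newtonE_mem _ _ _ _ fun j _ hj => hX j (by omega))

theorem smul_add_aeval_newtonTail [CharZero k] (p : ℕ → B) (m : ℕ) :
    ((-1) ^ m : k) • p (m + 1) + MvPolynomial.aeval p (newtonTail k m) =
      ((m + 1 : ℕ) : k) • newtonE k p (m + 1) := by
  rw [succ_smul_newtonE_succ, Finset.sum_range_succ, add_comm]
  have he : ∀ s, MvPolynomial.aeval p (newtonE k MvPolynomial.X s : MvPolynomial ℕ k) =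
      newtonE k p s := fun s => by
    rw [map_newtonE]
    simp
  simp [newtonTail, he, newtonE_zero, Algebra.smul_def]

/-- A linear map `τ` from `k[t]` to a commutative algebra extends to the ring of symmetric
polynomials in `m` variables if `τ 1 = m` and the `(m+1)`-st elementary symmetric function of the
`τ (a ^ j)` vanishes for all `a`. -/
theorem SymPoly.exists_algHom_of_newtonE [CharZero k] {m : ℕ} (τ : Polynomial k →ₗ[k] B)
    (h1 : τ 1 = m) (hB : ∀ a : Polynomial k, newtonE k (fun j => τ (a ^ j)) (m + 1) = 0) :
    ∃ θ : SymPoly k m →ₐ[k] B, ∀ a, θ (powerSum k m a) = τ a := by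
  refine SymPoly.exists_algHom_of_relation τ h1 (c := (-1) ^ m) (by simp)
    (newtonTail_mem_supported m) ?_ fun a => ?_
  · rw [smul_add_aeval_newtonTail, newtonE_psum, esymm_eq_zero_of_lt k m.lt_succ_self, smul_zero]
  · rw [smul_add_aeval_newtonTail fun j => τ (a ^ j), hB, smul_zero]

end Universal

/-! ### Power sums over the cycles of permutations -/

section CycleIndex

open Equiv.Perm

variable {α : Type*} [Fintype α] [DecidableEq α]

/-- The cycles of `g`, including the fixed points. -/
abbrev Cycles (g : Equiv.Perm α) : Type _ := g.cycleFactorsFinset ⊕ (g.supportᶜ : Finset α)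

/-- The cycle of `g` that contains `x`. -/
def toCycle (g : Equiv.Perm α) (x : α) : Cycles g :=
  if h : x ∈ g.support then Sum.inl ⟨g.cycleOf x, cycleOf_mem_cycleFactorsFinset_iff.mpr h⟩
  else Sum.inr ⟨x, Finset.mem_compl.mpr h⟩

theorem toCycle_eq_inl (g : Equiv.Perm α) (x : α) (c : g.cycleFactorsFinset) :
    toCycle g x = Sum.inl c ↔ x ∈ (c : Equiv.Perm α).support := by
  unfold toCycle
  split_ifs with h
  · rw [Sum.inl.injEq, Subtype.ext_iff]
    constructor
    · intro h'
      rw [← h']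
      exact mem_support_cycleOf_iff.mpr ⟨SameCycle.refl _ _, h⟩
    · intro h'
      exact (cycle_is_cycleOf h' c.2).symm
  · simp only [false_iff]
    exact fun h' => h (mem_cycleFactorsFinset_support_le c.2 h')

theorem toCycle_eq_inr (g : Equiv.Perm α) (x : α) (y : (g.supportᶜ : Finset α)) :
    toCycle g x = Sum.inr y ↔ x = y := by
  unfold toCycle
  split_ifs with h
  · simp only [false_iff]
    rintro rfl
    exact Finset.mem_compl.mp y.2 h
  · rw [Sum.inr.injEq, Subtype.ext_iff]

theorem toCycle_surjective (g : Equiv.Perm α) : Function.Surjective (toCycle g) := by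
  rintro (c | y)
  · obtain ⟨x, hx⟩ := ((mem_cycleFactorsFinset_iff.mp c.2).1.nonempty_support)
    exact ⟨x, (toCycle_eq_inl g x c).mpr hx⟩
  · exact ⟨y, (toCycle_eq_inr g y y).mpr rfl⟩

theorem toCycle_apply (g : Equiv.Perm α) (x : α) : toCycle g (g x) = toCycle g x := by
  rcases h : toCycle g x with c | y
  · rw [toCycle_eq_inl] at h ⊢
    have := (mem_cycleFactorsFinset_iff.mp c.2).2 x h
    rw [← this]
    exact apply_mem_support.mpr h
  · rw [toCycle_eq_inr] at h ⊢
    have := notMem_support.mp (Finset.mem_compl.mp y.2)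
    rw [h, this]

theorem sameCycle_of_toCycle_eq {g : Equiv.Perm α} {x y : α} (h : toCycle g x = toCycle g y) :
    g.SameCycle x y := by
  rcases hy : toCycle g y with c | z
  · rw [hy] at h
    rw [toCycle_eq_inl] at h hy
    rw [sameCycle_iff_cycleOf_eq_of_mem_support (mem_cycleFactorsFinset_support_le c.2 h)
      (mem_cycleFactorsFinset_support_le c.2 hy), ← cycle_is_cycleOf h c.2,
      ← cycle_is_cycleOf hy c.2]
  · rw [hy] at h
    rw [toCycle_eq_inr] at h hy
    rw [h, hy]

theorem prod_parts_partition {C : Type*} [CommRing C] (g : Equiv.Perm α) (p : ℕ → C) :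
    (g.partition.parts.map p).prod =
      ∏ o : Cycles g, p (Finset.univ.filter fun x => toCycle g x = o).card := by
  rw [parts_partition, Multiset.map_add, Multiset.prod_add, Multiset.map_replicate,
    Multiset.prod_replicate, Fintype.prod_sum_type]
  congr 1
  · rw [cycleType_def, Multiset.map_map]
    change ∏ c ∈ g.cycleFactorsFinset, p c.support.card = _
    rw [← Finset.prod_coe_sort]
    refine Finset.prod_congr rfl fun c _ => ?_
    simp only [toCycle_eq_inl, Finset.filter_univ_mem]
  · simp only [toCycle_eq_inr, Finset.filter_eq', Finset.mem_univ, if_true, Finset.card_singleton,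
      Finset.prod_const, Finset.card_univ, Fintype.card_coe, Finset.card_compl]

/-- Expanding the product chooses one variable for each cycle of `g`, that is, a function on the
points that is constant on cycles. -/
theorem prod_parts_powerSum {C ι : Type*} [CommRing C] [Fintype ι] [DecidableEq ι]
    (g : Equiv.Perm α) (y : ι → C) :
    (g.partition.parts.map fun j => ∑ i, y i ^ j).prod =
      ∑ f : α → ι, if f ∘ g = f then ∏ x, y (f x) else 0 := by
  rw [prod_parts_partition, Finset.prod_univ_sum, Fintype.piFinset_univ, ← Finset.sum_filter]
  refine Finset.sum_bij (fun φ _ => φ ∘ toCycle g) (fun φ _ => ?_) (fun φ _ ψ _ h => ?_)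
    (fun f hf => ?_) (fun φ _ => ?_)
  · rw [Finset.mem_filter]
    exact ⟨Finset.mem_univ _, funext fun x => by simp [toCycle_apply]⟩
  · exact (toCycle_surjective g).injective_comp_right h
  · have hf' : ∀ x, f (g x) = f x := fun x => congrFun (Finset.mem_filter.mp hf).2 x
    have hz : ∀ (i : ℤ) x, f ((g ^ i) x) = f x := fun i => by
      induction i with
      | zero => simp
      | succ i ih => intro x; rw [zpow_add, zpow_one, mul_apply, ih, hf']
      | pred i ih =>
        intro x
        rw [zpow_sub, zpow_one, mul_apply, ih]
        simpa using (hf' (g⁻¹ x)).symm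
    refine ⟨f ∘ Function.surjInv (toCycle_surjective g), Finset.mem_univ _, funext fun x => ?_⟩
    obtain ⟨i, hi⟩ := sameCycle_of_toCycle_eq
      (Function.surjInv_eq (toCycle_surjective g) (toCycle g x))
    simp only [Function.comp_apply]
    conv_rhs => rw [← hi, hz]
  · rw [← Finset.prod_fiberwise_of_maps_to (g := toCycle g) (t := Finset.univ)
      fun _ _ => Finset.mem_univ _]
    refine Finset.prod_congr rfl fun o _ => ?_
    rw [← Finset.prod_const]
    refine Finset.prod_congr rfl fun x hx => ?_
    rw [Function.comp_apply, (Finset.mem_filter.mp hx).2]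

/-- After exchanging the sums, each `f` takes the same value at two points. Multiplication by their
transposition preserves the condition `f ∘ g = f` and reverses the sign, so the permutations cancel
in pairs. Behind this is the vanishing of the elementary symmetric function whose degree exceeds the
number of variables. -/
theorem sum_sign_prod_parts_powerSum {C ι : Type*} [CommRing C] [Fintype ι] [DecidableEq ι]
    (h : Fintype.card ι < Fintype.card α) (y : ι → C) :
    ∑ g : Equiv.Perm α, (sign g : ℤ) • (g.partition.parts.map fun j => ∑ i, y i ^ j).prod = 0 := by
  simp only [prod_parts_powerSum, Finset.smul_sum]
  rw [Finset.sum_comm]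
  refine Finset.sum_eq_zero fun f _ => ?_
  obtain ⟨a, b, hab, hf⟩ := Fintype.exists_ne_map_eq_of_card_lt f h
  have hs : f ∘ Equiv.swap a b = f := by
    funext x
    rw [Function.comp_apply, Equiv.swap_apply_def]
    split_ifs with h1 h2
    · rw [h1, hf]
    · rw [h2, hf]
    · rfl
  refine Finset.sum_involution (fun g _ => g * Equiv.swap a b) (fun g _ => ?_) (fun g _ _ => ?_)
    (fun _ _ => Finset.mem_univ _) (fun g _ => ?_)
  · have hg : f ∘ (g * Equiv.swap a b : Equiv.Perm α) = f ↔ f ∘ g = f := by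
      rw [coe_mul, ← Function.comp_assoc]
      constructor
      · intro h1
        have h2 : ((f ∘ g) ∘ Equiv.swap a b) ∘ Equiv.swap a b = f ∘ Equiv.swap a b :=
          congrArg (· ∘ _) h1
        rw [Function.comp_assoc, ← coe_mul, Equiv.swap_mul_self, hs] at h2
        exact h2
      · intro h1
        rw [h1, hs]
    simp only [hg, map_mul, sign_swap hab]
    split_ifs <;> simp
  · intro hg
    have := congrArg (fun e : Equiv.Perm α => e a) (mul_eq_left.mp hg)
    simp [Equiv.swap_apply_left] at this
    exact hab this.symm
  · rw [mul_assoc, Equiv.swap_mul_self, mul_one]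

theorem exists_parts_partition_eq_singleton (n : ℕ) :
    ∃ g : Equiv.Perm (Fin (n + 1)), g.partition.parts = {n + 1} := by
  refine ⟨finRotate (n + 1), ?_⟩
  rw [parts_partition]
  cases n with
  | zero => simp [Subsingleton.elim (Equiv.refl (Fin 1)) 1]
  | succ n => simp [cycleType_finRotate, support_finRotate]

/-- The cycle type of a permutation of `Fin N`, as a partition of `N`. -/
def finPartition {N : ℕ} (g : Equiv.Perm (Fin N)) : N.Partition where
  parts := g.partition.parts
  parts_pos := g.partition.parts_pos
  parts_sum := g.partition.parts_sum.trans (Fintype.card_fin N)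

/-- Each fixed point is counted in `N` and again as a part, so it changes the exponent of `-1` by
two. -/
theorem sign_eq_sgn {N : ℕ} (g : Equiv.Perm (Fin N)) : (sign g : ℤ) = sgn (finPartition g) := by
  rw [sign_of_cycleType, sgn, finPartition, parts_partition, Multiset.card_add,
    Multiset.card_replicate, sum_cycleType, Fintype.card_fin]
  have h : g.support.card ≤ N := by simpa using Finset.card_le_univ g.support
  have : N + (Multiset.card g.cycleType + (N - g.support.card)) =
      g.support.card + Multiset.card g.cycleType + 2 * (N - g.support.card) := by omega
  rw [this, pow_add _ _ (2 * _), pow_mul]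
  simp

theorem sum_partition_eq_sum_perm {N : ℕ} {C : Type*} [CommRing C] (p : ℕ → C) :
    ∑ σ : N.Partition, (sgn σ * classCard σ) • (σ.parts.map p).prod =
      ∑ g : Equiv.Perm (Fin N), (sign g : ℤ) • (g.partition.parts.map p).prod := by
  rw [← Finset.sum_fiberwise_of_maps_to (g := finPartition) (t := Finset.univ)
    fun _ _ => Finset.mem_univ _]
  refine Finset.sum_congr rfl fun σ _ => ?_
  have hc : ∀ g ∈ Finset.univ.filter (fun g : Equiv.Perm (Fin N) => finPartition g = σ),
      (sign g : ℤ) • (g.partition.parts.map p).prod = sgn σ • (σ.parts.map p).prod := by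
    intro g hg
    rw [sign_eq_sgn, (Finset.mem_filter.mp hg).2, ← (Finset.mem_filter.mp hg).2]
    rfl
  rw [Finset.sum_congr rfl hc, Finset.sum_const, mul_comm, mul_smul, natCast_zsmul]
  congr 1
  rw [classCard, Nat.card_eq_fintype_card, Fintype.card_subtype]
  congr 1
  ext g
  simp only [Finset.mem_filter, Nat.Partition.ext_iff]
  rfl

end CycleIndex

/-! ### The envelope of the polynomial ring in one variable -/

section EnvelopePolynomial

attribute [local instance 100] LieRing.ofAssociativeRing

variable {k : Type*} [Field k]

variable (k) in
/-- The relation of level `n`, as a polynomial in power sums, without its linear term. -/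
def dominantTail (n : ℕ) : MvPolynomial ℕ k :=
  ∑ σ ∈ (Finset.univ : Finset (n + 1).Partition).erase (Nat.Partition.indiscrete (n + 1)),
    (sgn σ * classCard σ) • (σ.parts.map MvPolynomial.X).prod

variable (k) in
/-- The coefficient of the linear term in the relation of level `n`. -/
def dominantCoeff (n : ℕ) : k :=
  ((sgn (Nat.Partition.indiscrete (n + 1)) * classCard (Nat.Partition.indiscrete (n + 1)) : ℤ) : k)

/-- Up to sign this is the number of `(n+1)`-cycles, which is positive. -/
theorem dominantCoeff_ne_zero [CharZero k] (n : ℕ) : dominantCoeff k n ≠ 0 := by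
  obtain ⟨g, hg⟩ := exists_parts_partition_eq_singleton n
  have hne : classCard (Nat.Partition.indiscrete (n + 1)) ≠ 0 := by
    rw [classCard]
    have : Nonempty {g : Equiv.Perm (Fin (n + 1)) //
        g.partition.parts = (Nat.Partition.indiscrete (n + 1)).parts} := ⟨g, by
      rw [hg, Nat.Partition.indiscrete_parts n.succ_ne_zero]⟩
    exact Nat.card_ne_zero.mpr ⟨this, inferInstance⟩
  rw [dominantCoeff, Int.cast_ne_zero, mul_ne_zero_iff]
  exact ⟨by simp [sgn], by exact_mod_cast hne⟩

/-- A part equal to `n+1` leaves no room for others, so it occurs only in the partition that has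
been erased. -/
theorem dominantTail_mem_supported (n : ℕ) :
    dominantTail k n ∈ MvPolynomial.supported k (Set.Iic n) := by
  refine sum_mem fun σ hσ => zsmul_mem (multiset_prod_mem _ fun x hx => ?_) _
  obtain ⟨j, hj, rfl⟩ := Multiset.mem_map.mp hx
  refine MvPolynomial.X_mem_supported.mpr ?_
  rw [Set.mem_Iic]
  by_contra hlt
  have hle := σ.le_of_mem_parts hj
  obtain rfl : j = n + 1 := by omega
  refine (Finset.mem_erase.mp hσ).1 (Nat.Partition.ext ?_)
  obtain ⟨s, hs⟩ := Multiset.exists_cons_of_mem hj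
  have hsum := σ.parts_sum
  rw [hs, Multiset.sum_cons, Nat.add_eq_left, Multiset.sum_eq_zero_iff] at hsum
  rw [Nat.Partition.indiscrete_parts n.succ_ne_zero, hs]
  have : s = 0 := by
    refine Multiset.eq_zero_of_forall_notMem fun x hx => ?_
    have h1 := σ.parts_pos (i := x) (hs ▸ Multiset.mem_cons_of_mem hx)
    have h2 := hsum x hx
    omega
  rw [this]
  rfl

theorem dominant_eq {C : Type*} [CommRing C] [Algebra k C] (n : ℕ) (p : ℕ → C) :
    ∑ σ : (n + 1).Partition, (sgn σ * classCard σ) • (σ.parts.map p).prod =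
      dominantCoeff k n • p (n + 1) + MvPolynomial.aeval p (dominantTail k n) := by
  rw [← Finset.add_sum_erase _ _ (Finset.mem_univ (Nat.Partition.indiscrete (n + 1)))]
  congr 1
  · rw [Nat.Partition.indiscrete_parts n.succ_ne_zero, Multiset.map_singleton,
      Multiset.prod_singleton, dominantCoeff, Int.cast_smul_eq_zsmul]
  · rw [dominantTail, map_sum]
    refine Finset.sum_congr rfl fun σ _ => ?_
    rw [map_zsmul, map_multiset_prod, Multiset.map_map]
    simp

theorem dominant_psum (n : ℕ) : dominantCoeff k n • MvPolynomial.psum (Fin n) k (n + 1) +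
    MvPolynomial.aeval (fun j => MvPolynomial.psum (Fin n) k j) (dominantTail k n) = 0 := by
  rw [← dominant_eq n fun j => MvPolynomial.psum (Fin n) k j, sum_partition_eq_sum_perm]
  exact sum_sign_prod_parts_powerSum (by simp) _

theorem dominant_powerSum (n : ℕ) (a : Polynomial k) :
    ∑ σ : (n + 1).Partition, (sgn σ * classCard σ) •
      (σ.parts.map fun i => powerSum k n (a ^ i)).prod = 0 := by
  rw [dominant_eq (k := k) n fun i => powerSum k n (a ^ i)]
  exact powerSum_relation (dominant_psum n) a

theorem map_partTensor {A C : Type*} [CommRing A] [Algebra k A] [CommRing C] [Algebra k C]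
    (f : TensorAlgebra k A →ₐ[k] C) {N : ℕ} (σ : N.Partition) (a : A) :
    f (partTensor k σ a) = (σ.parts.map fun i => f (TensorAlgebra.ι k (a ^ i))).prod := by
  rw [partTensor, map_list_prod, List.map_map]
  conv_rhs => rw [← Multiset.sort_eq σ.parts (· ≥ ·)]
  rfl

/-- The homomorphism from the envelope to the symmetric polynomials. -/
def Envelope.toSymPoly (k : Type*) [Field k] (n : ℕ) :
    Envelope k (Polynomial k) n →ₐ[k] SymPoly k n :=
  RingQuot.liftAlgHom k ⟨TensorAlgebra.lift k (powerSum k n), fun x y h => by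
    induction h with
    | level => rw [TensorAlgebra.lift_ι_apply, powerSum_one, map_natCast]
    | jordan a => rw [map_mul, map_mul, mul_comm]
    | triple a b c =>
      have : innerDer a b c = 0 := by rw [innerDer, mul_left_comm, sub_self]
      rw [this, map_zero, smul_zero, map_zero, map_sub, map_mul, map_mul, map_sub, map_mul,
        map_mul]
      ring
    | dominant a =>
      rw [map_sum, map_zero, ← dominant_powerSum n a]
      refine Finset.sum_congr rfl fun σ _ => ?_
      rw [map_zsmul, map_partTensor]
      simp only [TensorAlgebra.lift_ι_apply]⟩

theorem Envelope.toSymPoly_of (n : ℕ) (a : Polynomial k) :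
    Envelope.toSymPoly k n (Envelope.of k (Polynomial k) n a) = powerSum k n a := by
  simp [Envelope.toSymPoly, Envelope.of]

theorem Envelope.adjoin_range_of {A : Type*} [CommRing A] [Algebra k A] (n : ℕ) :
    Algebra.adjoin k (Set.range (Envelope.of k A n)) = ⊤ := by
  refine eq_top_iff.mpr fun x _ => ?_
  obtain ⟨y, rfl⟩ := RingQuot.mkAlgHom_surjective k (EnvRel k n) x
  clear * -
  induction y using TensorAlgebra.induction with
  | algebraMap r => rw [AlgHom.commutes]; exact Subalgebra.algebraMap_mem _ r
  | ι a => exact Algebra.subset_adjoin ⟨a, rfl⟩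
  | mul a b ha hb => rw [map_mul]; exact mul_mem ha hb
  | add a b ha hb => rw [map_add]; exact add_mem ha hb

theorem Envelope.of_mul_of_sq {A : Type*} [CommRing A] [Algebra k A] (n : ℕ) (a : A) :
    Envelope.of k A n a * Envelope.of k A n (a ^ 2) =
      Envelope.of k A n (a ^ 2) * Envelope.of k A n a := by
  have := RingQuot.mkAlgHom_rel k (EnvRel.jordan (k := k) (n := n) a)
  rwa [map_mul, map_mul] at this

theorem Envelope.of_one {A : Type*} [CommRing A] [Algebra k A] (n : ℕ) :
    Envelope.of k A n 1 = n := by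
  have := RingQuot.mkAlgHom_rel k (EnvRel.level (k := k) (A := A) (n := n))
  rwa [map_natCast] at this

theorem Envelope.dominant {A : Type*} [CommRing A] [Algebra k A] (n : ℕ) (a : A) :
    ∑ σ : (n + 1).Partition, (sgn σ * classCard σ) •
      RingQuot.mkAlgHom k (EnvRel k n) (partTensor k σ a) = 0 := by
  have := RingQuot.mkAlgHom_rel k (EnvRel.dominant (k := k) (n := n) a)
  rw [map_sum, map_zero] at this
  simpa only [map_zsmul] using this

/-- The polarization of `[a, a²] = 0`. -/
theorem Envelope.commutator_cyclic [CharZero k] {A : Type*} [CommRing A] [Algebra k A] (n : ℕ)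
    (a b c : A) :
    ⁅Envelope.of k A n a, Envelope.of k A n (b * c)⁆ +
      ⁅Envelope.of k A n b, Envelope.of k A n (c * a)⁆ +
      ⁅Envelope.of k A n c, Envelope.of k A n (a * b)⁆ = 0 := by
  set o := Envelope.of k A n
  have hQ : ∀ x : A, ⁅o x, o (x ^ 2)⁆ = 0 := fun x => by
    rw [Ring.lie_def, Envelope.of_mul_of_sq, sub_self]
  have h2 : ∀ x y : A, o ((x + y) ^ 2) = o (x ^ 2) + (2 : ℕ) • o (x * y) + o (y ^ 2) :=
    fun x y => by
      rw [← map_nsmul, ← map_add, ← map_add]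
      congr 1
      rw [nsmul_eq_mul]
      push_cast
      ring
  have h3 := hQ (a + b + c)
  have hab := hQ (a + b)
  have hbc := hQ (b + c)
  have hac := hQ (a + c)
  have ha := hQ a
  have hb := hQ b
  have hc := hQ c
  simp only [h2, add_mul, map_add, add_lie, lie_add, lie_nsmul, smul_add, ha, hb, hc] at h3 hab hbc hac
  rw [mul_comm c a]
  have : (2 : k) • (⁅o a, o (b * c)⁆ + ⁅o b, o (a * c)⁆ + ⁅o c, o (a * b)⁆) = 0 := by
    -- Inclusion and exclusion for a cubic form: subtracting the values at the pairwise sums from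
    -- the value at `a + b + c` leaves the trilinear part.
    have e := congrArg₂ (· - ·) h3 (congrArg₂ (· + ·) hab (congrArg₂ (· + ·) hbc hac))
    simp only [add_zero, sub_zero] at e
    rw [← e]
    module
  exact (smul_eq_zero.mp this).resolve_left two_ne_zero

/-- The cyclic identity reduces every commutator of powers of `t` to a multiple of one `[t, t ^ i]`,
and this one vanishes because `1` is sent to a scalar. -/
theorem Envelope.of_commute [CharZero k] (n : ℕ) (a b : Polynomial k) :
    Commute (Envelope.of k (Polynomial k) n a) (Envelope.of k (Polynomial k) n b) := by
  set o := Envelope.of k (Polynomial k) n with ho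
  have h1 : ∀ x, ⁅x, o 1⁆ = 0 := fun x => by
    rw [Ring.lie_def, ho, Envelope.of_one, sub_eq_zero]
    exact (Nat.cast_commute n x).symm
  -- The inductive step is the cyclic identity for `t ^ (i+1)`, `t`, `t ^ j`: one factor `t` moves
  -- to the other side of the commutator and leaves a further copy of the same commutator with `t`.
  have key : ∀ i j, ⁅o (Polynomial.X ^ (i + 1)), o (Polynomial.X ^ j)⁆ =
      (i + 1) • ⁅o Polynomial.X, o (Polynomial.X ^ (i + j))⁆ := fun i => by
    induction i with
    | zero => intro j; simp
    | succ i ih =>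
      intro j
      have h := Envelope.commutator_cyclic (k := k) n (Polynomial.X ^ (i + 1)) Polynomial.X
        (Polynomial.X ^ j : Polynomial k)
      rw [← ho, ← pow_succ', ← pow_add, ← pow_succ, ih,
        ← lie_skew (o (Polynomial.X ^ j)), ← sub_eq_add_neg, sub_eq_zero] at h
      rw [← h, show i + (j + 1) = i + 1 + j by omega, show j + (i + 1) = i + 1 + j by omega,
        ← succ_nsmul]
  have hX : ∀ i, ⁅o Polynomial.X, o (Polynomial.X ^ i)⁆ = 0 := fun i => by
    -- For `j = 0` the left side is a commutator with the scalar `n`; division by `i + 1` gives the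
    -- claim.
    have h := key i 0
    rw [pow_zero, h1, add_zero, ← Nat.cast_smul_eq_nsmul k] at h
    exact (smul_eq_zero.mp h.symm).resolve_left (Nat.cast_ne_zero.mpr i.succ_ne_zero)
  have hall : ∀ i j, Commute (o (Polynomial.X ^ i)) (o (Polynomial.X ^ j)) := fun i j => by
    refine sub_eq_zero.mp ?_
    rw [← Ring.lie_def]
    cases i with
    | zero => rw [pow_zero, ← lie_skew, h1, neg_zero]
    | succ i => rw [key, hX, smul_zero]
  induction a using Polynomial.induction_on' with
  | add p q hp hq => rw [map_add]; exact hp.add_left hq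
  | monomial i r =>
    induction b using Polynomial.induction_on' with
    | add p q hp hq => rw [map_add]; exact hp.add_right hq
    | monomial j s =>
      rw [← Polynomial.smul_X_eq_monomial, ← Polynomial.smul_X_eq_monomial, map_smul, map_smul]
      exact ((hall i j).smul_left r).smul_right s

theorem Envelope.commute [CharZero k] (n : ℕ) (x y : Envelope k (Polynomial k) n) :
    Commute x y := by
  have h : ∀ x ∈ Algebra.adjoin k (Set.range (Envelope.of k (Polynomial k) n)),
      ∀ y ∈ Algebra.adjoin k (Set.range (Envelope.of k (Polynomial k) n)), Commute x y :=
    fun x hx y hy => Algebra.commute_of_mem_adjoin_of_forall_mem_commute hy fun z hz =>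
      (Algebra.commute_of_mem_adjoin_of_forall_mem_commute hx fun w hw => by
        obtain ⟨a, rfl⟩ := hz
        obtain ⟨b, rfl⟩ := hw
        exact Envelope.of_commute n a b).symm
  rw [Envelope.adjoin_range_of] at h
  exact h x trivial y trivial

/-- Once the envelope is known to be commutative, `SymPoly.exists_algHom_of_relation` applies to the
canonical map `k[t] → U_n(k[t])`, with the level relation as the required relation. It supplies a
left inverse; surjectivity holds because the power sums generate. -/
theorem Envelope.toSymPoly_bijective [CharZero k] (n : ℕ) :
    Function.Bijective (Envelope.toSymPoly k n) := by
  let _ : CommRing (Envelope k (Polynomial k) n) :=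
    { (inferInstance : Ring (Envelope k (Polynomial k) n)) with
      mul_comm := fun x y => Envelope.commute n x y }
  obtain ⟨θ, hθ⟩ := SymPoly.exists_algHom_of_relation (Envelope.of k (Polynomial k) n)
    (Envelope.of_one n) (dominantCoeff_ne_zero n) (dominantTail_mem_supported n) (dominant_psum n)
    fun a => by
      rw [← dominant_eq n fun j => Envelope.of k (Polynomial k) n (a ^ j)]
      refine Eq.trans (Finset.sum_congr rfl fun σ _ => ?_) (Envelope.dominant n a)
      rw [map_partTensor]
      rfl
  constructor
  · have h : θ.comp (Envelope.toSymPoly k n) = AlgHom.id k _ := by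
      refine AlgHom.ext_of_adjoin_eq_top (Envelope.adjoin_range_of n) ?_
      rintro _ ⟨a, rfl⟩
      rw [AlgHom.comp_apply, Envelope.toSymPoly_of, hθ]
      rfl
    exact Function.LeftInverse.injective (g := θ) fun x => DFunLike.congr_fun h x
  · intro x
    obtain ⟨q, rfl⟩ := psumHom_surjective n x
    have hle : (psumHom k n).range ≤ (Envelope.toSymPoly k n).range := by
      rw [psumHom, ← Algebra.adjoin_range_eq_range_aeval]
      refine Algebra.adjoin_le ?_
      rintro _ ⟨i, rfl⟩
      exact ⟨Envelope.of k (Polynomial k) n (Polynomial.X ^ ((i : ℕ) + 1)), by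
        change Envelope.toSymPoly k n _ = _
        rw [Envelope.toSymPoly_of, powerSum_X_pow]⟩
    exact hle ⟨q, rfl⟩

theorem newtonAction_apply (n : ℕ) (a : Polynomial k) (x : SymPoly k n) :
    newtonAction k n a x = powerSum k n a * x := by
  have : newtonAction k n = (Algebra.lmul k (SymPoly k n)).toLinearMap ∘ₗ powerSum k n := by
    refine (Polynomial.basisMonomials k).ext fun j => ?_
    rw [newtonAction, Module.Basis.constr_basis, LinearMap.comp_apply,
      Polynomial.coe_basisMonomials]
    simp only
    rw [← Polynomial.X_pow_eq_monomial, powerSum_X_pow]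
    rfl
  rw [this]
  rfl

theorem isFreeOfRank_newtonAction [CharZero k] (n : ℕ) :
    IsFreeOfRank n 1 (newtonAction k n) := by
  refine ⟨(Algebra.lmul k (SymPoly k n)).comp (Envelope.toSymPoly k n), fun a => ?_,
    (LinearEquiv.funUnique (Fin 1) k _).trans
      (LinearEquiv.ofBijective (Envelope.toSymPoly k n).toLinearMap
        (Envelope.toSymPoly_bijective n)), fun u w => ?_⟩
  · refine LinearMap.ext fun x => ?_
    rw [newtonAction_apply, AlgHom.comp_apply, Envelope.toSymPoly_of]
    rfl
  · exact map_mul (Envelope.toSymPoly k n) u (w default)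

end EnvelopePolynomial

/-! ### Symmetric polynomials of lowering operators -/

section Lowering

variable {k : Type*} [Field k]

/-- The linear map `k[x₁, …, xᵣ] → B` that sends `a₁(x₁) ⋯ aᵣ(xᵣ)` to `φ(a₁) ⋯ φ(aᵣ)`. -/
def polyProd {B : Type*} [CommRing B] [Algebra k B] (φ : Polynomial k →ₗ[k] B) (r : ℕ) :
    MvPolynomial (Fin r) k →ₗ[k] B :=
  (MvPolynomial.basisMonomials (Fin r) k).constr k fun α => ∏ i, φ (Polynomial.X ^ α i)

theorem polyProd_prod {B : Type*} [CommRing B] [Algebra k B] (φ : Polynomial k →ₗ[k] B) (r : ℕ)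
    (a : Fin r → Polynomial k) :
    polyProd φ r (∏ i, Polynomial.aeval (MvPolynomial.X i) (a i)) = ∏ i, φ (a i) := by
  have h : (polyProd φ r).compMultilinearMap
      ((MultilinearMap.mkPiAlgebra k (Fin r) (MvPolynomial (Fin r) k)).compLinearMap
        fun i => (Polynomial.aeval (MvPolynomial.X i)).toLinearMap) =
      (MultilinearMap.mkPiAlgebra k (Fin r) B).compLinearMap fun _ => φ := by
    refine Module.Basis.ext_multilinear (fun _ => Polynomial.basisMonomials k) fun v => ?_
    have hv : ∏ i, (MvPolynomial.X i : MvPolynomial (Fin r) k) ^ v i =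
        MvPolynomial.basisMonomials (Fin r) k (Finsupp.equivFunOnFinite.symm v) := by
      rw [MvPolynomial.coe_basisMonomials]
      simp only
      rw [MvPolynomial.monomial_eq, Finsupp.prod_fintype]
      · simp
      · simp
    simp only [LinearMap.compMultilinearMap_apply, MultilinearMap.compLinearMap_apply,
      MultilinearMap.mkPiAlgebra_apply, Polynomial.coe_basisMonomials,
      ← Polynomial.X_pow_eq_monomial, AlgHom.toLinearMap_apply, map_pow, Polynomial.aeval_X]
    rw [hv, polyProd, Module.Basis.constr_basis]
    rfl
  exact congrArg (fun f => f a) h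

theorem polyProd_powerProd {B : Type*} [CommRing B] [Algebra k B] (φ : Polynomial k →ₗ[k] B)
    (r : ℕ) (a : Polynomial k) : polyProd φ r (powerProd k r a) = φ a ^ r := by
  rw [coe_powerProd, polyProd_prod φ r fun _ => a, Finset.prod_const, Finset.card_univ,
    Fintype.card_fin]

/-- Multiplication by `∑ c(xᵢ)` replaces the factor `a(xᵢ)` by `(ca)(xᵢ)`, for each `i` in turn, and
all `r` terms have the same image. -/
theorem polyProd_powerProd_mul_powerSum {B : Type*} [CommRing B] [Algebra k B]
    (φ : Polynomial k →ₗ[k] B) (r : ℕ) (a c : Polynomial k) :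
    polyProd φ r ((powerProd k r a * powerSum k r c : SymPoly k r) : MvPolynomial (Fin r) k) =
      r • (φ (c * a) * φ a ^ (r - 1)) := by
  have hu : ∀ i, ∀ j ∈ Finset.univ.erase i,
      Function.update (fun _ : Fin r => a) i (c * a) j = a :=
    fun i j hj => Function.update_of_ne (Finset.ne_of_mem_erase hj) _ _
  have h : ((powerProd k r a * powerSum k r c : SymPoly k r) : MvPolynomial (Fin r) k) =
      ∑ i, ∏ j, Polynomial.aeval (MvPolynomial.X j)
        (Function.update (fun _ => a) i (c * a) j) := by
    rw [MulMemClass.coe_mul, coe_powerProd, coe_powerSum, Finset.mul_sum]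
    refine Finset.sum_congr rfl fun i _ => ?_
    rw [← Finset.mul_prod_erase _ _ (Finset.mem_univ i),
      ← Finset.mul_prod_erase _ _ (Finset.mem_univ i), Function.update_self, map_mul]
    have hq : ∏ j ∈ Finset.univ.erase i, Polynomial.aeval (MvPolynomial.X j : MvPolynomial (Fin r) k)
        (Function.update (fun _ : Fin r => a) i (c * a) j) =
        ∏ j ∈ Finset.univ.erase i, Polynomial.aeval (MvPolynomial.X j) a :=
      Finset.prod_congr rfl fun j hj => by rw [hu i j hj]
    rw [hq]
    ring
  rw [h, map_sum]
  refine (Finset.sum_congr rfl fun i _ => ?_).trans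
    ((Finset.sum_const _).trans (by rw [Finset.card_univ, Fintype.card_fin]))
  rw [polyProd_prod, ← Finset.mul_prod_erase _ _ (Finset.mem_univ i), Function.update_self]
  have hq : ∏ j ∈ Finset.univ.erase i, φ (Function.update (fun _ : Fin r => a) i (c * a) j) =
      ∏ j ∈ Finset.univ.erase i, φ a := Finset.prod_congr rfl fun j hj => by rw [hu i j hj]
  rw [hq, Finset.prod_const, Finset.card_erase_of_mem (Finset.mem_univ i), Finset.card_univ,
    Fintype.card_fin]

/-- `f(a)`, where `f = !![0, 0; 1, 0]`. -/
def fElt (a : Polynomial k) : Current k (Polynomial k) :=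
  a ⊗ₜ[k] LieAlgebra.SpecialLinear.single 1 0 (by decide) (1 : k)

theorem lie_eElt_fElt (a b : Polynomial k) : ⁅eElt k a, fElt b⁆ = hElt k (a * b) := by
  rw [eElt, fElt, hElt, LieAlgebra.ExtendScalars.bracket_tmul]
  congr 1
  refine Subtype.ext ?_
  ext i j
  fin_cases i <;> fin_cases j <;>
    simp [Ring.lie_def]

theorem lie_hElt_fElt (a b : Polynomial k) : ⁅hElt k a, fElt b⁆ = -(2 • fElt (a * b)) := by
  rw [fElt, hElt, fElt, LieAlgebra.ExtendScalars.bracket_tmul, ← TensorProduct.tmul_smul,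
    ← TensorProduct.tmul_neg]
  congr 1
  refine Subtype.ext ?_
  ext i j
  fin_cases i <;> fin_cases j <;>
    norm_num [Ring.lie_def]

theorem lie_fElt_fElt (a b : Polynomial k) : ⁅fElt a, fElt b⁆ = 0 := by
  rw [fElt, fElt, LieAlgebra.ExtendScalars.bracket_tmul, lie_self, TensorProduct.tmul_zero]

theorem eq_top_of_mem_current (N : Submodule k (Current k (Polynomial k)))
    (he : ∀ a, eElt k a ∈ N) (hh : ∀ a, hElt k a ∈ N) (hf : ∀ a, fElt a ∈ N) : N = ⊤ := by
  refine eq_top_iff.mpr fun x _ => ?_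
  induction x using TensorProduct.induction_on with
  | zero => exact zero_mem _
  | add x y hx hy => exact add_mem (hx trivial) (hy trivial)
  | tmul a x =>
    have hx : x = x.1 0 1 • LieAlgebra.SpecialLinear.single 0 1 (by decide) (1 : k) +
        x.1 0 0 • LieAlgebra.SpecialLinear.singleSubSingle 0 1 (1 : k) +
        x.1 1 0 • LieAlgebra.SpecialLinear.single 1 0 (by decide) (1 : k) := by
      have ht : x.1 0 0 + x.1 1 1 = 0 := by
        rw [← Matrix.trace_fin_two]
        exact x.2
      refine Subtype.ext ?_
      ext i j
      fin_cases i <;> fin_cases j <;> simp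
      exact eq_neg_of_add_eq_zero_right ht
    rw [hx, TensorProduct.tmul_add, TensorProduct.tmul_add, TensorProduct.tmul_smul,
      TensorProduct.tmul_smul, TensorProduct.tmul_smul]
    exact add_mem (add_mem (N.smul_mem _ (he a)) (N.smul_mem _ (hh a))) (N.smul_mem _ (hf a))

variable {W : Type*} [AddCommGroup W] [Module k W] [LieRingModule (Current k (Polynomial k)) W]
  [LieModule k (Current k (Polynomial k)) W]

variable (k W) in
/-- The operators `f(a)` on an `sl₂[t]`-module. -/
def fOp : Polynomial k →ₗ[k] Module.End k W where
  toFun a := LieModule.toEnd k (Current k (Polynomial k)) W (fElt a)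
  map_add' a b := by rw [fElt, TensorProduct.add_tmul, map_add]; rfl
  map_smul' c a := by rw [fElt, ← TensorProduct.smul_tmul', map_smul]; rfl

variable (k W) in
/-- The algebra generated by the commuting operators `f(a)`. -/
abbrev LowerAlgebra : Subalgebra k (Module.End k W) := Algebra.adjoin k (Set.range (fOp k W))

instance : IsMulCommutative (LowerAlgebra k W) :=
  Algebra.isMulCommutative_adjoin k (by
    rintro _ ⟨a, rfl⟩ _ ⟨b, rfl⟩
    refine LinearMap.ext fun x => ?_
    change ⁅fElt a, ⁅fElt b, x⁆⁆ = ⁅fElt b, ⁅fElt a, x⁆⁆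
    rw [leibniz_lie, lie_fElt_fElt, zero_lie, zero_add])

instance : CommRing (LowerAlgebra k W) :=
  { (inferInstance : Ring (LowerAlgebra k W)) with mul_comm := mul_comm' }

variable (k W) in
/-- The operators `f(a)`, as elements of the commutative algebra that they generate. -/
def lowerOp : Polynomial k →ₗ[k] LowerAlgebra k W :=
  (fOp k W).codRestrict (Subalgebra.toSubmodule (LowerAlgebra k W))
    fun a => Algebra.subset_adjoin ⟨a, rfl⟩

theorem lowerOp_smul (a : Polynomial k) (x : W) : lowerOp k W a • x = ⁅fElt a, x⁆ := rfl

theorem lie_hElt_lowerOp_pow_smul (c a : Polynomial k) (r : ℕ) (x : W) :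
    ⁅hElt k c, lowerOp k W a ^ r • x⁆ = lowerOp k W a ^ r • ⁅hElt k c, x⁆ -
      (2 * r) • (lowerOp k W (c * a) * lowerOp k W a ^ (r - 1)) • x := by
  induction r with
  | zero => simp
  | succ r ih =>
    rw [pow_succ', mul_smul, lowerOp_smul, leibniz_lie, lie_hElt_fElt, neg_lie, nsmul_lie,
      ← lowerOp_smul, ← lowerOp_smul, ih, smul_sub, ← mul_smul, ← mul_smul, Nat.add_sub_cancel,
      smul_comm _ (2 * r), ← mul_smul, mul_left_comm]
    have h : (2 * r) • (lowerOp k W (c * a) * (lowerOp k W a * lowerOp k W a ^ (r - 1))) • x =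
        (2 * r) • (lowerOp k W (c * a) * lowerOp k W a ^ r) • x := by
      cases r with
      | zero => simp
      | succ r => rw [Nat.add_sub_cancel, ← pow_succ']
    rw [h]
    module

/-- A linear map from the symmetric polynomials to an `sl₂[t]`-module that is annihilated by the
`e(a)` and on which `h(a)` acts through multiplication by the power sums `a(x₁) + ⋯ + a(xₙ)`. -/
structure IsHighestWeight (n : ℕ) (w : SymPoly k n →ₗ[k] W) : Prop where
  lie_e : ∀ (a : Polynomial k) m, ⁅eElt k a, w m⁆ = 0
  lie_h : ∀ (a : Polynomial k) m, ⁅hElt k a, w m⁆ = w (powerSum k n a * m)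

/-- Moving `e(b)` past a factor `f(a)` leaves `h(ba)`, and moving that to the right past the
remaining factors produces `f(ba²)`. The truncated exponent `r - 1` is harmless, since its term
carries the factor `r`. -/
theorem IsHighestWeight.lie_eElt_lowerOp_pow_smul {n : ℕ} {w : SymPoly k n →ₗ[k] W}
    (hw : IsHighestWeight n w) (b a : Polynomial k) (r : ℕ) (m : SymPoly k n) :
    ⁅eElt k b, lowerOp k W a ^ (r + 1) • w m⁆ =
      (r + 1) • (lowerOp k W a ^ r • w (powerSum k n (b * a) * m) -
        r • (lowerOp k W (b * a * a) * lowerOp k W a ^ (r - 1)) • w m) := by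
  induction r with
  | zero =>
    rw [zero_add, pow_one, lowerOp_smul, leibniz_lie, lie_eElt_fElt, hw.lie_e, lie_zero, add_zero,
      hw.lie_h]
    simp
  | succ r ih =>
    rw [pow_succ', mul_smul, lowerOp_smul, leibniz_lie, lie_eElt_fElt, ← lowerOp_smul, ih,
      lie_hElt_lowerOp_pow_smul, hw.lie_h, smul_comm _ (r + 1), smul_sub, smul_comm _ r,
      ← mul_smul, ← mul_smul, ← pow_succ', mul_left_comm, Nat.add_sub_cancel]
    have h : r • (lowerOp k W (b * a * a) * (lowerOp k W a * lowerOp k W a ^ (r - 1))) • w m =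
        r • (lowerOp k W (b * a * a) * lowerOp k W a ^ r) • w m := by
      cases r with
      | zero => simp
      | succ r => rw [Nat.add_sub_cancel, ← pow_succ']
    rw [h]
    module

end Lowering

/-! ### Tensor products of rings of symmetric polynomials -/

section BiSym

variable {k : Type*} [Field k] {r n : ℕ}

/-- Polynomials that are symmetric in two separate sets of variables. -/
def BiSym (k : Type*) [Field k] (r n : ℕ) : Type _ := SymPoly k r ⊗[k] SymPoly k n

namespace BiSym

instance : CommRing (BiSym k r n) := inferInstanceAs (CommRing (SymPoly k r ⊗[k] SymPoly k n))

instance : Algebra k (BiSym k r n) := inferInstanceAs (Algebra k (SymPoly k r ⊗[k] SymPoly k n))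

/-- Symmetric polynomials in the first set of variables. -/
def inl : SymPoly k r →ₐ[k] BiSym k r n :=
  (Algebra.TensorProduct.includeLeft : SymPoly k r →ₐ[k] SymPoly k r ⊗[k] SymPoly k n)

/-- Symmetric polynomials in the second set of variables. -/
def inr : SymPoly k n →ₐ[k] BiSym k r n :=
  (Algebra.TensorProduct.includeRight : SymPoly k n →ₐ[k] SymPoly k r ⊗[k] SymPoly k n)

/-- The linear map out of `BiSym k r n` given by a bilinear map. -/
def liftLinear {E : Type*} [AddCommGroup E] [Module k E]
    (f : SymPoly k r →ₗ[k] SymPoly k n →ₗ[k] E) : BiSym k r n →ₗ[k] E :=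
  (TensorProduct.lift f : SymPoly k r ⊗[k] SymPoly k n →ₗ[k] E)

/-- The algebra homomorphism out of `BiSym k r n` given by its restrictions to both factors. -/
def lift {C : Type*} [CommRing C] [Algebra k C] (f : SymPoly k r →ₐ[k] C)
    (g : SymPoly k n →ₐ[k] C) : BiSym k r n →ₐ[k] C :=
  (Algebra.TensorProduct.productMap f g : SymPoly k r ⊗[k] SymPoly k n →ₐ[k] C)

theorem inl_mul_inr (y : SymPoly k r) (m : SymPoly k n) :
    (inl y * inr m : BiSym k r n) = (y ⊗ₜ[k] m : SymPoly k r ⊗[k] SymPoly k n) :=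
  (Algebra.TensorProduct.tmul_mul_tmul _ _ _ _).trans (by rw [mul_one, one_mul])

theorem liftLinear_inl_mul_inr {E : Type*} [AddCommGroup E] [Module k E]
    (f : SymPoly k r →ₗ[k] SymPoly k n →ₗ[k] E) (y : SymPoly k r) (m : SymPoly k n) :
    liftLinear f (inl y * inr m) = f y m := by
  rw [inl_mul_inr]
  rfl

section lift

variable {C : Type*} [CommRing C] [Algebra k C] (f : SymPoly k r →ₐ[k] C) (g : SymPoly k n →ₐ[k] C)

theorem lift_inl (y : SymPoly k r) : lift f g (inl y) = f y :=
  Algebra.TensorProduct.productMap_left_apply f g y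

theorem lift_inr (m : SymPoly k n) : lift f g (inr m) = g m :=
  Algebra.TensorProduct.productMap_right_apply f g m

end lift

theorem linearMap_ext {E : Type*} [AddCommGroup E] [Module k E] {f g : BiSym k r n →ₗ[k] E}
    (h : ∀ y m, f (inl y * inr m) = g (inl y * inr m)) : f = g :=
  TensorProduct.ext' (R := k) (M := SymPoly k r) (N := SymPoly k n) fun y m => by
    have := h y m
    rwa [inl_mul_inr] at this

theorem linearMap_ext_powerProd [CharZero k] {E : Type*} [AddCommGroup E] [Module k E]
    {f g : BiSym k r n →ₗ[k] E}
    (h : ∀ a m, f (inl (powerProd k r a) * inr m) = g (inl (powerProd k r a) * inr m)) : f = g := by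
  refine linearMap_ext fun y m => ?_
  have : (f ∘ₗ LinearMap.mulRight k (inr m)) ∘ₗ (inl : SymPoly k r →ₐ[k] BiSym k r n).toLinearMap =
      (g ∘ₗ LinearMap.mulRight k (inr m)) ∘ₗ (inl : SymPoly k r →ₐ[k] BiSym k r n).toLinearMap := by
    refine LinearMap.ext_on_range (span_powerProd r) fun a => h a m
  exact LinearMap.congr_fun this y

theorem algHom_ext [CharZero k] {C : Type*} [CommRing C] [Algebra k C] {f g : BiSym k r n →ₐ[k] C}
    (hl : ∀ y, f (inl y) = g (inl y)) (hr : ∀ m, f (inr m) = g (inr m)) : f = g := by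
  have : f.toLinearMap = g.toLinearMap := linearMap_ext fun y m => by
    simp only [AlgHom.toLinearMap_apply, map_mul, hl, hr]
  exact AlgHom.ext fun x => LinearMap.congr_fun this x

end BiSym

variable (k) in
/-- The shifted action of `h(a)`. -/
def shiftedSum (n r : ℕ) : Polynomial k →ₗ[k] BiSym k r n :=
  BiSym.inr.toLinearMap ∘ₗ powerSum k n - BiSym.inl.toLinearMap ∘ₗ powerSum k r

theorem shiftedSum_apply (n r : ℕ) (a : Polynomial k) :
    shiftedSum k n r a = BiSym.inr (powerSum k n a) - BiSym.inl (powerSum k r a) := rfl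

variable {W : Type*} [AddCommGroup W] [Module k W] [LieRingModule (Current k (Polynomial k)) W]
  [LieModule k (Current k (Polynomial k)) W]

/-- The linear map `y ⊗ m ↦ y(f) w(m)`, where `a₁(x₁) ⋯ aᵣ(xᵣ)` at `f` is `f(a₁) ⋯ f(aᵣ)`. -/
def lowerMap (w : SymPoly k n →ₗ[k] W) (r : ℕ) : BiSym k r n →ₗ[k] W :=
  BiSym.liftLinear (LinearMap.lcomp k W w ∘ₗ (LowerAlgebra k W).val.toLinearMap ∘ₗ
    polyProd (lowerOp k W) r ∘ₗ (MvPolynomial.symmetricSubalgebra (Fin r) k).val.toLinearMap)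

theorem lowerMap_inl_mul_inr (w : SymPoly k n →ₗ[k] W) (r : ℕ) (y : SymPoly k r)
    (m : SymPoly k n) :
    lowerMap w r (BiSym.inl y * BiSym.inr m) = polyProd (lowerOp k W) r y • w m := by
  rw [lowerMap, BiSym.liftLinear_inl_mul_inr]
  rfl

theorem lowerMap_powerProd (w : SymPoly k n →ₗ[k] W) (r : ℕ) (a : Polynomial k)
    (m : SymPoly k n) : lowerMap w r (BiSym.inl (powerProd k r a) * BiSym.inr m) =
      lowerOp k W a ^ r • w m := by
  rw [lowerMap_inl_mul_inr, polyProd_powerProd]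

/-- Both terms of the commutator formula are ring multiplications on the parameter: by a power sum
in the second set of variables, and by minus the same power sum in the first. This turns the action
of `e(b)` into commutative algebra. -/
theorem IsHighestWeight.lie_eElt_lowerMap_powerProd {w : SymPoly k n →ₗ[k] W}
    (hw : IsHighestWeight n w) (b a : Polynomial k) (r : ℕ) (m : SymPoly k n) :
    ⁅eElt k b, lowerMap w (r + 1) (BiSym.inl (powerProd k (r + 1) a) * BiSym.inr m)⁆ =
      (r + 1) • lowerMap w r
        (BiSym.inl (powerProd k r a) * BiSym.inr m * shiftedSum k n r (b * a)) := by
  have h : (BiSym.inl (powerProd k r a) * BiSym.inr m * shiftedSum k n r (b * a) : BiSym k r n) =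
      BiSym.inl (powerProd k r a) * BiSym.inr (powerSum k n (b * a) * m) -
        BiSym.inl (powerProd k r a * powerSum k r (b * a)) * BiSym.inr m := by
    rw [shiftedSum_apply, map_mul BiSym.inr, map_mul BiSym.inl]
    ring
  rw [h, map_sub, lowerMap_powerProd, hw.lie_eElt_lowerOp_pow_smul, lowerMap_powerProd,
    lowerMap_inl_mul_inr, polyProd_powerProd_mul_powerSum, smul_assoc]

end BiSym

/-! ### Separation of one variable and the action of `e` on products of lowering operators. -/

section Contraction

variable {k : Type*} [Field k]

theorem BiSym.subalgebra_eq_top {r n : ℕ} (S : Subalgebra k (BiSym k r n))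
    (hl : ∀ y, BiSym.inl y ∈ S) (hr : ∀ m, BiSym.inr m ∈ S) : S = ⊤ := by
  refine eq_top_iff.mpr fun x _ => ?_
  have h : ∀ z : SymPoly k r ⊗[k] SymPoly k n, (z : BiSym k r n) ∈ S := fun z => by
    induction z using TensorProduct.induction_on with
    | zero => exact S.zero_mem
    | add x y hx hy => exact S.add_mem hx hy
    | tmul y m =>
      have := S.mul_mem (hl y) (hr m)
      rwa [BiSym.inl_mul_inr] at this
  exact h x

theorem SymPoly.subalgebra_eq_top [CharZero k] {m : ℕ} (S : Subalgebra k (SymPoly k m))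
    (h : ∀ j, newton k m j ∈ S) : S = ⊤ := by
  refine eq_top_iff.mpr fun x _ => ?_
  obtain ⟨q, rfl⟩ := psumHom_surjective m x
  have hle : (psumHom k m).range ≤ S := by
    rw [psumHom, ← Algebra.adjoin_range_eq_range_aeval]
    refine Algebra.adjoin_le ?_
    rintro _ ⟨i, rfl⟩
    exact h _
  exact hle ⟨q, rfl⟩

/-- Polynomials in `r + 1` variables, as polynomials in the first variable. -/
def joinVar (k : Type*) [Field k] (r : ℕ) :
    Polynomial (SymPoly k r) →ₐ[k] MvPolynomial (Fin (r + 1)) k :=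
  ((MvPolynomial.finSuccEquiv k r).symm : _ →ₐ[k] _).comp
    (Polynomial.mapAlgHom (MvPolynomial.symmetricSubalgebra (Fin r) k).val)

theorem joinVar_injective (r : ℕ) : Function.Injective (joinVar k r) :=
  (MvPolynomial.finSuccEquiv k r).symm.injective.comp
    (Polynomial.map_injective _ Subtype.val_injective)

theorem joinVar_C (r : ℕ) (y : SymPoly k r) :
    joinVar k r (Polynomial.C y) = MvPolynomial.rename Fin.succ (y : MvPolynomial (Fin r) k) := by
  change (MvPolynomial.finSuccEquiv k r).symm (Polynomial.map _ (Polynomial.C y)) = _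
  rw [AlgEquiv.symm_apply_eq, Polynomial.map_C]
  have h : (MvPolynomial.finSuccEquiv k r).toAlgHom.comp (MvPolynomial.rename Fin.succ) =
      Polynomial.CAlgHom := by
    refine MvPolynomial.algHom_ext fun i => ?_
    simp [MvPolynomial.finSuccEquiv_X_succ]
  exact (DFunLike.congr_fun h (y : MvPolynomial (Fin r) k)).symm

theorem joinVar_X (r : ℕ) : joinVar k r Polynomial.X = MvPolynomial.X 0 := by
  change (MvPolynomial.finSuccEquiv k r).symm (Polynomial.map _ Polynomial.X) = _
  rw [AlgEquiv.symm_apply_eq, Polynomial.map_X, MvPolynomial.finSuccEquiv_X_zero]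

theorem joinVar_aeval_X (r : ℕ) (a : Polynomial k) :
    joinVar k r (Polynomial.aeval Polynomial.X a) = Polynomial.aeval (MvPolynomial.X 0) a := by
  rw [← Polynomial.aeval_algHom_apply, joinVar_X]

/-- A power sum splits as the power sum of the last `r` variables plus a power of the first.
Prescribing this on the first `r + 1` power sums defines the homomorphism, and the comparison with
`joinVar` needs checking only there. -/
theorem exists_splitVar [CharZero k] (r : ℕ) :
    ∃ δ : SymPoly k (r + 1) →ₐ[k] Polynomial (SymPoly k r), ∀ y, joinVar k r (δ y) = y := by
  obtain ⟨δ, hδ⟩ := SymPoly.exists_algHom (k := k) (m := r + 1)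
    fun j => Polynomial.C (newton k r j) + Polynomial.X ^ j
  refine ⟨δ, fun y => ?_⟩
  have : (joinVar k r).comp δ = (MvPolynomial.symmetricSubalgebra (Fin (r + 1)) k).val := by
    refine SymPoly.algHom_ext fun j h1 h2 => ?_
    rw [AlgHom.comp_apply, hδ j h1 h2, map_add, map_pow, joinVar_C, joinVar_X]
    simp [coe_newton, MvPolynomial.psum, Fin.sum_univ_succ, add_comm]
  exact DFunLike.congr_fun this y

variable {n : ℕ}

/-- The contraction of the variable against the shifted action of `h`. -/
def contract (k : Type*) [Field k] (n r : ℕ) :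
    Polynomial (BiSym k r n) →ₗ[BiSym k r n] BiSym k r n :=
  (Polynomial.basisMonomials (BiSym k r n)).constr (BiSym k r n)
    fun j => shiftedSum k n r (Polynomial.X ^ j)

theorem contract_aeval_X (r : ℕ) (a : Polynomial k) :
    contract k n r (Polynomial.aeval Polynomial.X a) = shiftedSum k n r a := by
  have : (contract k n r).restrictScalars k ∘ₗ (Polynomial.aeval Polynomial.X).toLinearMap =
      shiftedSum k n r := by
    refine (Polynomial.basisMonomials k).ext fun j => ?_
    have h : (Polynomial.X : Polynomial (BiSym k r n)) ^ j =
      Polynomial.basisMonomials (BiSym k r n) j := Polynomial.X_pow_eq_monomial j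
    rw [LinearMap.comp_apply, Polynomial.coe_basisMonomials]
    simp only [← Polynomial.X_pow_eq_monomial, AlgHom.toLinearMap_apply, map_pow,
      Polynomial.aeval_X, LinearMap.restrictScalars_apply]
    rw [h, contract, Module.Basis.constr_basis]
  exact LinearMap.congr_fun this a

theorem contract_C_mul (r : ℕ) (x : BiSym k r n) (q : Polynomial (BiSym k r n)) :
    contract k n r (Polynomial.C x * q) = x * contract k n r q := by
  rw [← Polynomial.smul_eq_C_mul, map_smul, smul_eq_mul]

variable {W : Type*} [AddCommGroup W] [Module k W] [LieRingModule (Current k (Polynomial k)) W]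
  [LieModule k (Current k (Polynomial k)) W] {w : SymPoly k n →ₗ[k] W}

variable (w) in
/-- The largest ideal in the kernel of `lowerMap w r`. -/
def lowerIdeal (r : ℕ) : Ideal (BiSym k r n) where
  carrier := {x | ∀ y, lowerMap w r (y * x) = 0}
  zero_mem' y := by rw [mul_zero, map_zero]
  add_mem' hx hy y := by rw [mul_add, map_add, hx, hy, add_zero]
  smul_mem' c x hx y := by rw [smul_eq_mul, ← mul_assoc, hx]

theorem lowerMap_eq_zero_of_mem {r : ℕ} {x : BiSym k r n} (hx : x ∈ lowerIdeal w r) :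
    lowerMap w r x = 0 := by
  simpa using hx 1

variable [CharZero k]

variable (k) in
/-- A symmetric polynomial in `r + 1` variables, as a polynomial in the first variable. -/
def splitVar (r : ℕ) : SymPoly k (r + 1) →ₐ[k] Polynomial (SymPoly k r) :=
  (exists_splitVar r).choose

theorem joinVar_splitVar (r : ℕ) (y : SymPoly k (r + 1)) : joinVar k r (splitVar k r y) = y :=
  (exists_splitVar r).choose_spec y

theorem splitVar_powerProd (r : ℕ) (a : Polynomial k) : splitVar k r (powerProd k (r + 1) a) =
    Polynomial.C (powerProd k r a) * Polynomial.aeval Polynomial.X a := by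
  refine joinVar_injective r ?_
  rw [joinVar_splitVar, map_mul, joinVar_C, joinVar_aeval_X, coe_powerProd, coe_powerProd,
    map_prod, Fin.prod_univ_succ, mul_comm]
  simp only [← Polynomial.aeval_algHom_apply, MvPolynomial.rename_X]

theorem splitVar_powerSum (r : ℕ) (a : Polynomial k) : splitVar k r (powerSum k (r + 1) a) =
    Polynomial.C (powerSum k r a) + Polynomial.aeval Polynomial.X a := by
  refine joinVar_injective r ?_
  rw [joinVar_splitVar, map_add, joinVar_C, joinVar_aeval_X, coe_powerSum, coe_powerSum,
    map_sum, Fin.sum_univ_succ, add_comm (_ : MvPolynomial (Fin (r + 1)) k)]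
  simp only [← Polynomial.aeval_algHom_apply, MvPolynomial.rename_X]

/-- The separation of one variable in the first set. -/
def BiSym.split (k : Type*) [Field k] [CharZero k] (n r : ℕ) :
    BiSym k (r + 1) n →ₐ[k] Polynomial (BiSym k r n) :=
  BiSym.lift ((Polynomial.mapAlgHom BiSym.inl).comp (splitVar k r))
    (Polynomial.CAlgHom.comp BiSym.inr)

theorem BiSym.split_inr (r : ℕ) (m : SymPoly k n) :
    BiSym.split k n r (BiSym.inr m) = Polynomial.C (BiSym.inr m) := by
  rw [BiSym.split, BiSym.lift_inr]
  rfl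

theorem BiSym.split_inl_powerProd (r : ℕ) (a : Polynomial k) :
    BiSym.split k n r (BiSym.inl (powerProd k (r + 1) a)) =
      Polynomial.C (BiSym.inl (powerProd k r a)) * Polynomial.aeval Polynomial.X a := by
  rw [BiSym.split, BiSym.lift_inl, AlgHom.comp_apply, splitVar_powerProd, map_mul,
    ← Polynomial.aeval_algHom_apply]
  simp

theorem BiSym.split_inl_powerSum (r : ℕ) (a : Polynomial k) :
    BiSym.split k n r (BiSym.inl (powerSum k (r + 1) a)) =
      Polynomial.C (BiSym.inl (powerSum k r a)) + Polynomial.aeval Polynomial.X a := by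
  rw [BiSym.split, BiSym.lift_inl, AlgHom.comp_apply, splitVar_powerSum, map_add,
    ← Polynomial.aeval_algHom_apply]
  simp

theorem BiSym.split_shiftedSum (r : ℕ) (a : Polynomial k) :
    BiSym.split k n r (shiftedSum k n (r + 1) a) =
      Polynomial.C (shiftedSum k n r a) - Polynomial.aeval Polynomial.X a := by
  rw [shiftedSum_apply, shiftedSum_apply, map_sub, BiSym.split_inr, BiSym.split_inl_powerSum,
    map_sub]
  ring

/-- By linearity `x` may be taken of the form `a(x₁) ⋯ a(xᵣ₊₁) ⊗ m`. Separating a variable frees a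
factor `a(X)`, which together with `b(X)` is contracted to the shifted sum of `ab`. -/
theorem IsHighestWeight.lie_eElt_lowerMap (hw : IsHighestWeight n w) (b : Polynomial k) (r : ℕ)
    (x : BiSym k (r + 1) n) : ⁅eElt k b, lowerMap w (r + 1) x⁆ =
      (r + 1) • lowerMap w r
        (contract k n r (BiSym.split k n r x * Polynomial.aeval Polynomial.X b)) := by
  have : LieModule.toEnd k (Current k (Polynomial k)) W (eElt k b) ∘ₗ lowerMap w (r + 1) =
      (r + 1) • (lowerMap w r ∘ₗ (contract k n r).restrictScalars k ∘ₗ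
        LinearMap.mulRight k (Polynomial.aeval Polynomial.X b) ∘ₗ
          (BiSym.split k n r).toLinearMap) := by
    refine BiSym.linearMap_ext_powerProd fun a m => ?_
    refine (hw.lie_eElt_lowerMap_powerProd b a r m).trans ?_
    simp only [LinearMap.smul_apply, LinearMap.comp_apply, LinearMap.restrictScalars_apply,
      LinearMap.mulRight_apply, AlgHom.toLinearMap_apply]
    congr 2
    rw [map_mul (BiSym.split k n r), BiSym.split_inl_powerProd, BiSym.split_inr,
      mul_right_comm (Polynomial.C _), ← map_mul, mul_assoc (Polynomial.C _),
      ← map_mul (Polynomial.aeval _), contract_C_mul, contract_aeval_X, mul_comm b]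
  exact LinearMap.congr_fun this x

/-- Applying `e(c)` gives only that `lowerMap w r` vanishes on the contraction itself. To obtain the
ideal one must also multiply by arbitrary `y` from the smaller ring, and such a `y` need not come
from a symmetric polynomial in `r + 1` variables. It can, however, be built from such polynomials
and the separated variable. -/
theorem IsHighestWeight.contract_mem_lowerIdeal (hw : IsHighestWeight n w) {r : ℕ}
    {x : BiSym k (r + 1) n} (hx : x ∈ lowerIdeal w (r + 1)) (c : Polynomial k) :
    contract k n r (BiSym.split k n r x * Polynomial.aeval Polynomial.X c) ∈ lowerIdeal w r := by
  let M : Submodule k (Polynomial (BiSym k r n)) :=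
    { carrier := {q | ∀ x ∈ lowerIdeal w (r + 1), ∀ b : Polynomial k, lowerMap w r
        (contract k n r (BiSym.split k n r x * Polynomial.aeval Polynomial.X b * q)) = 0}
      zero_mem' := fun x _ b => by rw [mul_zero, map_zero, map_zero]
      add_mem' := fun hp hq x hx b => by rw [mul_add, map_add, map_add, hp x hx, hq x hx, add_zero]
      smul_mem' := fun s q hq x hx b => by
        rw [mul_smul_comm, ← algebraMap_smul (BiSym k r n) s, map_smul, algebraMap_smul, map_smul,
          hq x hx, smul_zero] }
  have h1 : 1 ∈ M := fun x hx b => by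
    have h := hw.lie_eElt_lowerMap b r x
    rw [lowerMap_eq_zero_of_mem hx, lie_zero, ← Nat.cast_smul_eq_nsmul k] at h
    rw [mul_one]
    exact (smul_eq_zero.mp h.symm).resolve_left (Nat.cast_ne_zero.mpr r.succ_ne_zero)
  -- The multipliers that preserve `M` form a subalgebra. It contains the polynomials in `X`,
  -- absorbed into `b`, and the image of `split`, absorbed into `x` because `lowerIdeal` is an
  -- ideal.
  let S : Subalgebra k (Polynomial (BiSym k r n)) :=
    { carrier := {p | ∀ q ∈ M, p * q ∈ M}
      mul_mem' := fun ha hb q hq => by rw [mul_assoc]; exact ha _ (hb _ hq)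
      add_mem' := fun ha hb q hq => by rw [add_mul]; exact M.add_mem (ha _ hq) (hb _ hq)
      algebraMap_mem' := fun s q hq => by rw [← Algebra.smul_def]; exact M.smul_mem s hq }
  have hX : ∀ a : Polynomial k, Polynomial.aeval Polynomial.X a ∈ S := fun a q hq x hx b => by
    rw [← mul_assoc, mul_assoc (BiSym.split k n r x), ← map_mul]
    exact hq x hx (b * a)
  have hsplit : ∀ z, BiSym.split k n r z ∈ S := fun z q hq x hx b => by
    rw [← mul_assoc, mul_right_comm (BiSym.split k n r x), ← map_mul]
    exact hq (x * z) (Ideal.mul_mem_right _ _ hx) b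
  have hC : S.comap Polynomial.CAlgHom = ⊤ := by
    refine BiSym.subalgebra_eq_top _ (fun y => ?_) fun m => ?_
    · have : (S.comap Polynomial.CAlgHom).comap (BiSym.inl : SymPoly k r →ₐ[k] BiSym k r n) = ⊤ := by
        refine SymPoly.subalgebra_eq_top _ fun j => ?_
        -- A power sum of `r` variables is the power sum of `r + 1` variables minus the power of the
        -- separated one, so the generators of the constants lie in `S`.
        have h := S.sub_mem (hsplit (BiSym.inl (powerSum k (r + 1) (Polynomial.X ^ j))))
          (hX (Polynomial.X ^ j))
        rw [BiSym.split_inl_powerSum, add_sub_cancel_right, powerSum_X_pow] at h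
        exact h
      exact (this ▸ Algebra.mem_top : y ∈ (S.comap Polynomial.CAlgHom).comap _)
    · have h := hsplit (BiSym.inr m)
      rwa [BiSym.split_inr] at h
  have hCS : ∀ z, Polynomial.C z ∈ S := fun z =>
    (hC ▸ Algebra.mem_top : z ∈ S.comap Polynomial.CAlgHom)
  intro y
  have h := hCS y 1 h1 x hx c
  rwa [mul_one, mul_comm, contract_C_mul] at h

/-- Induction downwards from `r = n + 1`, where the ideal is everything. Separating a variable
changes the shifted sums by `-c(X) ^ j`, so by `newtonE_sub_pow` the elementary function becomes `∑
(-c(X)) ^ i E_{s-i}`. Multiplied by `c(X)` and contracted, this is the right side of Newton's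
identity for `(s+1) E_{s+1}`. -/
theorem IsHighestWeight.newtonE_mem_lowerIdeal (hw : IsHighestWeight n w)
    (h0 : lowerMap w (n + 1) = 0) (c : Polynomial k) (s : ℕ) : ∀ r, r + s = n + 1 →
      newtonE k (fun j => shiftedSum k n r (c ^ j)) s ∈ lowerIdeal w r := by
  induction s with
  | zero =>
    rintro r rfl
    intro y
    rw [h0, LinearMap.zero_apply]
  | succ s ih =>
    intro r hr
    have h := hw.contract_mem_lowerIdeal (ih (r + 1) (by omega)) c
    rw [map_newtonE] at h
    simp only [BiSym.split_shiftedSum, map_pow] at h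
    rw [newtonE_sub_pow k (fun j => Polynomial.C (shiftedSum k n r (c ^ j))), Finset.sum_mul,
      map_sum] at h
    have hs : (((s + 1 : ℕ) : k)) • newtonE k (fun j => shiftedSum k n r (c ^ j)) (s + 1) ∈
        lowerIdeal w r := by
      rw [succ_smul_newtonE_succ]
      convert h using 1
      refine Finset.sum_congr rfl fun i _ => ?_
      have hCE := map_newtonE k (fun j => shiftedSum k n r (c ^ j))
        (Polynomial.CAlgHom (R := k) (A := BiSym k r n)) (s - i)
      have hC1 : (-Polynomial.aeval (Polynomial.X : Polynomial (BiSym k r n)) c) ^ i *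
          newtonE k (fun j => Polynomial.C (shiftedSum k n r (c ^ j))) (s - i) *
            Polynomial.aeval Polynomial.X c =
          Polynomial.C ((-1) ^ i * newtonE k (fun j => shiftedSum k n r (c ^ j)) (s - i)) *
            Polynomial.aeval Polynomial.X (c ^ (i + 1)) := by
        rw [map_mul, map_pow (Polynomial.aeval _), map_pow Polynomial.C, map_neg, map_one]
        rw [show Polynomial.C (newtonE k (fun j => shiftedSum k n r (c ^ j)) (s - i)) =
          newtonE k (fun j => Polynomial.C (shiftedSum k n r (c ^ j))) (s - i) from hCE,
          neg_pow]
        ring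
      rw [hC1, contract_C_mul, contract_aeval_X]
      ring
    rw [← algebraMap_smul (BiSym k r n), smul_eq_mul] at hs
    have h2 := Ideal.mul_mem_left _ (algebraMap k (BiSym k r n) (((s + 1 : ℕ) : k))⁻¹) hs
    rwa [← mul_assoc, ← map_mul, inv_mul_cancel₀ (Nat.cast_ne_zero.mpr s.succ_ne_zero), map_one,
      one_mul] at h2

end Contraction

/-! ### Two sets of variables inside one polynomial ring, and the relations among lowering
operators. -/

section Join

variable {k : Type*} [Field k]

/-- Two polynomials in separate variables, as a polynomial in all variables. -/
def joinPoly (k : Type*) [Field k] (r s : ℕ) :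
    MvPolynomial (Fin r) k ⊗[k] MvPolynomial (Fin s) k →ₐ[k] MvPolynomial (Fin (r + s)) k :=
  Algebra.TensorProduct.productMap (MvPolynomial.rename (Fin.castAdd s))
    (MvPolynomial.rename (Fin.natAdd r))

theorem joinPoly_bijective (r s : ℕ) : Function.Bijective (joinPoly k r s) := by
  have h : joinPoly k r s = (MvPolynomial.renameEquiv k finSumFinEquiv).toAlgHom.comp
      (MvPolynomial.tensorEquivSum k (Fin r) (Fin s) k).toAlgHom := by
    refine Algebra.TensorProduct.ext (MvPolynomial.algHom_ext fun i => ?_)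
      (MvPolynomial.algHom_ext fun i => ?_)
    · simp [joinPoly]
    · simp [joinPoly]
  rw [h]
  exact (MvPolynomial.renameEquiv k finSumFinEquiv).bijective.comp
    (MvPolynomial.tensorEquivSum k (Fin r) (Fin s) k).bijective

theorem joinPoly_tmul {r s : ℕ} (u : MvPolynomial (Fin r) k) (v : MvPolynomial (Fin s) k) :
    joinPoly k r s (u ⊗ₜ v) = MvPolynomial.rename (Fin.castAdd s) u *
      MvPolynomial.rename (Fin.natAdd r) v :=
  Algebra.TensorProduct.productMap_apply_tmul _ _ _ _

/-- Polynomials symmetric in two separate sets of variables, as polynomials in all variables. -/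
def BiSym.join (k : Type*) [Field k] (r s : ℕ) : BiSym k r s →ₐ[k] MvPolynomial (Fin (r + s)) k :=
  BiSym.lift ((MvPolynomial.rename (Fin.castAdd s)).comp
      (MvPolynomial.symmetricSubalgebra (Fin r) k).val)
    ((MvPolynomial.rename (Fin.natAdd r)).comp (MvPolynomial.symmetricSubalgebra (Fin s) k).val)

theorem BiSym.join_inl {r s : ℕ} (y : SymPoly k r) : BiSym.join k r s (BiSym.inl y) =
    MvPolynomial.rename (Fin.castAdd s) (y : MvPolynomial (Fin r) k) := BiSym.lift_inl _ _ _

theorem BiSym.join_inr {r s : ℕ} (y : SymPoly k s) : BiSym.join k r s (BiSym.inr y) =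
    MvPolynomial.rename (Fin.natAdd r) (y : MvPolynomial (Fin s) k) := BiSym.lift_inr _ _ _

/-- Over a field the tensor product of the two inclusions is injective, and the polynomial rings
themselves tensor to the polynomial ring in all variables. -/
theorem BiSym.join_injective (r s : ℕ) : Function.Injective (BiSym.join k r s) := by
  let f : SymPoly k r ⊗[k] SymPoly k s →ₗ[k]
      MvPolynomial (Fin r) k ⊗[k] MvPolynomial (Fin s) k :=
    TensorProduct.map (MvPolynomial.symmetricSubalgebra (Fin r) k).val.toLinearMap
      (MvPolynomial.symmetricSubalgebra (Fin s) k).val.toLinearMap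
  have hf : Function.Injective f :=
    TensorProduct.map_injective_of_flat_flat _ _ Subtype.val_injective Subtype.val_injective
  have h : ((joinPoly k r s).toLinearMap ∘ₗ f : BiSym k r s →ₗ[k] _) =
      (BiSym.join k r s).toLinearMap := BiSym.linearMap_ext fun y m => by
    have hR : BiSym.join k r s (BiSym.inl y * BiSym.inr m) = MvPolynomial.rename (Fin.castAdd s)
        (y : MvPolynomial (Fin r) k) * MvPolynomial.rename (Fin.natAdd r)
          (m : MvPolynomial (Fin s) k) := by
      rw [map_mul, BiSym.join_inl, BiSym.join_inr]
    refine Eq.trans ?_ hR.symm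
    rw [BiSym.inl_mul_inr]
    exact joinPoly_tmul _ _
  have h2 := (joinPoly_bijective (k := k) r s).1.comp hf
  intro x y hxy
  refine h2 ?_
  exact (LinearMap.congr_fun h x).trans (hxy.trans (LinearMap.congr_fun h y).symm)

/-- A pair of permutations acts on the union of two sets of variables. -/
def joinPerm {r s : ℕ} (σ : Equiv.Perm (Fin r)) (τ : Equiv.Perm (Fin s)) :
    Equiv.Perm (Fin (r + s)) := finSumFinEquiv.permCongr (Equiv.sumCongr σ τ)

theorem joinPerm_castAdd {r s : ℕ} (σ : Equiv.Perm (Fin r)) (τ : Equiv.Perm (Fin s)) (i : Fin r) :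
    joinPerm σ τ (Fin.castAdd s i) = Fin.castAdd s (σ i) := by
  simp [joinPerm]

theorem joinPerm_natAdd {r s : ℕ} (σ : Equiv.Perm (Fin r)) (τ : Equiv.Perm (Fin s)) (i : Fin s) :
    joinPerm σ τ (Fin.natAdd r i) = Fin.natAdd r (τ i) := by
  simp [joinPerm]

/-- The sum over all permutations of the variables. -/
def symmetrize {r : ℕ} (u : MvPolynomial (Fin r) k) : SymPoly k r :=
  ⟨∑ σ : Equiv.Perm (Fin r), MvPolynomial.rename σ u, fun e => by
    rw [map_sum]
    refine Fintype.sum_equiv (Equiv.mulLeft e) _ _ fun σ => ?_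
    rw [MvPolynomial.rename_rename]
    rfl⟩

/-- Averaging over `S_r × S_s`: on a product of polynomials in separate variables the double sum
factors into two symmetrizations, and on an invariant `p` it is `r! s! p`. -/
theorem BiSym.mem_range_join [CharZero k] {r s : ℕ} {p : MvPolynomial (Fin (r + s)) k}
    (hp : ∀ σ τ, MvPolynomial.rename (joinPerm σ τ) p = p) : p ∈ (BiSym.join k r s).range := by
  have h : ∀ q : MvPolynomial (Fin (r + s)) k, ∑ σ : Equiv.Perm (Fin r),
      ∑ τ : Equiv.Perm (Fin s), MvPolynomial.rename (joinPerm σ τ) q ∈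
        (BiSym.join k r s).range := fun q => by
    obtain ⟨t, rfl⟩ := (joinPoly_bijective r s).2 q
    induction t using TensorProduct.induction_on with
    | zero => simp
    | add x y hx hy =>
      simp only [map_add, Finset.sum_add_distrib]
      exact add_mem hx hy
    | tmul u v =>
      refine ⟨BiSym.inl (symmetrize u) * BiSym.inr (symmetrize v), ?_⟩
      change BiSym.join k r s _ = _
      rw [map_mul, BiSym.join_inl, BiSym.join_inr, symmetrize, symmetrize]
      simp only [map_sum, Finset.sum_mul_sum]
      refine Finset.sum_congr rfl fun σ _ => Finset.sum_congr rfl fun τ _ => ?_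
      rw [joinPoly_tmul, map_mul]
      simp only [MvPolynomial.rename_rename]
      congr 3
      · exact funext fun i => (joinPerm_castAdd σ τ i).symm
      · exact funext fun i => (joinPerm_natAdd σ τ i).symm
  have h1 := h p
  simp only [hp, Finset.sum_const, Finset.card_univ, Fintype.card_perm, Fintype.card_fin,
    ← Nat.cast_smul_eq_nsmul k, smul_smul] at h1
  have h2 := (BiSym.join k r s).range.smul_mem h1 (((r.factorial : k) * (s.factorial : k))⁻¹)
  rwa [smul_smul, inv_mul_cancel₀ (mul_ne_zero (Nat.cast_ne_zero.mpr r.factorial_ne_zero)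
    (Nat.cast_ne_zero.mpr s.factorial_ne_zero)), one_smul] at h2

variable [CharZero k]

theorem exists_comul (r s : ℕ) : ∃ f : SymPoly k (r + s) →ₐ[k] BiSym k r s,
    ∀ m, BiSym.join k r s (f m) = m := by
  obtain ⟨f, hf⟩ := SymPoly.exists_algHom (k := k) (m := r + s)
    fun j => (BiSym.inl (newton k r j) + BiSym.inr (newton k s j) : BiSym k r s)
  refine ⟨f, fun m => ?_⟩
  have : (BiSym.join k r s).comp f = (MvPolynomial.symmetricSubalgebra (Fin (r + s)) k).val := by
    refine SymPoly.algHom_ext fun j h1 h2 => ?_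
    rw [AlgHom.comp_apply, hf j h1 h2, map_add, BiSym.join_inl, BiSym.join_inr]
    simp [coe_newton, MvPolynomial.psum, Fin.sum_univ_add]
  exact DFunLike.congr_fun this m

/-- A symmetric polynomial in `r + s` variables, as a polynomial in two sets of variables. -/
def comul (k : Type*) [Field k] [CharZero k] (r s : ℕ) : SymPoly k (r + s) →ₐ[k] BiSym k r s :=
  (exists_comul r s).choose

theorem join_comul (r s : ℕ) (m : SymPoly k (r + s)) : BiSym.join k r s (comul k r s m) = m :=
  (exists_comul r s).choose_spec m

theorem comul_powerSum (r s : ℕ) (a : Polynomial k) : comul k r s (powerSum k (r + s) a) =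
    BiSym.inl (powerSum k r a) + BiSym.inr (powerSum k s a) := by
  refine BiSym.join_injective r s ?_
  rw [join_comul, map_add, BiSym.join_inl, BiSym.join_inr]
  simp only [coe_powerSum, map_sum, Fin.sum_univ_add, ← Polynomial.aeval_algHom_apply,
    MvPolynomial.rename_X]

/-- The multiplication map `y ⊗ m ↦ y(x₁, …, xᵣ) m(x₁, …, xᵣ₊ₛ)`. -/
def BiSym.restrict (k : Type*) [Field k] [CharZero k] (r s : ℕ) :
    BiSym k r (r + s) →ₐ[k] BiSym k r s := BiSym.lift BiSym.inl (comul k r s)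

/-- The power sums of the last `s` variables are those of all variables minus those of the first
`r`. -/
theorem BiSym.restrict_surjective (r s : ℕ) : Function.Surjective (BiSym.restrict k r s) := by
  have hl : ∀ y, BiSym.inl y ∈ (BiSym.restrict k r s).range :=
    fun y => ⟨BiSym.inl y, BiSym.lift_inl _ _ _⟩
  have h : (BiSym.restrict k r s).range = ⊤ := by
    refine BiSym.subalgebra_eq_top _ hl fun m => ?_
    have : ((BiSym.restrict k r s).range.comap BiSym.inr : Subalgebra k (SymPoly k s)) = ⊤ := by
      refine SymPoly.subalgebra_eq_top _ fun j => ?_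
      have h := sub_mem (⟨BiSym.inr (powerSum k (r + s) (Polynomial.X ^ j)), BiSym.lift_inr _ _ _⟩ :
        comul k r s (powerSum k (r + s) (Polynomial.X ^ j)) ∈ (BiSym.restrict k r s).range)
        (hl (powerSum k r (Polynomial.X ^ j)))
      rwa [comul_powerSum, add_sub_cancel_left, powerSum_X_pow] at h
    exact (this ▸ Algebra.mem_top : m ∈ (BiSym.restrict k r s).range.comap BiSym.inr)
  intro x
  exact (h ▸ Algebra.mem_top : x ∈ (BiSym.restrict k r s).range)

theorem join_restrict_inl_mul_inr (r s : ℕ) (y : SymPoly k r) (m : SymPoly k (r + s)) :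
    BiSym.join k r s (BiSym.restrict k r s (BiSym.inl y * BiSym.inr m)) =
      MvPolynomial.rename (Fin.castAdd s) (y : MvPolynomial (Fin r) k) * m := by
  rw [map_mul, map_mul, BiSym.restrict, BiSym.lift_inl, BiSym.lift_inr, BiSym.join_inl, join_comul]

variable {W : Type*} [AddCommGroup W] [Module k W] [LieRingModule (Current k (Polynomial k)) W]
  [LieModule k (Current k (Polynomial k)) W]

/-- In an `sl₂[t]`-module generated by a highest weight map of level `n = r + s` on which products of
`n + 1` lowering operators vanish, the products of `r` lowering operators satisfy all relations that
hold in the symmetric tensors. -/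
theorem IsHighestWeight.lowerMap_eq_zero {r s : ℕ} {w : SymPoly k (r + s) →ₗ[k] W}
    (hw : IsHighestWeight (r + s) w) (h0 : lowerMap w (r + s + 1) = 0) {x : BiSym k r (r + s)}
    (hx : BiSym.restrict k r s x = 0) : lowerMap w r x = 0 := by
  let mk : BiSym k r (r + s) →ₐ[k] BiSym k r (r + s) ⧸ lowerIdeal w r := Ideal.Quotient.mkₐ k _
  -- Modulo the ideal the shifted sums behave like power sums of `s` variables: `1` goes to `(r + s)
  -- - r = s`, and the elementary function of degree `s + 1` vanishes.
  obtain ⟨θ₀, hθ₀⟩ := SymPoly.exists_algHom_of_newtonE (m := s)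
    (mk.toLinearMap ∘ₗ shiftedSum k (r + s) r) (by
      rw [LinearMap.comp_apply, shiftedSum_apply, powerSum_one, powerSum_one]
      simp) fun a => by
      have h := hw.newtonE_mem_lowerIdeal h0 a (s + 1) r (by omega)
      rw [← Ideal.Quotient.eq_zero_iff_mem] at h
      exact (map_newtonE k _ mk (s + 1)).symm.trans h
  -- Hence the quotient map factors through `restrict`, so the kernel of `restrict` lies in the
  -- ideal.
  have hθ : (BiSym.lift (mk.comp BiSym.inl) θ₀).comp (BiSym.restrict k r s) = mk := by
    refine BiSym.algHom_ext (fun y => ?_) fun m => ?_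
    · rw [AlgHom.comp_apply, BiSym.restrict, BiSym.lift_inl, BiSym.lift_inl]
      rfl
    · have : ((BiSym.lift (mk.comp BiSym.inl) θ₀).comp (BiSym.restrict k r s)).comp BiSym.inr =
          mk.comp BiSym.inr := by
        refine SymPoly.algHom_ext fun j _ _ => ?_
        rw [AlgHom.comp_apply, AlgHom.comp_apply, BiSym.restrict, BiSym.lift_inr, ← powerSum_X_pow,
          comul_powerSum, map_add, BiSym.lift_inl, BiSym.lift_inr, hθ₀]
        refine (map_add mk _ _).symm.trans (congrArg mk ?_)
        rw [shiftedSum_apply]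
        exact add_sub_cancel _ _
      exact DFunLike.congr_fun this m
  refine lowerMap_eq_zero_of_mem (Ideal.Quotient.eq_zero_iff_mem.mp ?_)
  change mk x = 0
  rw [← hθ, AlgHom.comp_apply, hx, map_zero]

end Join

/-! ### Modules generated by a highest weight map -/

section Generation

variable {k : Type*} [Field k] {n : ℕ}
  {W : Type*} [AddCommGroup W] [Module k W] [LieRingModule (Current k (Polynomial k)) W]
  [LieModule k (Current k (Polynomial k)) W]

theorem lowerMap_mem_of_powerProd [CharZero k] {E : Type*} [AddCommGroup E] [Module k E]
    {w : SymPoly k n →ₗ[k] W} {r : ℕ} (T : W →ₗ[k] E) (S : Submodule k E)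
    (h : ∀ a m, T (lowerOp k W a ^ r • w m) ∈ S) (x : BiSym k r n) : T (lowerMap w r x) ∈ S := by
  have h1 : (S.mkQ ∘ₗ T) ∘ₗ lowerMap w r = 0 := BiSym.linearMap_ext_powerProd fun a m => by
    rw [LinearMap.comp_apply, lowerMap_powerProd]
    exact (Submodule.Quotient.mk_eq_zero S).mpr (h a m)
  exact (Submodule.Quotient.mk_eq_zero S).mp (LinearMap.congr_fun h1 x)

theorem map_lowerMap [CharZero k] {W' : Type*} [AddCommGroup W'] [Module k W']
    [LieRingModule (Current k (Polynomial k)) W'] [LieModule k (Current k (Polynomial k)) W']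
    (ψ : W →ₗ⁅k, Current k (Polynomial k)⁆ W') {w : SymPoly k n →ₗ[k] W}
    {w' : SymPoly k n →ₗ[k] W'} (h : ∀ m, ψ (w m) = w' m) (r : ℕ) (x : BiSym k r n) :
    ψ (lowerMap w r x) = lowerMap w' r x := by
  have h1 : (ψ : W →ₗ[k] W') ∘ₗ lowerMap w r = lowerMap w' r :=
    BiSym.linearMap_ext_powerProd fun a m => by
      rw [LinearMap.comp_apply, lowerMap_powerProd, lowerMap_powerProd]
      clear x
      induction r with
      | zero => rw [pow_zero, pow_zero, one_smul, one_smul]; exact h m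
      | succ r ih =>
        rw [pow_succ', pow_succ', mul_smul, mul_smul, lowerOp_smul, lowerOp_smul, ← ih]
        exact ψ.map_lie _ _
  exact LinearMap.congr_fun h1 x

theorem lowerMap_eq_zero_of_le [CharZero k] {w : SymPoly k n →ₗ[k] W} {r s : ℕ} (hrs : r ≤ s)
    (h : lowerMap w r = 0) : lowerMap w s = 0 := by
  refine BiSym.linearMap_ext_powerProd fun a m => ?_
  rw [lowerMap_powerProd, ← Nat.sub_add_cancel hrs, pow_add, mul_smul, ← lowerMap_powerProd, h]
  exact smul_zero _

/-- Up to the factor `r + 1`, the product `f(b) f(a) ^ r` is the coefficient of `s` in `f(s b + a) ^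
(r+1)`, whose values on `w(m)` lie in the range. -/
theorem lie_fElt_lowerMap_mem [CharZero k] (w : SymPoly k n →ₗ[k] W) (b : Polynomial k) (r : ℕ)
    (x : BiSym k r n) : ⁅fElt b, lowerMap w r x⁆ ∈ LinearMap.range (lowerMap w (r + 1)) := by
  refine lowerMap_mem_of_powerProd (fOp k W b) _ (fun a m => ?_) x
  have h := mem_of_forall_sum_pow_smul_mem (k := k) (LinearMap.range (lowerMap w (r + 1))) (r + 2)
    (fun i => ((r + 1).choose i) •
      ((lowerOp k W b ^ i * lowerOp k W a ^ (r + 1 - i)) • w m)) (fun s => by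
        refine ⟨BiSym.inl (powerProd k (r + 1) (s • b + a)) * BiSym.inr m, ?_⟩
        rw [lowerMap_powerProd, map_add, map_smul, add_pow, Finset.sum_smul]
        refine Finset.sum_congr rfl fun i _ => ?_
        rw [smul_pow, smul_mul_assoc, smul_mul_assoc, smul_assoc, mul_comm _ (Nat.cast _), mul_smul,
          Nat.cast_smul_eq_nsmul]) (i := 1) (by omega)
  rw [Nat.choose_one_right, pow_one, Nat.add_sub_cancel, ← Nat.cast_smul_eq_nsmul k] at h
  have h2 := (LinearMap.range (lowerMap w (r + 1))).smul_mem (((r + 1 : ℕ) : k)⁻¹) h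
  rw [smul_smul, inv_mul_cancel₀ (Nat.cast_ne_zero.mpr r.succ_ne_zero), one_smul, mul_smul] at h2
  exact h2

variable {w : SymPoly k n →ₗ[k] W}

theorem IsHighestWeight.lie_hElt_lowerMap_mem [CharZero k] (hw : IsHighestWeight n w)
    (b : Polynomial k) (r : ℕ) (x : BiSym k r n) :
    ⁅hElt k b, lowerMap w r x⁆ ∈ LinearMap.range (lowerMap w r) := by
  refine lowerMap_mem_of_powerProd (LieModule.toEnd k (Current k (Polynomial k)) W (hElt k b)) _
    (fun a m => ?_) x
  rw [LieModule.toEnd_apply_apply, lie_hElt_lowerOp_pow_smul, hw.lie_h, mul_smul 2 r, ← smul_assoc r,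
    ← polyProd_powerProd_mul_powerSum, ← lowerMap_inl_mul_inr, ← lowerMap_powerProd]
  exact sub_mem (LinearMap.mem_range_self _ _) (nsmul_mem (LinearMap.mem_range_self _ _) _)

theorem IsHighestWeight.lie_hElt_one_lowerMap [CharZero k] (hw : IsHighestWeight n w)
    (r : ℕ) (x : BiSym k r n) :
    ⁅hElt k (1 : Polynomial k), lowerMap w r x⁆ = ((n : k) - 2 * r) • lowerMap w r x := by
  have h : LieModule.toEnd k (Current k (Polynomial k)) W (hElt k 1) ∘ₗ lowerMap w r =
      ((n : k) - 2 * r) • lowerMap w r := BiSym.linearMap_ext_powerProd fun a m => by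
    rw [LinearMap.comp_apply, LieModule.toEnd_apply_apply, LinearMap.smul_apply, lowerMap_powerProd,
      lie_hElt_lowerOp_pow_smul, hw.lie_h, powerSum_one, one_mul, ← nsmul_eq_mul, map_nsmul,
      smul_comm, sub_smul, Nat.cast_smul_eq_nsmul]
    have h2 : (2 * (r : k)) = ((2 * r : ℕ) : k) := by push_cast; rfl
    rw [h2, Nat.cast_smul_eq_nsmul]
    congr 1
    cases r with
    | zero => simp
    | succ r => rw [Nat.add_sub_cancel, ← pow_succ']
  exact LinearMap.congr_fun h x

/-- The elements `e(a)`, `h(a)`, `f(a)` span the Lie algebra and carry the `r`-th range into the one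
of index `r - 1`, `r`, `r + 1`; for `r = 0` the element `e(a)` gives zero. -/
theorem IsHighestWeight.lie_mem_iSup [CharZero k] (hw : IsHighestWeight n w)
    (g : Current k (Polynomial k)) {v : W} (hv : v ∈ ⨆ r, LinearMap.range (lowerMap w r)) :
    ⁅g, v⁆ ∈ ⨆ r, LinearMap.range (lowerMap w r) := by
  let N : Submodule k (Current k (Polynomial k)) :=
    { carrier := {g | ∀ v ∈ ⨆ r, LinearMap.range (lowerMap w r),
        ⁅g, v⁆ ∈ ⨆ r, LinearMap.range (lowerMap w r)}
      zero_mem' := fun v _ => by rw [zero_lie]; exact zero_mem _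
      add_mem' := fun hx hy v hv => by rw [add_lie]; exact add_mem (hx v hv) (hy v hv)
      smul_mem' := fun c x hx v hv => by
        rw [smul_lie]; exact Submodule.smul_mem _ c (hx v hv) }
  have key : ∀ g : Current k (Polynomial k), (∀ r x, ∃ s, ⁅g, lowerMap w r x⁆ ∈
      LinearMap.range (lowerMap w s)) → g ∈ N := fun g h v hv => by
    have hle : (⨆ r, LinearMap.range (lowerMap w r)) ≤
        (⨆ r, LinearMap.range (lowerMap w r)).comap
          (LieModule.toEnd k (Current k (Polynomial k)) W g) := iSup_le fun r => by
      rintro _ ⟨x, rfl⟩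
      obtain ⟨s, hs⟩ := h r x
      exact Submodule.mem_iSup_of_mem s hs
    exact hle hv
  have hN : N = ⊤ := eq_top_of_mem_current N
    (fun a => key _ fun r x => by
      cases r with
      | zero =>
        refine ⟨0, lowerMap_mem_of_powerProd
          (LieModule.toEnd k (Current k (Polynomial k)) W (eElt k a)) _ (fun c m => ?_) x⟩
        rw [pow_zero, one_smul, LieModule.toEnd_apply_apply, hw.lie_e]
        exact zero_mem _
      | succ r =>
        refine ⟨r, ?_⟩
        rw [hw.lie_eElt_lowerMap]
        exact nsmul_mem (LinearMap.mem_range_self _ _) _)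
    (fun a => key _ fun r x => ⟨r, hw.lie_hElt_lowerMap_mem a r x⟩)
    (fun a => key _ fun r x => ⟨r + 1, lie_fElt_lowerMap_mem w a r x⟩)
  exact (hN ▸ Submodule.mem_top : g ∈ N) v hv

/-- A module generated by a highest weight map is spanned by products of lowering operators. -/
theorem IsHighestWeight.exists_sum_lowerMap [CharZero k] (hw : IsHighestWeight n w)
    (h0 : lowerMap w (n + 1) = 0)
    (hgen : ∀ N : LieSubmodule k (Current k (Polynomial k)) W, (∀ m, w m ∈ N) → N = ⊤) (v : W) :
    ∃ x : ∀ r, BiSym k r n, v = ∑ r ∈ Finset.range (n + 1), lowerMap w r (x r) := by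
  let N : LieSubmodule k (Current k (Polynomial k)) W :=
    { (⨆ r, LinearMap.range (lowerMap w r) : Submodule k W) with
      lie_mem := fun h => hw.lie_mem_iSup _ h }
  have hN : N = ⊤ := hgen N fun m => Submodule.mem_iSup_of_mem 0
    ⟨BiSym.inl (powerProd k 0 1) * BiSym.inr m, by rw [lowerMap_powerProd, pow_zero, one_smul]⟩
  have hv : v ∈ ⨆ r, LinearMap.range (lowerMap w r) := (hN ▸ LieSubmodule.mem_top v : v ∈ N)
  let L : (∀ r, BiSym k r n) →ₗ[k] W :=
    ∑ r ∈ Finset.range (n + 1), lowerMap w r ∘ₗ LinearMap.proj r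
  have hL : ∀ x, L x = ∑ r ∈ Finset.range (n + 1), lowerMap w r (x r) := fun x => by
    simp only [L, LinearMap.sum_apply, LinearMap.comp_apply, LinearMap.proj_apply]
  have hle : (⨆ r, LinearMap.range (lowerMap w r)) ≤ LinearMap.range L := iSup_le fun r => by
    rintro _ ⟨x, rfl⟩
    by_cases hr : r < n + 1
    · refine ⟨Pi.single r x, ?_⟩
      rw [hL, Finset.sum_eq_single_of_mem r (Finset.mem_range.mpr hr), Pi.single_eq_same]
      intro s _ hs
      rw [Pi.single_eq_of_ne hs, map_zero]
    · rw [lowerMap_eq_zero_of_le (not_lt.mp hr) h0]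
      exact zero_mem _
  obtain ⟨x, hx⟩ := hle hv
  exact ⟨x, hx.symm.trans (hL x)⟩

end Generation

/-! ### Verma modules and Weyl modules -/

section VermaModule

variable {k : Type*} [Field k] {A : Type*} [CommRing A] [Algebra k A]

attribute [local instance 100] LieRing.ofAssociativeRing

/-- The universal property gives a homomorphism to `S` whose composite with the inclusion fixes the
Lie algebra, hence is the identity. -/
theorem envelopingSubalgebra_eq_top {R L : Type*} [CommRing R] [LieRing L]
    [LieAlgebra R L] (S : Subalgebra R (UniversalEnvelopingAlgebra R L))
    (h : ∀ x, UniversalEnvelopingAlgebra.ι R x ∈ S) : S = ⊤ := by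
  let f : L →ₗ⁅R⁆ S :=
    { (UniversalEnvelopingAlgebra.ι R : L →ₗ⁅R⁆ UniversalEnvelopingAlgebra R L).toLinearMap.codRestrict
        (Subalgebra.toSubmodule S) h with
      map_lie' := fun {x y} => Subtype.ext ((UniversalEnvelopingAlgebra.ι R).map_lie x y) }
  have hf : S.val.comp (UniversalEnvelopingAlgebra.lift R f) =
      AlgHom.id R (UniversalEnvelopingAlgebra R L) := by
    apply UniversalEnvelopingAlgebra.hom_ext R
    ext x
    change S.val (UniversalEnvelopingAlgebra.lift R f (UniversalEnvelopingAlgebra.ι R x)) = _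
    rw [UniversalEnvelopingAlgebra.lift_ι_apply]
    rfl
  refine eq_top_iff.mpr fun u _ => ?_
  have h2 : (UniversalEnvelopingAlgebra.lift R f u : UniversalEnvelopingAlgebra R L) = u :=
    DFunLike.congr_fun hf u
  rw [← h2]
  exact (UniversalEnvelopingAlgebra.lift R f u).2

variable {M : Type*} [AddCommGroup M] [Module k M] (ρ : A →ₗ[k] Module.End k M)

/-- The map `m ↦ 1 ⊗ m` to the Verma module. -/
def Verma.of : M →ₗ[k] Verma ρ where
  toFun m := Submodule.Quotient.mk (1 ⊗ₜ[k] m)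
  map_add' m m' := by rw [TensorProduct.tmul_add]; rfl
  map_smul' c m := by rw [TensorProduct.tmul_smul]; rfl

theorem Verma.lie_of (x : Current k A) (m : M) : ⁅x, Verma.of ρ m⁆ =
    (vermaRel ρ).mkQ ((1 * UniversalEnvelopingAlgebra.ι k x) ⊗ₜ[k] m) := by
  change (vermaRel ρ).mkQ (UniversalEnvelopingAlgebra.ι k x • (1 ⊗ₜ[k] m)) = _
  rw [TensorProduct.smul_tmul', smul_eq_mul, mul_one, one_mul]

theorem Verma.lie_eElt_of (a : A) (m : M) : ⁅eElt k a, Verma.of ρ m⁆ = 0 := by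
  rw [Verma.lie_of]
  exact (Submodule.Quotient.mk_eq_zero _).mpr (Submodule.subset_span (.inl ⟨1, a, m, rfl⟩))

theorem Verma.lie_hElt_of (a : A) (m : M) : ⁅hElt k a, Verma.of ρ m⁆ = Verma.of ρ (ρ a m) := by
  rw [Verma.lie_of]
  exact (Submodule.Quotient.eq _).mpr (Submodule.subset_span (.inr ⟨1, a, m, rfl⟩))

theorem Verma.eq_top_of_of_mem (N : LieSubmodule k (Current k A) (Verma ρ))
    (h : ∀ m, Verma.of ρ m ∈ N) : N = ⊤ := by
  let S : Subalgebra k (UniversalEnvelopingAlgebra k (Current k A)) :=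
    { carrier := {u | ∀ v ∈ N, u • v ∈ N}
      mul_mem' := fun hx hy v hv => by rw [mul_smul]; exact hx _ (hy v hv)
      add_mem' := fun hx hy v hv => by rw [add_smul]; exact add_mem (hx v hv) (hy v hv)
      algebraMap_mem' := fun c v hv => by rw [algebraMap_smul]; exact N.smul_mem c hv }
  have hS : S = ⊤ := envelopingSubalgebra_eq_top S fun x v hv => N.lie_mem hv
  refine eq_top_iff.mpr fun v _ => ?_
  obtain ⟨z, rfl⟩ := Submodule.Quotient.mk_surjective (vermaRel ρ) v
  induction z using TensorProduct.induction_on with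
  | zero => exact zero_mem N
  | add x y hx hy => exact add_mem (hx trivial) (hy trivial)
  | tmul u m =>
    have hu : u ⊗ₜ[k] m = u • ((1 : UniversalEnvelopingAlgebra k (Current k A)) ⊗ₜ[k] m) := by
      rw [TensorProduct.smul_tmul', smul_eq_mul, mul_one]
    rw [hu]
    exact (hS ▸ Algebra.mem_top : u ∈ S) _ (h m)

/-- The universal property of the Verma module. -/
theorem Verma.exists_lift {W : Type*} [AddCommGroup W] [Module k W] [LieRingModule (Current k A) W]
    [LieModule k (Current k A) W] (w : M →ₗ[k] W) (he : ∀ (a : A) m, ⁅eElt k a, w m⁆ = 0)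
    (hh : ∀ (a : A) m, ⁅hElt k a, w m⁆ = w (ρ a m)) :
    ∃ ψ : Verma ρ →ₗ⁅k, Current k A⁆ W, ∀ m, ψ (Verma.of ρ m) = w m := by
  let T : UniversalEnvelopingAlgebra k (Current k A) →ₐ[k] Module.End k W :=
    UniversalEnvelopingAlgebra.lift k (LieModule.toEnd k (Current k A) W)
  have hT : ∀ x v, T (UniversalEnvelopingAlgebra.ι k x) v = ⁅x, v⁆ := fun x v => by
    simp only [T, UniversalEnvelopingAlgebra.lift_ι_apply, LieModule.toEnd_apply_apply]
  let g : UniversalEnvelopingAlgebra k (Current k A) ⊗[k] M →ₗ[k] W :=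
    TensorProduct.lift (LinearMap.lcomp k W w ∘ₗ T.toLinearMap)
  have hg : ∀ u m, g (u ⊗ₜ m) = T u (w m) := fun u m => rfl
  -- The relations generate a submodule over the enveloping algebra, so `g` must be seen as linear
  -- over that algebra before it can descend.
  let : Module (UniversalEnvelopingAlgebra k (Current k A)) W := Module.compHom W T.toRingHom
  have hsmul : ∀ (u : UniversalEnvelopingAlgebra k (Current k A)) (v : W), u • v = T u v :=
    fun u v => rfl
  let g' : UniversalEnvelopingAlgebra k (Current k A) ⊗[k] M
      →ₗ[UniversalEnvelopingAlgebra k (Current k A)] W :=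
    { g with
      map_smul' := fun u z => by
        change g (u • z) = T u (g z)
        induction z using TensorProduct.induction_on with
        | zero => simp
        | add x y hx hy => rw [smul_add, map_add, hx, hy, map_add, map_add]
        | tmul u' m =>
          rw [TensorProduct.smul_tmul', hg, hg, smul_eq_mul, map_mul]
          rfl }
  have hle : vermaRel ρ ≤ LinearMap.ker g' := by
    refine Submodule.span_le.mpr ?_
    rintro _ (⟨u, a, m, rfl⟩ | ⟨u, a, m, rfl⟩)
    · change g _ = 0
      rw [hg, map_mul, Module.End.mul_apply, hT, he, map_zero]
    · change g _ = 0
      rw [map_sub, hg, hg, map_mul, Module.End.mul_apply, hT, hh, sub_self]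
  let ψ : Verma ρ →ₗ[UniversalEnvelopingAlgebra k (Current k A)] W :=
    (vermaRel ρ).liftQ g' hle
  have hψ : ∀ z, ψ (Submodule.Quotient.mk z) = g z := fun z => rfl
  refine ⟨{ toFun := ψ, map_add' := ψ.map_add, map_smul' := fun c v => ?_, map_lie' := ?_ },
    fun m => ?_⟩
  · rw [← algebraMap_smul (UniversalEnvelopingAlgebra k (Current k A)) c v, ψ.map_smul, hsmul,
      AlgHom.commutes]
    rfl
  · intro x v
    change ψ (UniversalEnvelopingAlgebra.ι k x • v) = ⁅x, ψ v⁆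
    rw [ψ.map_smul, hsmul, hT]
  · change g (1 ⊗ₜ m) = w m
    rw [hg, map_one]
    rfl

end VermaModule

/-! ### The Weyl module as a quotient generated by a highest weight map. -/

section WeylModule

variable {k : Type*} [Field k] (n : ℕ)

/-- The map `m ↦ 1 ⊗ m` to the Weyl module. -/
def weylOf : SymPoly k n →ₗ[k] WeylModule n (newtonAction k n) :=
  (LieSubmodule.Quotient.mk' (lowSubmodule n (newtonAction k n)) : _ →ₗ[k] _) ∘ₗ
    Verma.of (newtonAction k n)

theorem isHighestWeight_vermaOf : IsHighestWeight n (Verma.of (newtonAction k n)) where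
  lie_e := Verma.lie_eElt_of _
  lie_h a m := by rw [Verma.lie_hElt_of, newtonAction_apply]

theorem weylOf_apply (m : SymPoly k n) : weylOf n m =
    LieSubmodule.Quotient.mk' (lowSubmodule n (newtonAction k n)) (Verma.of (newtonAction k n) m) :=
  rfl

theorem isHighestWeight_weylOf : IsHighestWeight n (weylOf (k := k) n) where
  lie_e a m := by
    rw [weylOf_apply, ← LieModuleHom.map_lie, (isHighestWeight_vermaOf n).lie_e, map_zero]
  lie_h a m := by
    rw [weylOf_apply, ← LieModuleHom.map_lie, (isHighestWeight_vermaOf n).lie_h, weylOf_apply]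

variable [CharZero k]

theorem lowerMap_weylOf : lowerMap (weylOf (k := k) n) (n + 1) = 0 := by
  refine LinearMap.ext fun x => ?_
  rw [← map_lowerMap (LieSubmodule.Quotient.mk' (lowSubmodule n (newtonAction k n)))
    fun m => (weylOf_apply n m).symm]
  refine (LieSubmodule.Quotient.mk_eq_zero _).mpr (LieSubmodule.subset_lieSpan ?_)
  -- A product of `n + 1` lowering operators has weight `n - 2(n+1) = -n - 2`, below the bound.
  refine Submodule.mem_iSup_of_mem (-(n : ℤ) - 2) (Submodule.mem_iSup_of_mem (by omega) ?_)
  refine Module.End.mem_eigenspace_iff.mpr ?_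
  rw [LieModule.toEnd_apply_apply, (isHighestWeight_vermaOf n).lie_hElt_one_lowerMap]
  congr 1
  push_cast
  ring

theorem exists_sum_lowerMap_weylOf (v : WeylModule n (newtonAction k n)) :
    ∃ x : ∀ r, BiSym k r n, v = ∑ r ∈ Finset.range (n + 1), lowerMap (weylOf n) r (x r) := by
  refine (isHighestWeight_weylOf n).exists_sum_lowerMap (lowerMap_weylOf n) (fun N hN => ?_) v
  have h := Verma.eq_top_of_of_mem _
    (N.comap (LieSubmodule.Quotient.mk' (lowSubmodule n (newtonAction k n)))) hN
  refine eq_top_iff.mpr fun v _ => ?_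
  obtain ⟨z, rfl⟩ := LieSubmodule.Quotient.surjective_mk' _ v
  exact (h ▸ LieSubmodule.mem_top z : z ∈ N.comap _)

end WeylModule

/-! ### Symmetric tensors of the loop module -/

section Components

variable {k : Type*} [Field k]

scoped instance : Bracket (Current k (Polynomial k)) (Loops k) := LieRingModule.toBracket

/-- The coordinates of an element of `L[t]` in the standard basis of `L`. -/
def loopCoord (k : Type*) [Field k] (j : Fin 2) : Loops k →ₗ[k] Polynomial k :=
  (TensorProduct.rid k (Polynomial k)).toLinearMap ∘ₗ
    LinearMap.lTensor (Polynomial k) (LinearMap.proj j)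

theorem loopCoord_tmul (j : Fin 2) (b : Polynomial k) (v : Fin 2 → k) :
    loopCoord k j (b ⊗ₜ v) = v j • b := by
  simp [loopCoord]

theorem loopCoord_lie_tmul (j : Fin 2) (a : Polynomial k)
    (x : LieAlgebra.SpecialLinear.sl (Fin 2) k) (u : Loops k) :
    loopCoord k j ⁅(a ⊗ₜ x : Current k (Polynomial k)), u⁆ =
      x.1 j 0 • (a * loopCoord k 0 u) + x.1 j 1 • (a * loopCoord k 1 u) := by
  induction u using TensorProduct.induction_on with
  | zero => rw [lie_zero, map_zero, map_zero, map_zero, mul_zero, smul_zero, smul_zero, add_zero]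
  | add u v hu hv =>
    rw [lie_add, map_add, hu, hv, map_add, map_add, mul_add, mul_add, smul_add, smul_add]
    abel
  | tmul b v =>
    have hv : ⁅x, v⁆ j = x.1 j 0 * v 0 + x.1 j 1 * v 1 := by
      change Matrix.mulVec x.1 v j = _
      rw [Matrix.mulVec, dotProduct, Fin.sum_univ_two]
    refine (congrArg (loopCoord k j) (LieAlgebra.ExtendScalars.bracket_tmul _ _ _ _ _ _ _ _)).trans ?_
    rw [loopCoord_tmul, loopCoord_tmul, loopCoord_tmul, hv,
      mul_smul_comm, mul_smul_comm, smul_smul, smul_smul, add_smul]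

theorem loopCoord_eElt (j : Fin 2) (a : Polynomial k) (u : Loops k) :
    loopCoord k j ⁅eElt k a, u⁆ = (![a, 0] : Fin 2 → Polynomial k) j * loopCoord k 1 u := by
  rw [eElt, loopCoord_lie_tmul]
  fin_cases j <;> simp

theorem loopCoord_hElt (j : Fin 2) (a : Polynomial k) (u : Loops k) :
    loopCoord k j ⁅hElt k a, u⁆ = (![a, -a] : Fin 2 → Polynomial k) j * loopCoord k j u := by
  rw [hElt, loopCoord_lie_tmul]
  fin_cases j <;> simp

theorem loopCoord_fElt (j : Fin 2) (a : Polynomial k) (u : Loops k) :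
    loopCoord k j ⁅fElt a, u⁆ = (![0, a] : Fin 2 → Polynomial k) j * loopCoord k 0 u := by
  rw [fElt, loopCoord_lie_tmul]
  fin_cases j <;> simp

variable {n : ℕ}

/-- The components of an element of `L[t]^{⊗n}`. -/
def component (ε : Fin n → Fin 2) : (⨂[k]^n (Loops k)) →ₗ[k] MvPolynomial (Fin n) k :=
  PiTensorProduct.lift ((MultilinearMap.mkPiAlgebra k (Fin n) (MvPolynomial (Fin n) k)).compLinearMap
    fun i => (Polynomial.aeval (MvPolynomial.X i)).toLinearMap ∘ₗ loopCoord k (ε i))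

theorem component_tprod (ε : Fin n → Fin 2) (v : Fin n → Loops k) :
    component ε (PiTensorProduct.tprod k v) =
      ∏ i, Polynomial.aeval (MvPolynomial.X i) (loopCoord k (ε i) (v i)) := by
  rw [component, PiTensorProduct.lift.tprod]
  rfl

theorem component_tprod_tmul_single (ε δ : Fin n → Fin 2) (α : Fin n →₀ ℕ) :
    component ε (PiTensorProduct.tprod k fun i =>
      ((Polynomial.X ^ α i : Polynomial k) ⊗ₜ[k] (Pi.single (δ i) (1 : k) : Fin 2 → k) : Loops k)) =
      if ε = δ then MvPolynomial.monomial α 1 else 0 := by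
  rw [component_tprod]
  split_ifs with h
  · subst h
    rw [MvPolynomial.monomial_eq, map_one, one_mul, Finsupp.prod_fintype _ _ (by simp)]
    refine Finset.prod_congr rfl fun i _ => ?_
    rw [loopCoord_tmul, Pi.single_eq_same, one_smul, map_pow, Polynomial.aeval_X]
  · obtain ⟨i, hi⟩ := Function.ne_iff.mp h
    refine Finset.prod_eq_zero (Finset.mem_univ i) ?_
    rw [loopCoord_tmul, Pi.single_eq_of_ne hi, zero_smul, map_zero]

/-- The monomial coefficients of the components are the coordinates in the tensor power of the basis
`t ^ j ⊗ vᵢ` of `L[t]`. -/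
theorem eq_zero_of_component_eq_zero {z : ⨂[k]^n (Loops k)} (h : ∀ ε, component ε z = 0) :
    z = 0 := by
  let b : Module.Basis (ℕ × Fin 2) k (Loops k) :=
    (Polynomial.basisMonomials k).tensorProduct (Pi.basisFun k (Fin 2))
  let B : Module.Basis (Fin n → ℕ × Fin 2) k (⨂[k]^n (Loops k)) :=
    Basis.piTensorProduct fun _ => b
  have hB : ∀ q p : Fin n → ℕ × Fin 2, MvPolynomial.coeff
      (Finsupp.equivFunOnFinite.symm fun i => (q i).1) (component (fun i => (q i).2) (B p)) =
        B.repr (B p) q := fun q p => by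
    have hp : B p = PiTensorProduct.tprod k fun i =>
        ((Polynomial.X ^ (Finsupp.equivFunOnFinite.symm fun i => (p i).1) i : Polynomial k) ⊗ₜ[k]
          (Pi.single (p i).2 (1 : k) : Fin 2 → k) : Loops k) := by
      rw [Basis.piTensorProduct_apply]
      congr 1
      funext i
      refine (Module.Basis.tensorProduct_apply _ _ _ _).trans ?_
      rw [Pi.basisFun_apply, Polynomial.coe_basisMonomials, Polynomial.X_pow_eq_monomial]
      rfl
    rw [B.repr_self, hp, component_tprod_tmul_single]
    by_cases hqp : p = q
    · subst hqp
      simp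
    · rw [Finsupp.single_eq_of_ne (Ne.symm hqp)]
      split_ifs with h2
      · rw [MvPolynomial.coeff_monomial, if_neg]
        intro h3
        refine hqp (funext fun i => Prod.ext ?_ (congrFun h2 i).symm)
        exact congrFun (Finsupp.equivFunOnFinite.symm.injective h3) i
      · rw [MvPolynomial.coeff_zero]
  refine B.forall_coord_eq_zero_iff.mp fun q => ?_
  have h2 : MvPolynomial.lcoeff k (Finsupp.equivFunOnFinite.symm fun i => (q i).1) ∘ₗ
      component (fun i => (q i).2) = B.coord q := B.ext fun p => hB q p
  rw [← h2, LinearMap.comp_apply, h, map_zero]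

theorem component_reindex (ε : Fin n → Fin 2) (σ : Equiv.Perm (Fin n)) (z : ⨂[k]^n (Loops k)) :
    component ε (PiTensorProduct.reindex k (fun _ => Loops k) σ z) =
      MvPolynomial.rename σ (component (ε ∘ σ) z) := by
  have h : component ε ∘ₗ (PiTensorProduct.reindex k (fun _ => Loops k) σ).toLinearMap =
      (MvPolynomial.rename σ).toLinearMap ∘ₗ component (ε ∘ σ) := by
    refine PiTensorProduct.ext (MultilinearMap.ext fun v => ?_)
    simp only [LinearMap.compMultilinearMap_apply, LinearMap.comp_apply, LinearEquiv.coe_coe,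
      PiTensorProduct.reindex_tprod, component_tprod, AlgHom.toLinearMap_apply, map_prod]
    refine (Fintype.prod_equiv σ _ _ fun i => ?_).symm
    rw [← Polynomial.aeval_algHom_apply, MvPolynomial.rename_X, Equiv.symm_apply_apply]
    rfl
  exact LinearMap.congr_fun h z

/-- The action on components of an element that acts on `L[t]` by a monomial matrix. -/
theorem component_lie (g : Current k (Polynomial k)) (c : Fin 2 → Polynomial k)
    (τ : Fin 2 → Fin 2) (hg : ∀ j u, loopCoord k j ⁅g, u⁆ = c j * loopCoord k (τ j) u)
    (ε : Fin n → Fin 2) (z : ⨂[k]^n (Loops k)) :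
    component ε ⁅g, z⁆ = ∑ i, Polynomial.aeval (MvPolynomial.X i) (c (ε i)) *
      component (Function.update ε i (τ (ε i))) z := by
  have h : component ε ∘ₗ tensorAction (k := k) (Loops k) n g =
      ∑ i, LinearMap.mulLeft k (Polynomial.aeval (MvPolynomial.X i) (c (ε i))) ∘ₗ
        component (Function.update ε i (τ (ε i))) := by
    refine PiTensorProduct.ext (MultilinearMap.ext fun v => ?_)
    simp only [LinearMap.compMultilinearMap_apply, LinearMap.comp_apply, tensorAction_tprod,
      map_sum, LinearMap.sum_apply, LinearMap.mulLeft_apply, component_tprod]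
    refine Finset.sum_congr rfl fun i _ => ?_
    rw [← Finset.mul_prod_erase _ _ (Finset.mem_univ i),
      ← Finset.mul_prod_erase _ (fun j => Polynomial.aeval _ (loopCoord k _ (v j)))
        (Finset.mem_univ i), Function.update_self, Function.update_self, hg, map_mul, mul_assoc]
    congr 2
    refine Finset.prod_congr rfl fun j hj => ?_
    rw [Function.update_of_ne (Finset.ne_of_mem_erase hj),
      Function.update_of_ne (Finset.ne_of_mem_erase hj)]
  refine (LinearMap.congr_fun h z).trans ?_
  simp only [LinearMap.sum_apply, LinearMap.comp_apply, LinearMap.mulLeft_apply]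

/-- The `sl₂[t]`-module of symmetric tensors of degree `n` of `L[t]`. -/
abbrev SymLoops (k : Type*) [Field k] (n : ℕ) :
    LieSubmodule k (Current k (Polynomial k)) (⨂[k]^n (Loops k)) :=
  symTensors (k := k) (G := Current k (Polynomial k)) (Loops k) n

scoped instance : AddCommGroup (SymLoops k n) := AddSubgroupClass.toAddCommGroup (SymLoops k n)

scoped instance : AddCommMonoid (SymLoops k n) :=
  (AddSubgroupClass.toAddCommGroup (SymLoops k n)).toAddCommMonoid

scoped instance : Zero (SymLoops k n) :=
  (AddSubgroupClass.toAddCommGroup (SymLoops k n)).toAddCommMonoid.toZero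

scoped instance : Module k (SymLoops k n) := SubmoduleClass.module (SymLoops k n)

theorem SymLoops.component_eq {z : ⨂[k]^n (Loops k)} (hz : z ∈ SymLoops k n) (ε : Fin n → Fin 2)
    (σ : Equiv.Perm (Fin n)) : component ε z = MvPolynomial.rename σ (component (ε ∘ σ) z) := by
  rw [← component_reindex, hz σ]

/-- The tensors all of whose factors are multiples of the highest weight vector. -/
def highTensor (k : Type*) [Field k] (n : ℕ) : MvPolynomial (Fin n) k →ₗ[k] ⨂[k]^n (Loops k) :=
  (MvPolynomial.basisMonomials (Fin n) k).constr k fun α => PiTensorProduct.tprod k fun i =>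
    ((Polynomial.X ^ α i : Polynomial k) ⊗ₜ[k] (Pi.single 0 (1 : k) : Fin 2 → k) : Loops k)

theorem component_highTensor (ε : Fin n → Fin 2) (m : MvPolynomial (Fin n) k) :
    component ε (highTensor k n m) = if ε = fun _ => 0 then m else 0 := by
  have h : component ε ∘ₗ highTensor k n = if ε = fun _ => 0 then LinearMap.id else 0 := by
    refine (MvPolynomial.basisMonomials (Fin n) k).ext fun α => ?_
    rw [LinearMap.comp_apply, highTensor, Module.Basis.constr_basis]
    refine (component_tprod_tmul_single ε (fun _ => 0) α).trans ?_
    split_ifs <;> simp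
  refine (LinearMap.congr_fun h m).trans ?_
  split_ifs <;> rfl

theorem highTensor_mem (m : SymPoly k n) : highTensor k n m ∈ SymLoops k n := fun σ => by
  refine sub_eq_zero.mp (eq_zero_of_component_eq_zero fun ε => ?_)
  rw [map_sub, component_reindex, component_highTensor, component_highTensor, sub_eq_zero]
  have h : (ε ∘ σ = fun _ => 0) ↔ ε = fun _ => 0 := by
    refine ⟨fun h => funext fun i => ?_, fun h => by rw [h]; rfl⟩
    rw [← σ.apply_symm_apply i]
    exact congrFun h _
  rw [if_congr h rfl rfl]
  split_ifs
  · exact m.2 σ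
  · exact map_zero _

/-- The highest weight map to the symmetric tensors. -/
def symHigh (k : Type*) [Field k] (n : ℕ) : SymPoly k n →ₗ[k] SymLoops k n :=
  (highTensor k n ∘ₗ (MvPolynomial.symmetricSubalgebra (Fin n) k).val.toLinearMap).codRestrict
    (SymLoops k n).toSubmodule highTensor_mem

theorem coe_symHigh (m : SymPoly k n) :
    (symHigh k n m : ⨂[k]^n (Loops k)) = highTensor k n m := rfl

theorem component_symHigh (ε : Fin n → Fin 2) (m : SymPoly k n) :
    component ε (symHigh k n m : ⨂[k]^n (Loops k)) =
      if ε = fun _ => 0 then (m : MvPolynomial (Fin n) k) else 0 := by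
  rw [coe_symHigh, component_highTensor]

theorem SymLoops.ext {z z' : SymLoops k n}
    (h : ∀ ε, component ε (z : ⨂[k]^n (Loops k)) = component ε (z' : ⨂[k]^n (Loops k))) :
    z = z' :=
  Subtype.ext (sub_eq_zero.mp (eq_zero_of_component_eq_zero fun ε => by
    rw [map_sub, h, sub_self]))

/-- A component of `e(a) z` reads components of `z` with some index equal to `1`, where a highest
tensor is zero. On the component with all indices `0`, the element `h(a)` multiplies by `∑ a(xᵢ)`.
-/
theorem isHighestWeight_symHigh : IsHighestWeight n (symHigh k n) where
  lie_e a m := SymLoops.ext fun ε => by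
    rw [LieSubmodule.coe_bracket, component_lie _ _ (fun _ => 1) (fun j u => loopCoord_eElt j a u)]
    refine (Finset.sum_eq_zero fun i _ => ?_).trans (map_zero _).symm
    rw [component_symHigh, if_neg, mul_zero]
    intro h
    have := congrFun h i
    simp at this
  lie_h a m := SymLoops.ext fun ε => by
    rw [LieSubmodule.coe_bracket, component_lie _ _ id (fun j u => loopCoord_hElt j a u)]
    simp only [id, Function.update_eq_self, component_symHigh]
    rw [← Finset.sum_mul]
    split_ifs with h
    · subst h
      rw [MulMemClass.coe_mul, coe_powerSum]
      rfl
    · exact mul_zero _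

end Components

/-! ### The Weyl module of the ring of symmetric polynomials -/

section Comparison

variable {k : Type*} [Field k] {n : ℕ}

theorem component_lie_fElt (a : Polynomial k) (ε : Fin n → Fin 2) (z : ⨂[k]^n (Loops k)) :
    component ε ⁅fElt a, z⁆ = ∑ i ∈ Finset.univ.filter fun i => ε i = 1,
      Polynomial.aeval (MvPolynomial.X i) a * component (Function.update ε i 0) z := by
  rw [component_lie _ _ (fun _ => 0) (fun j u => loopCoord_fElt j a u), Finset.sum_filter]
  refine Finset.sum_congr rfl fun i _ => ?_
  split_ifs with h
  · rw [h]
    rfl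
  · have h0 : ε i = 0 := by omega
    rw [h0]
    exact (congrArg (· * _) (map_zero _)).trans (zero_mul _)

/-- Each `f(a)` lowers one factor and multiplies by `a` there; `r!` counts the orders in which the
`r` chosen positions are lowered. -/
theorem component_lowerOp_pow_smul (a : Polynomial k) (r : ℕ) (m : SymPoly k n) (ε : Fin n → Fin 2) :
    component ε ((lowerOp k (SymLoops k n) a ^ r • symHigh k n m : SymLoops k n) :
      ⨂[k]^n (Loops k)) = if (Finset.univ.filter fun i => ε i = 1).card = r then
        r.factorial • ((∏ i ∈ Finset.univ.filter fun i => ε i = 1,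
          Polynomial.aeval (MvPolynomial.X i) a) * (m : MvPolynomial (Fin n) k)) else 0 := by
  induction r generalizing ε with
  | zero =>
    rw [pow_zero, one_smul, component_symHigh]
    by_cases h : ε = fun _ => 0
    · subst h
      simp
    · rw [if_neg h, if_neg]
      intro h2
      refine h (funext fun i => ?_)
      have h3 := Finset.filter_eq_empty_iff.mp (Finset.card_eq_zero.mp h2) (Finset.mem_univ i)
      omega
  | succ r ih =>
    rw [pow_succ', mul_smul, lowerOp_smul, LieSubmodule.coe_bracket, component_lie_fElt]
    have h1 : ∀ i ∈ Finset.univ.filter fun i => ε i = 1,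
        Polynomial.aeval (MvPolynomial.X i : MvPolynomial (Fin n) k) a *
          component (Function.update ε i 0) ((lowerOp k (SymLoops k n) a ^ r • symHigh k n m :
            SymLoops k n) : ⨂[k]^n (Loops k)) =
        if (Finset.univ.filter fun i => ε i = 1).card = r + 1 then
          r.factorial • ((∏ i ∈ Finset.univ.filter fun i => ε i = 1,
            Polynomial.aeval (MvPolynomial.X i) a) * (m : MvPolynomial (Fin n) k)) else 0 :=
      fun i hmem => by
        have he : (Finset.univ.filter fun j => Function.update ε i 0 j = 1) =
            (Finset.univ.filter fun i => ε i = 1).erase i := by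
          ext j
          by_cases hj : j = i
          · subst hj; simp
          · simp [hj]
        have hc : ((Finset.univ.filter fun i => ε i = 1).card - 1 = r) ↔
            (Finset.univ.filter fun i => ε i = 1).card = r + 1 := by
          have := Finset.card_pos.mpr ⟨i, hmem⟩
          omega
        rw [ih, he, Finset.card_erase_of_mem hmem, if_congr hc rfl rfl, mul_ite,
          mul_zero, ← Finset.mul_prod_erase _ _ hmem, mul_smul_comm, mul_assoc]
    refine (Finset.sum_congr rfl h1).trans ?_
    rw [Finset.sum_const]
    split_ifs with h
    · rw [h, smul_smul, Nat.factorial_succ]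
    · exact smul_zero _

/-- The sequence `1, …, 1, 0, …, 0` with `r` ones. -/
def initialOnes (n r : ℕ) : Fin n → Fin 2 := fun i => if (i : ℕ) < r then 1 else 0

theorem initialOnes_castAdd {r s : ℕ} (i : Fin r) : initialOnes (r + s) r (Fin.castAdd s i) = 1 :=
  if_pos i.2

theorem initialOnes_natAdd {r s : ℕ} (i : Fin s) : initialOnes (r + s) r (Fin.natAdd r i) = 0 :=
  if_neg (by simp)

theorem initialOnes_comp_joinPerm {r s : ℕ} (σ : Equiv.Perm (Fin r)) (τ : Equiv.Perm (Fin s)) :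
    initialOnes (r + s) r ∘ joinPerm σ τ = initialOnes (r + s) r := by
  funext i
  rw [Function.comp_apply]
  induction i using Fin.addCases with
  | left i => rw [joinPerm_castAdd, initialOnes_castAdd, initialOnes_castAdd]
  | right i => rw [joinPerm_natAdd, initialOnes_natAdd, initialOnes_natAdd]

theorem prod_initialOnes {B : Type*} [CommMonoid B] (r s : ℕ) (f : Fin (r + s) → B) :
    ∏ i ∈ Finset.univ.filter (fun i => initialOnes (r + s) r i = 1), f i =
      ∏ i : Fin r, f (Fin.castAdd s i) := by
  rw [Finset.prod_filter, Fin.prod_univ_add]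
  simp only [initialOnes_castAdd, initialOnes_natAdd, if_true, zero_ne_one, if_false,
    Finset.prod_const_one, mul_one]

theorem card_initialOnes (r s : ℕ) :
    (Finset.univ.filter fun i => initialOnes (r + s) r i = 1).card = r := by
  rw [Finset.card_filter, Fin.sum_univ_add]
  simp only [initialOnes_castAdd, initialOnes_natAdd, if_true, zero_ne_one, if_false,
    Finset.sum_const_zero, add_zero, Finset.sum_const, Finset.card_univ, Fintype.card_fin,
    smul_eq_mul, mul_one]

theorem exists_comp_eq_initialOnes (ε : Fin n → Fin 2) :
    ∃ r ≤ n, ∃ σ : Equiv.Perm (Fin n), ε ∘ σ = initialOnes n r := by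
  have hle : (Finset.univ.filter fun i => ε i = 1).card ≤ n :=
    (Finset.card_filter_le _ _).trans (by simp)
  obtain ⟨r, hr⟩ : ∃ r, r = (Finset.univ.filter fun i => ε i = 1).card := ⟨_, rfl⟩
  rw [← hr] at hle
  obtain ⟨s, rfl⟩ := Nat.exists_eq_add_of_le hle
  have hcard : Fintype.card {i // initialOnes (r + s) r i = 1} = Fintype.card {i // ε i = 1} := by
    rw [Fintype.card_subtype, Fintype.card_subtype]
    exact (card_initialOnes r s).trans hr
  let e := Fintype.equivOfCardEq hcard
  refine ⟨r, hle, e.extendSubtype, funext fun i => ?_⟩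
  rw [Function.comp_apply]
  by_cases hi : initialOnes (r + s) r i = 1
  · rw [hi]
    exact e.extendSubtype_mem i hi
  · have h2 := e.extendSubtype_not_mem i hi
    omega

/-- Every index sequence is a permutation of one that begins with its ones, and the components of a
symmetric tensor are permuted accordingly. -/
theorem SymLoops.ext_initialOnes {z z' : SymLoops k n}
    (h : ∀ r ≤ n, component (initialOnes n r) (z : ⨂[k]^n (Loops k)) =
      component (initialOnes n r) (z' : ⨂[k]^n (Loops k))) : z = z' :=
  SymLoops.ext fun ε => by
    obtain ⟨r, hr, σ, hσ⟩ := exists_comp_eq_initialOnes ε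
    rw [SymLoops.component_eq z.2 ε σ, SymLoops.component_eq z'.2 ε σ, hσ, h r hr]

variable [CharZero k]

/-- On `a(x₁) ⋯ a(xᵣ) ⊗ m` the component is `r!` times the product of both polynomials in all
variables. Since `join` is injective, the relations among `r` lowering operators in the symmetric
tensors are exactly the kernel of `restrict`. -/
theorem component_lowerMap (r s : ℕ) (x : BiSym k r (r + s)) :
    component (initialOnes (r + s) r)
      (lowerMap (symHigh k (r + s)) r x : ⨂[k]^(r + s) (Loops k)) =
        r.factorial • BiSym.join k r s (BiSym.restrict k r s x) := by
  have h : component (initialOnes (r + s) r) ∘ₗ (SymLoops k (r + s)).toSubmodule.subtype ∘ₗ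
      lowerMap (symHigh k (r + s)) r =
        r.factorial • ((BiSym.join k r s).comp (BiSym.restrict k r s)).toLinearMap :=
    BiSym.linearMap_ext_powerProd fun a m => by
      rw [LinearMap.smul_apply, AlgHom.toLinearMap_apply, AlgHom.comp_apply,
        join_restrict_inl_mul_inr, LinearMap.comp_apply, LinearMap.comp_apply, lowerMap_powerProd]
      refine (component_lowerOp_pow_smul a r m _).trans ?_
      rw [if_pos (card_initialOnes r s), prod_initialOnes, coe_powerProd, map_prod]
      simp only [← Polynomial.aeval_algHom_apply, MvPolynomial.rename_X]
  exact LinearMap.congr_fun h x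

theorem component_lowerMap_of_ne {r r' s : ℕ} (h : r' ≠ r) (x : BiSym k r' (r + s)) :
    component (initialOnes (r + s) r)
      (lowerMap (symHigh k (r + s)) r' x : ⨂[k]^(r + s) (Loops k)) = 0 := by
  have h : component (initialOnes (r + s) r) ∘ₗ (SymLoops k (r + s)).toSubmodule.subtype ∘ₗ
      lowerMap (symHigh k (r + s)) r' = 0 :=
    BiSym.linearMap_ext_powerProd fun a m => by
      rw [LinearMap.comp_apply, LinearMap.comp_apply, lowerMap_powerProd]
      refine (component_lowerOp_pow_smul a r' m _).trans ?_
      rw [if_neg (by rw [card_initialOnes]; exact h.symm)]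
      rfl
  exact LinearMap.congr_fun h x

theorem component_sum_lowerMap (r s : ℕ) (x : ∀ r', BiSym k r' (r + s)) :
    component (initialOnes (r + s) r) ((∑ r' ∈ Finset.range (r + s + 1),
      lowerMap (symHigh k (r + s)) r' (x r') : SymLoops k (r + s)) : ⨂[k]^(r + s) (Loops k)) =
        r.factorial • BiSym.join k r s (BiSym.restrict k r s (x r)) := by
  have h := map_sum (component (initialOnes (r + s) r) ∘ₗ (SymLoops k (r + s)).toSubmodule.subtype)
    (fun r' => lowerMap (symHigh k (r + s)) r' (x r')) (Finset.range (r + s + 1))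
  refine h.trans ((Finset.sum_eq_single_of_mem r (Finset.mem_range.mpr (by omega)) ?_).trans
    (component_lowerMap r s (x r)))
  exact fun r' _ hr => component_lowerMap_of_ne hr _

theorem factorial_smul_join_eq_zero {r s : ℕ} {x : BiSym k r s}
    (h : r.factorial • BiSym.join k r s x = 0) : x = 0 := by
  rw [← Nat.cast_smul_eq_nsmul k] at h
  have h2 := (smul_eq_zero.mp h).resolve_left (Nat.cast_ne_zero.mpr r.factorial_ne_zero)
  exact BiSym.join_injective r s (h2.trans (map_zero _).symm)

/-- The index sequence is fixed by `S_r × S_s`, so the component is invariant under this group,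
hence in the range of `join`; `restrict` is onto, and `r!` is invertible. -/
theorem exists_join_restrict_eq {r s : ℕ} {z : ⨂[k]^(r + s) (Loops k)} (hz : z ∈ SymLoops k (r + s)) :
    ∃ x : BiSym k r (r + s), r.factorial • BiSym.join k r s (BiSym.restrict k r s x) =
      component (initialOnes (r + s) r) z := by
  obtain ⟨y, hy⟩ := BiSym.mem_range_join (p := component (initialOnes (r + s) r) z) fun σ τ => by
    have h := SymLoops.component_eq hz (initialOnes (r + s) r) (joinPerm σ τ)
    rw [initialOnes_comp_joinPerm] at h
    exact h.symm
  obtain ⟨x, rfl⟩ := BiSym.restrict_surjective r s y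
  refine ⟨((r.factorial : k)⁻¹) • x, ?_⟩
  rw [map_smul, map_smul, ← Nat.cast_smul_eq_nsmul k, smul_smul,
    mul_inv_cancel₀ (Nat.cast_ne_zero.mpr r.factorial_ne_zero), one_smul]
  exact hy

/-- On each component `h(1)` acts by the number of zeros minus the number of ones in the index, an
integer that is at least `-n` and so differs from `ℓ`. -/
theorem eq_zero_of_lie_hElt_one {ℓ : ℤ} (hℓ : ℓ < -n) {z : SymLoops k n}
    (h : ⁅hElt k (1 : Polynomial k), z⁆ = (ℓ : k) • z) : z = 0 := by
  refine SymLoops.ext fun ε => ?_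
  have h1 : component ε (⁅hElt k (1 : Polynomial k), z⁆ : SymLoops k n).1 =
      (ℓ : k) • component ε z.1 := by
    rw [h, ← map_smul]
    rfl
  rw [LieSubmodule.coe_bracket, component_lie _ _ id (fun j u => loopCoord_hElt j 1 u)] at h1
  simp only [id, Function.update_eq_self] at h1
  have h2 : ∀ i, Polynomial.aeval (MvPolynomial.X i : MvPolynomial (Fin n) k)
      ((![1, -1] : Fin 2 → Polynomial k) (ε i)) =
        (((![1, -1] : Fin 2 → ℤ) (ε i) : ℤ) : MvPolynomial (Fin n) k) := fun i => by
    generalize ε i = j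
    fin_cases j <;> simp
  rw [← Finset.sum_mul, Finset.sum_congr rfl fun i _ => h2 i, ← Int.cast_sum,
    MvPolynomial.smul_eq_C_mul, map_intCast, ← sub_eq_zero, ← sub_mul, ← Int.cast_sub] at h1
  have h3 : -(n : ℤ) ≤ ∑ i, (![1, -1] : Fin 2 → ℤ) (ε i) := by
    have : ∑ i : Fin n, (-1 : ℤ) ≤ ∑ i, (![1, -1] : Fin 2 → ℤ) (ε i) :=
      Finset.sum_le_sum fun i _ => by
        generalize ε i = j
        fin_cases j <;> simp
    simpa using this
  refine ((mul_eq_zero.mp h1).resolve_left (Int.cast_ne_zero.mpr ?_)).trans (map_zero _).symm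
  omega

/-- A homomorphism of Lie modules that vanishes on a submodule factors through the quotient. -/
theorem exists_lieModuleHom_quotient {R L V W : Type*} [CommRing R] [LieRing L] [LieAlgebra R L]
    [AddCommGroup V] [Module R V] [LieRingModule L V] [LieModule R L V]
    [AddCommGroup W] [Module R W] [LieRingModule L W] [LieModule R L W]
    (N : LieSubmodule R L V) (ψ : V →ₗ⁅R, L⁆ W) (h : N ≤ ψ.ker) :
    ∃ φ : V ⧸ N →ₗ⁅R, L⁆ W, ∀ v, φ (LieSubmodule.Quotient.mk' N v) = ψ v := by
  let f : V ⧸ N →ₗ[R] W := N.toSubmodule.liftQ (ψ : V →ₗ[R] W) fun v hv => h hv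
  have hf : ∀ v, f (LieSubmodule.Quotient.mk' N v) = ψ v := fun v => rfl
  refine ⟨{ f with map_lie' := fun {x v} => ?_ }, hf⟩
  obtain ⟨v, rfl⟩ := LieSubmodule.Quotient.surjective_mk' N v
  change f ⁅x, LieSubmodule.Quotient.mk' N v⁆ = ⁅x, f (LieSubmodule.Quotient.mk' N v)⁆
  rw [← LieModuleHom.map_lie, hf, hf, LieModuleHom.map_lie]

variable (k n) in
theorem exists_weylModule_hom : ∃ φ : WeylModule n (newtonAction k n)
    →ₗ⁅k, Current k (Polynomial k)⁆ SymLoops k n, ∀ m, φ (weylOf n m) = symHigh k n m := by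
  obtain ⟨ψ, hψ⟩ := Verma.exists_lift (newtonAction k n) (symHigh k n)
    isHighestWeight_symHigh.lie_e fun a m => by
      rw [isHighestWeight_symHigh.lie_h, newtonAction_apply]
  have hle : lowSubmodule n (newtonAction k n) ≤ ψ.ker := by
    refine LieSubmodule.lieSpan_le.mpr ?_
    have h : (⨆ ℓ : ℤ, ⨆ _ : ℓ < -(n : ℤ),
        weightSpace (A := Polynomial k) (Verma (newtonAction k n)) ℓ) ≤ ψ.ker.toSubmodule :=
      iSup_le fun ℓ => iSup_le fun hℓ v hv => by
        refine ψ.mem_ker.mpr (eq_zero_of_lie_hElt_one hℓ ?_)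
        have hv2 : ⁅hElt k (1 : Polynomial k), v⁆ = (ℓ : k) • v :=
          Module.End.mem_eigenspace_iff.mp hv
        rw [← LieModuleHom.map_lie, hv2, map_smul]
    exact h
  obtain ⟨φ, hφ⟩ := exists_lieModuleHom_quotient _ ψ hle
  exact ⟨φ, fun m => (hφ _).trans (hψ m)⟩

variable {φ : WeylModule n (newtonAction k n) →ₗ⁅k, Current k (Polynomial k)⁆ SymLoops k n}

theorem weylModule_hom_sum (hφ : ∀ m, φ (weylOf n m) = symHigh k n m) (x : ∀ r, BiSym k r n) :
    φ (∑ r ∈ Finset.range (n + 1), lowerMap (weylOf n) r (x r)) =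
      ∑ r ∈ Finset.range (n + 1), lowerMap (symHigh k n) r (x r) := by
  rw [map_sum]
  exact Finset.sum_congr rfl fun r _ => map_lowerMap φ hφ r (x r)

/-- The component at the index with `r` initial ones sees only the `r`-th summand and shows that `x
r` is in the kernel of `restrict`. The relations proved for highest weight modules then apply in the
Weyl module. -/
theorem lowerMap_weylOf_eq_zero {x : ∀ r, BiSym k r n}
    (hx : ∑ r ∈ Finset.range (n + 1), lowerMap (symHigh k n) r (x r) = 0) {r : ℕ} (hr : r ≤ n) :
    lowerMap (weylOf n) r (x r) = 0 := by
  obtain ⟨s, rfl⟩ := Nat.exists_eq_add_of_le hr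
  refine (isHighestWeight_weylOf (r + s)).lowerMap_eq_zero (lowerMap_weylOf (r + s))
    (factorial_smul_join_eq_zero ?_)
  rw [← component_sum_lowerMap r s x, hx]
  exact map_zero _

theorem injective_weylModule_hom (hφ : ∀ m, φ (weylOf n m) = symHigh k n m) :
    Function.Injective φ := by
  refine (injective_iff_map_eq_zero φ).mpr fun v hv => ?_
  obtain ⟨x, rfl⟩ := exists_sum_lowerMap_weylOf n v
  rw [weylModule_hom_sum hφ] at hv
  exact Finset.sum_eq_zero fun r hr =>
    lowerMap_weylOf_eq_zero hv (Nat.lt_succ_iff.mp (Finset.mem_range.mp hr))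

/-- The components at the initial sequences can be matched independently, because each depends only
on its own `x r`. -/
theorem exists_component_sum_lowerMap (z : SymLoops k n) : ∃ x : ∀ r, BiSym k r n, ∀ r ≤ n,
    component (initialOnes n r) ((∑ r' ∈ Finset.range (n + 1), lowerMap (symHigh k n) r' (x r') :
      SymLoops k n) : ⨂[k]^n (Loops k)) = component (initialOnes n r) (z : ⨂[k]^n (Loops k)) := by
  have h : ∀ r, ∃ y : BiSym k r n, ∀ x : ∀ r, BiSym k r n, x r = y → r ≤ n →
      component (initialOnes n r) ((∑ r' ∈ Finset.range (n + 1), lowerMap (symHigh k n) r' (x r') :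
        SymLoops k n) : ⨂[k]^n (Loops k)) = component (initialOnes n r) (z : ⨂[k]^n (Loops k)) :=
    fun r => by
      by_cases hr : r ≤ n
      · obtain ⟨s, rfl⟩ := Nat.exists_eq_add_of_le hr
        obtain ⟨y, hy⟩ := exists_join_restrict_eq z.2
        refine ⟨y, fun x hx _ => ?_⟩
        rw [component_sum_lowerMap, hx, hy]
      · exact ⟨0, fun _ _ h => absurd h hr⟩
  choose x hx using h
  exact ⟨x, fun r hr => hx r x rfl hr⟩

theorem surjective_weylModule_hom (hφ : ∀ m, φ (weylOf n m) = symHigh k n m) :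
    Function.Surjective φ := fun z => by
  obtain ⟨x, hx⟩ := exists_component_sum_lowerMap z
  exact ⟨_, (weylModule_hom_sum hφ x).trans (SymLoops.ext_initialOnes hx)⟩

variable (k n) in
theorem nonempty_weylModule_equiv : Nonempty (WeylModule n (newtonAction k n)
    ≃ₗ⁅k, Current k (Polynomial k)⁆ SymLoops k n) := by
  obtain ⟨φ, hφ⟩ := exists_weylModule_hom k n
  let e := Equiv.ofBijective φ ⟨injective_weylModule_hom hφ, surjective_weylModule_hom hφ⟩
  exact ⟨{ φ with invFun := e.symm, left_inv := e.left_inv, right_inv := e.right_inv }⟩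

end Comparison

end JordanWeyl

end

theorem mainTheorem4 (k : Type*) [Field k] [IsAlgClosed k] [CharZero k] (n : ℕ) :
    JordanWeyl.IsFreeOfRank n 1 (JordanWeyl.newtonAction k n) ∧
      Nonempty
        (JordanWeyl.WeylModule n (JordanWeyl.newtonAction k n)
          ≃ₗ⁅k, JordanWeyl.Current k (Polynomial k)⁆
        JordanWeyl.symTensors (k := k) (G := JordanWeyl.Current k (Polynomial k))
          (JordanWeyl.Loops k) n) := by
  exact ⟨JordanWeyl.isFreeOfRank_newtonAction n, JordanWeyl.nonempty_weylModule_equiv k n⟩
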